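/- **Talbot effect for nonlinear evolutions.** Notation. For a sign $\sigma\in\{1,-1\}$ and a sequence $\alpha=\{\alpha_k\}_{k\in\mathbb Z}$ of complex numbers let $\|\alpha\|_{l^{2,s}}=\big(\sum_k(1+|k|)^{2s}|\alpha_k|^2\big)^{1/2}$ and $M=\sum_k|\alpha_k|^2$. For $u_0=\sum_k\alpha_k\delta_k$ we have $\hat u_0(\xi)=\sum_k\alpha_ke^{-ik\xi}$, and for $t>0$, $e^{it\Delta}\delta_k(x)=\frac{e^{i(x-k)^2/4t}}{\sqrt{4\pi i t}}$. For $s>\frac12$, $0<\gamma<1$, $T>0$ and $\alpha\in l^{2,s}$, *a solution on $(0,T)$ with data $\alpha$* is a function $u$ that satisfies, in the sense of distributions on $(0,T)\times\mathbb R$, $$i\partial_tu+\partial_x^2u+\frac\sigma2\Big(|u|^2-\frac M{2\pi t}\Big)u=0,$$ and has the form $$u(t,x)=\sum_{k\in\mathbb Z}e^{-i\sigma\frac{|\alpha_k|^2}{4\pi}\log\sqrt t}\,(\alpha_k+R_k(t))\,e^{it\Delta}\delta_k(x),\qquad 0<t<T,\ x\in\mathbb R,$$ with $\{R_k\}\in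 C^1((0,T);l^{2,s})$ and $\sup_{0<t<T}\big(t^{-\gamma}\|\{R_k(t)\}\|_{l^{2,s}}+t\|\{\partial_tR_k(t)\}\|_{l^{2,s}}\big)<\infty$. Let $t_{p,q}=\frac1{2\pi}\frac pq$. **Statement.** Let $\sigma\in\{1,-1\}$, let $p\ge1$ be an integer, $s>\frac12$ and $0<\gamma<1$. 1. There is $\varepsilon_0\in(0,1)$, depending only on $\sigma,p,s,\gamma$, such that for every $\varepsilon\in(0,\varepsilon_0)$ and every $\alpha$ with $\|\alpha\|_{l^{2,s}}\le\varepsilon$ there is a solution with data $\alpha$ on $(0,T)$ for some $T>t_{p,1}=\frac{p}{2\pi}$, and the following holds. Let $q_\varepsilon$ be such that $\varepsilon^2\sqrt{q_\varepsilon}\log q_\varepsilon<\frac12$, let $0<\eta<1$, and suppose that $\hat u_0$ vanishes at all points at distance at least $\eta\frac\pi p$ from $2\pi\mathbb Z$. Then every solution $u$ with data $\alpha$ on an interval $(0,T)$ satisfies $$|u(t_{p,q},x)|\le\varepsilon$$ for all odd $q$ with $1\le q\le q_\varepsilon$ and $t_{p,q}<T$, and for all $x\in\mathbb R$ at distance larger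 than $\frac\eta q$ from $\frac1q\mathbb Z$. 2. The bound on $q$ can be taken arbitrarily large as $\varepsilon\to0$: for every $N$, $\varepsilon^2\sqrt N\log N<\frac12$ for all sufficiently small $\varepsilon>0$. 3. There is a family $\{\alpha^\lambda\}_{\lambda\in\mathbb R}$ in $l^{2,s}$ with $\|\alpha^\lambda\|_{l^{2,s}}\to0$ as $\lambda\to\infty$, such that for every $0<\eta<1$ and all sufficiently large $\lambda$ the function $\sum_k\alpha^\lambda_ke^{-ik\xi}$ vanishes at all points at distance at least $\eta\frac\pi p$ from $2\pi\mathbb Z$; such that for each $\lambda$ there is a solution with data $\alpha^\lambda$ on $(0,T_\lambda)$ for some $T_\lambda>t_{p,1}$; and such that for every odd $q\ge1$ and any solutions $u^\lambda$ with data $\alpha^\lambda$ on intervals $(0,T_\lambda)$ with $T_\lambda>t_{p,q}$, $$\left|\frac{u^\lambda(t_{p,q},0)}{e^{it_{p,q}\Delta}\alpha_0^\lambda\delta_0(0)}\right|\longrightarrow\infty\qquad(\lambda\to\infty).$$ -/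

import Mathlib

open scoped ContDiff

noncomputable section

namespace DiracNLS

/-- The weight `(1 + |k|) ^ s` on the integers. -/
def weight (s : ℝ) (k : ℤ) : ℝ := (1 + |(k : ℝ)|) ^ s

/-- Membership of a sequence in the weighted space `l^{2,s}`. -/
def MemL2s (s : ℝ) (a : ℤ → ℂ) : Prop :=
  Summable fun k : ℤ => (weight s k * ‖a k‖) ^ 2

/-- The `l^{2,s}` norm `(∑ₖ (1 + |k|)^{2s} |aₖ|²)^{1/2}` (meaningful under `MemL2s s a`). -/
def l2sNorm (s : ℝ) (a : ℤ → ℂ) : ℝ :=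
  Real.sqrt (∑' k : ℤ, (weight s k * ‖a k‖) ^ 2)

/-- The Fourier transform `ξ ↦ ∑ₖ αₖ e^{-ikξ}` of the distribution `∑ₖ αₖ δₖ`. -/
def hatData (α : ℤ → ℂ) (ξ : ℝ) : ℂ :=
  ∑' k : ℤ, α k * Complex.exp (-(Complex.I * (k : ℂ) * (ξ : ℂ)))

/-- The Fourier transform of `∑ₖ αₖ δₖ` vanishes at every point whose distance to each
element of `2πℤ` is at least `r`. -/
def FourierLocalized (α : ℤ → ℂ) (r : ℝ) : Prop :=
  ∀ ξ : ℝ, (∀ n : ℤ, r ≤ |ξ - 2 * Real.pi * n|) → hatData α ξ = 0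

/-- The free Schrödinger evolution `e^{itΔ}δₖ(x) = e^{i(x-k)²/(4t)} / √(4πit)`, for `t > 0`
(principal branch of the square root). -/
def freeDirac (k : ℤ) (t x : ℝ) : ℂ :=
  Complex.exp (Complex.I * (((x - k) ^ 2 / (4 * t) : ℝ) : ℂ)) /
    (4 * (Real.pi : ℂ) * Complex.I * (t : ℂ)) ^ (1 / 2 : ℂ)

/-- The renormalizing mass `M = ∑ₖ |αₖ|²`. -/
def mass (α : ℤ → ℂ) : ℝ := ∑' k : ℤ, ‖α k‖ ^ 2

/-- `u` solves `i ∂ₜu + ∂ₓ²u + (σ/2) (|u|² - M/(2πt)) u = 0` on `(0,T) × ℝ` in the sense of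
distributions. -/
def IsWeakNLS (σ M T : ℝ) (u : ℝ → ℝ → ℂ) : Prop :=
  ∀ φ : ℝ → ℝ → ℂ,
    ContDiff ℝ ∞ (Function.uncurry φ) →
    HasCompactSupport (Function.uncurry φ) →
    tsupport (Function.uncurry φ) ⊆ Set.Ioo 0 T ×ˢ Set.univ →
    ∫ z : ℝ × ℝ,
      (u z.1 z.2 * (-(Complex.I * deriv (fun t => φ t z.2) z.1)
          + iteratedDeriv 2 (fun x => φ z.1 x) z.2)
        + ((σ / 2 * (‖u z.1 z.2‖ ^ 2 - M / (2 * Real.pi * z.1)) : ℝ) : ℂ)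
          * u z.1 z.2 * φ z.1 z.2) = 0

/-- `R` belongs to `C¹((0,T); l^{2,s})` and
`sup_{0<t<T} ( t^{-γ} ‖R(t)‖_{l^{2,s}} + t ‖∂ₜR(t)‖_{l^{2,s}} ) < ∞`.
The space `l^{2,s}` is identified isometrically with `ℓ²` through `R ↦ W`,
`Wₖ = (1 + |k|)^s Rₖ`. -/
def IsRemainder (s γ T : ℝ) (R : ℝ → ℤ → ℂ) : Prop :=
  ∃ W : ℝ → lp (fun _ : ℤ => ℂ) 2,
    (∀ t ∈ Set.Ioo 0 T, ∀ k : ℤ, W t k = (weight s k : ℂ) * R t k) ∧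
    ContDiffOn ℝ 1 W (Set.Ioo 0 T) ∧
    ∃ C : ℝ, ∀ t ∈ Set.Ioo 0 T, t ^ (-γ) * ‖W t‖ + t * ‖deriv W t‖ ≤ C

/-- `u` is, on `(0,T)`, a solution of the renormalized cubic equation with data `∑ₖ αₖ δₖ`:
it solves the equation with `M = ∑ₖ |αₖ|²` and has the form
`u(t,x) = ∑ₖ e^{-iσ (|αₖ|²/4π) log √t} (αₖ + Rₖ(t)) e^{itΔ}δₖ(x)`
with a remainder `R` as in `IsRemainder`. The sign `σ = ±1` is the one of the nonlinearity. -/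
def IsDiracSolution (σ s γ : ℝ) (α : ℤ → ℂ) (T : ℝ) (u : ℝ → ℝ → ℂ) : Prop :=
  (∃ R : ℝ → ℤ → ℂ, IsRemainder s γ T R ∧
    ∀ t ∈ Set.Ioo 0 T, ∀ x : ℝ,
      u t x = ∑' k : ℤ,
        Complex.exp (-(Complex.I *
            ((σ * (‖α k‖ ^ 2 / (4 * Real.pi)) * Real.log (Real.sqrt t) : ℝ) : ℂ)))
          * (α k + R t k) * freeDirac k t x) ∧
  IsWeakNLS σ (mass α) T u

/-- The times `t_{p,q} = (1/2π) (p/q)`. -/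
def talbotTime (p q : ℕ) : ℝ := 1 / (2 * Real.pi) * ((p : ℝ) / (q : ℝ))

/-- The lattice `(1/q) ℤ`. -/
def lattice (q : ℕ) : Set ℝ := Set.range fun n : ℤ => (n : ℝ) / (q : ℝ)

end DiracNLS

end

noncomputable section

namespace DiracNLS

open Filter Topology
open scoped ENNReal

/-! ### Discrete Young inequalities in `ℝ≥0∞` -/

/-! Write B = α + R. The product of the free modes i and l with the conjugate of mode j is, up to
the factor 1/(4πt), the mode k = i - j + l times exp(-ir/(4t)), where r = 2(k - i)(i - j). Hence u
solves the equation weakly exactly when B solves an ordinary differential equation in l^{2,s}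
(`isWeakNLS_iff`), whose vector field is singular like 1/t at t = 0.

Two mechanisms tame the singularity. For the resonant terms, r = 0, the term M/(2πt) and the
logarithmic phases remove the value at B = α, so what is left carries a factor B - α = O(t^γ) and is
integrable. The nonresonant terms oscillate: exp(-ir/(4t))/t is, to leading order, a multiple of the
time derivative of t exp(-ir/(4t))/r, and |r| ≥ 1. Subtracting this normal form correction, which is
O(t), leaves an integrable right-hand side (`hasDerivAt_sub_nfTerm`) that involves ∂ₜB only through
the bounded quantity t∂ₜB. As cubic convolutions are bounded on l^{2,s} for s > 1/2 (`norm_cub_le`),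
Picard iteration gives a solution on (0, p + 1) for small data (`exists_remainder`), and a
continuity argument gives every solution a remainder O(ε³t^γ) (`remainder_le`). No uniqueness
theorem is needed.

At t_{p,q} every solution is therefore within √q (log q + C) ε³ of the linear evolution
(`IsDiracSolution.norm_sub_linear_le`): √q is the size of t^{-1/2}, and log q comes from the phases.
Up to a factor of modulus (4πt)^{-1/2}, the linear evolution there is the sum of α_k e^{iπqk²/(2p)}
e^{-ikπqx/p}. The quadratic phase is 2p-periodic in k, and its finite Fourier expansion turns the
sum into a combination of translates of the Fourier transform of the data by multiples of π/p
(`tsum_quadPhase_mul`). For localized data all of them vanish when x is away from the lattice. At x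
= 0 exactly one survives, with a Gauss sum as coefficient, nonzero for odd q
(`sum_quadPhase_ne_zero`).

For the concentration, α is a small multiple of the Fourier coefficients of a bump of width δ → 0:
then α₀ is smaller than the value of the Fourier transform at the origin by a factor O(δ)
(`exists_localized_data`), while the nonlinear error is cubic. -/

theorem two_mul_le_sq_add_sq (a b : ℝ≥0∞) : 2 * (a * b) ≤ a ^ 2 + b ^ 2 := by
  rcases eq_or_ne a ⊤ with rfl | ha
  · simp
  rcases eq_or_ne b ⊤ with rfl | hb
  · simp
  lift a to NNReal using ha
  lift b to NNReal using hb
  norm_cast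
  rw [← NNReal.coe_le_coe]
  push_cast
  nlinarith [sq_nonneg ((a : ℝ) - b)]

theorem add_sq_le_two_mul (a b : ℝ≥0∞) : (a + b) ^ 2 ≤ 2 * (a ^ 2 + b ^ 2) := by
  calc (a + b) ^ 2 = a ^ 2 + b ^ 2 + 2 * (a * b) := by ring
    _ ≤ a ^ 2 + b ^ 2 + (a ^ 2 + b ^ 2) := by gcongr; exact two_mul_le_sq_add_sq a b
    _ = 2 * (a ^ 2 + b ^ 2) := by ring

/-- Cauchy–Schwarz by symmetrization: in the double sum the entries (i, j) and (j, i) are paired.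
Working in `ℝ≥0∞` avoids every summability hypothesis. -/
theorem tsum_mul_sq_le {ι : Type*} (a b : ι → ℝ≥0∞) :
    (∑' i, a i * b i) ^ 2 ≤ (∑' i, a i ^ 2) * ∑' i, b i ^ 2 := by
  have h2 : 2 * (∑' i, a i * b i) ^ 2 ≤ 2 * ((∑' i, a i ^ 2) * ∑' i, b i ^ 2) := by
    calc 2 * (∑' i, a i * b i) ^ 2
        = ∑' i, ∑' j, 2 * ((a i * b j) * (a j * b i)) := by
          simp_rw [sq, ← ENNReal.tsum_mul_right, ← ENNReal.tsum_mul_left]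
          refine tsum_congr fun i => tsum_congr fun j => by ring
      _ ≤ ∑' i, ∑' j, ((a i * b j) ^ 2 + (a j * b i) ^ 2) := by
          gcongr with i j
          exact two_mul_le_sq_add_sq _ _
      _ = ∑' i, ∑' j, a i ^ 2 * b j ^ 2 + ∑' i, ∑' j, a j ^ 2 * b i ^ 2 := by
          simp_rw [mul_pow, ENNReal.tsum_add]
      _ = 2 * ((∑' i, a i ^ 2) * ∑' i, b i ^ 2) := by
          simp_rw [ENNReal.tsum_mul_left, ENNReal.tsum_mul_right, ENNReal.tsum_mul_left]
          ring
  rwa [ENNReal.mul_le_mul_iff_right (by norm_num) (by norm_num)] at h2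

/-- Young's inequality ℓ¹ * ℓ² → ℓ². Only the invariance of the ℓ² norm under each `e i` is used, so
translations and reflections of ℤ are covered together. -/
theorem tsum_sq_tsum_mul_le {ι : Type*} (g : ι → ℝ≥0∞) (f : ℤ → ℝ≥0∞) (e : ι → ℤ ≃ ℤ) :
    ∑' k, (∑' i, g i * f (e i k)) ^ 2 ≤ (∑' i, g i) ^ 2 * ∑' k, f k ^ 2 := by
  have hs : ∀ i, ∑' k, f (e i k) ^ 2 = ∑' k, f k ^ 2 := fun i =>
    (e i).tsum_eq fun k => f k ^ 2
  have h2 : 2 * ∑' k, (∑' i, g i * f (e i k)) ^ 2 ≤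
      2 * ((∑' i, g i) ^ 2 * ∑' k, f k ^ 2) := by
    calc 2 * ∑' k, (∑' i, g i * f (e i k)) ^ 2
        = ∑' k, ∑' i, ∑' j, g i * g j * (2 * (f (e i k) * f (e j k))) := by
          rw [← ENNReal.tsum_mul_left]
          refine tsum_congr fun k => ?_
          simp_rw [sq, ← ENNReal.tsum_mul_right, ← ENNReal.tsum_mul_left]
          refine tsum_congr fun i => tsum_congr fun j => by ring
      _ ≤ ∑' k, ∑' i, ∑' j, g i * g j * (f (e i k) ^ 2 + f (e j k) ^ 2) := by
          gcongr with k i j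
          exact two_mul_le_sq_add_sq _ _
      _ = ∑' i, ∑' j, ∑' k, g i * g j * (f (e i k) ^ 2 + f (e j k) ^ 2) := by
          rw [ENNReal.tsum_comm]
          refine tsum_congr fun i => ?_
          rw [ENNReal.tsum_comm]
      _ = 2 * ((∑' i, g i) ^ 2 * ∑' k, f k ^ 2) := by
          simp_rw [ENNReal.tsum_mul_left, ENNReal.tsum_add, hs]
          simp_rw [ENNReal.tsum_mul_right, ENNReal.tsum_mul_left, ENNReal.tsum_mul_right]
          ring
  rwa [ENNReal.mul_le_mul_iff_right (by norm_num) (by norm_num)] at h2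

/-! ### The weight -/

theorem weight_pos (s : ℝ) (k : ℤ) : 0 < weight s k := by
  unfold weight; positivity

theorem weight_ne_zero (s : ℝ) (k : ℤ) : weight s k ≠ 0 := (weight_pos s k).ne'

theorem one_le_weight {s : ℝ} (hs : 1 / 2 < s) (k : ℤ) : 1 ≤ weight s k :=
  Real.one_le_rpow (by linarith [abs_nonneg (k : ℝ)]) (by linarith)

/-- The output frequency is at most three times the largest input, so one of the three factors can
absorb the whole weight. -/
theorem weight_le_add {s : ℝ} (hs : 1 / 2 < s) (i j l : ℤ) :
    weight s (i - j + l) ≤ 3 ^ s * (weight s i + weight s j + weight s l) := by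
  have hs0 : 0 ≤ s := by linarith
  unfold weight
  set a := 1 + |(i : ℝ)|
  set b := 1 + |(j : ℝ)|
  set c := 1 + |(l : ℝ)|
  have ha : 0 < a := by positivity
  have hb : 0 < b := by positivity
  have hc : 0 < c := by positivity
  have h1 : 1 + |((i - j + l : ℤ) : ℝ)| ≤ a + b + c := by
    have h := abs_add_le ((i : ℝ) - j) l
    have h' := abs_sub (i : ℝ) j
    simp only [a, b, c]; push_cast
    linarith
  have h2 : 1 + |((i - j + l : ℤ) : ℝ)| ≤ 3 * max a (max b c) := by
    have := le_max_left a (max b c)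
    have h3 := le_max_right a (max b c)
    have h4 := le_max_left b c
    have h5 := le_max_right b c
    linarith
  calc (1 + |((i - j + l : ℤ) : ℝ)|) ^ s ≤ (3 * max a (max b c)) ^ s :=
        Real.rpow_le_rpow (by positivity) h2 hs0
    _ = 3 ^ s * (max a (max b c)) ^ s := Real.mul_rpow (by norm_num) (by positivity)
    _ ≤ 3 ^ s * (a ^ s + b ^ s + c ^ s) := by
        have := Real.rpow_pos_of_pos ha s
        have := Real.rpow_pos_of_pos hb s
        have := Real.rpow_pos_of_pos hc s
        gcongr
        rcases max_choice b c with h | h <;> rw [h]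
        · rcases max_choice a b with h | h <;> rw [h] <;> linarith
        · rcases max_choice a c with h | h <;> rw [h] <;> linarith

/-- The source of the threshold 1/2: it gives the embedding of l^{2,s} into ℓ¹ through
Cauchy–Schwarz. -/
theorem summable_inv_weight_sq {s : ℝ} (hs : 1 / 2 < s) :
    Summable fun k : ℤ => (weight s k)⁻¹ ^ 2 := by
  have h1 : Summable fun k : ℕ => ((1 + (k : ℝ)) ^ s)⁻¹ ^ 2 := by
    have h := (summable_nat_add_iff 1).2 (Real.summable_nat_rpow.2 (show -(2 * s) < -1 by linarith))
    refine h.congr fun k => ?_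
    have hk : (0 : ℝ) ≤ 1 + k := by positivity
    rw [Real.rpow_neg (by positivity), inv_pow, ← Real.rpow_natCast, ← Real.rpow_mul hk]
    push_cast
    rw [add_comm, mul_comm]
  refine Summable.of_nat_of_neg ?_ ?_
  · refine h1.congr fun k => ?_
    simp [weight]
  · refine h1.congr fun k => ?_
    simp [weight]

/-! ### Weighted square summable sequences -/

/-- The space `ℓ²` on which weighted sequences are represented. -/
abbrev Seq := lp (fun _ : ℤ => ℂ) 2

theorem enorm_sq_eq_tsum (x : Seq) : ‖x‖ₑ ^ 2 = ∑' k, ‖x k‖ₑ ^ 2 := by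
  have h := lp.norm_rpow_eq_tsum (p := 2) (by norm_num) x
  have hsum := (lp.memℓp x).summable (by norm_num)
  simp only [ENNReal.toReal_ofNat, Real.rpow_ofNat] at h hsum
  rw [← ofReal_norm, ← ENNReal.ofReal_pow (norm_nonneg _), h,
    ENNReal.ofReal_tsum_of_nonneg (fun _ => by positivity) hsum]
  refine tsum_congr fun k => ?_
  rw [ENNReal.ofReal_pow (norm_nonneg _), ofReal_norm]

theorem memℓp_of_tsum_ne_top {f : ℤ → ℂ} (h : ∑' k, ‖f k‖ₑ ^ 2 ≠ ⊤) : Memℓp f 2 := by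
  refine memℓp_gen ?_
  simp only [ENNReal.toReal_ofNat, Real.rpow_ofNat]
  have := ENNReal.summable_toReal h
  refine this.congr fun k => ?_
  simp

theorem seq_norm_sq (x : Seq) : ‖x‖ ^ 2 = ∑' k, ‖x k‖ ^ 2 := by
  have h := lp.norm_rpow_eq_tsum (p := 2) (by norm_num) x
  simpa only [ENNReal.toReal_ofNat, Real.rpow_ofNat] using h

theorem seq_summable_sq (x : Seq) : Summable fun k => ‖x k‖ ^ 2 := by
  have h := (lp.memℓp x).summable (by norm_num)
  simpa only [ENNReal.toReal_ofNat, Real.rpow_ofNat] using h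

/-- The square sum of the inverse weights. -/
def invWeightSum (s : ℝ) : ℝ := ∑' k : ℤ, (weight s k)⁻¹ ^ 2

theorem invWeightSum_nonneg (s : ℝ) : 0 ≤ invWeightSum s :=
  tsum_nonneg fun _ => by positivity

theorem tsum_ofReal_inv_weight_sq {s : ℝ} (hs : 1 / 2 < s) :
    ∑' k : ℤ, ENNReal.ofReal (weight s k)⁻¹ ^ 2 = ENNReal.ofReal (invWeightSum s) := by
  rw [invWeightSum, ENNReal.ofReal_tsum_of_nonneg (fun _ => by positivity)
    (summable_inv_weight_sq hs)]
  refine tsum_congr fun k => ?_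
  rw [ENNReal.ofReal_pow (inv_nonneg.2 (weight_pos s k).le)]

theorem tsum_inv_weight_mul_sq_le {s : ℝ} (hs : 1 / 2 < s) (x : Seq) :
    (∑' k, ENNReal.ofReal (weight s k)⁻¹ * ‖x k‖ₑ) ^ 2 ≤
      ENNReal.ofReal (invWeightSum s) * ‖x‖ₑ ^ 2 := by
  rw [enorm_sq_eq_tsum, ← tsum_ofReal_inv_weight_sq hs]
  exact tsum_mul_sq_le _ _

/-- Weighted square summability implies absolute summability. -/
theorem summable_inv_weight_mul {s : ℝ} (hs : 1 / 2 < s) (x : Seq) :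
    Summable fun k => (weight s k)⁻¹ * ‖x k‖ := by
  have h : ∑' k, ENNReal.ofReal (weight s k)⁻¹ * ‖x k‖ₑ ≠ ⊤ := by
    intro h
    have := tsum_inv_weight_mul_sq_le hs x
    rw [h] at this
    exact ENNReal.mul_ne_top ENNReal.ofReal_ne_top (ENNReal.pow_ne_top enorm_ne_top)
      (top_le_iff.1 (by simpa using this))
  refine (ENNReal.summable_toReal h).congr fun k => ?_
  simp [ENNReal.toReal_ofReal (inv_nonneg.2 (weight_pos s k).le)]

theorem tsum_inv_weight_mul_le {s : ℝ} (hs : 1 / 2 < s) (x : Seq) :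
    ∑' k, (weight s k)⁻¹ * ‖x k‖ ≤ √(invWeightSum s) * ‖x‖ := by
  have h := tsum_inv_weight_mul_sq_le hs x
  have e : ∑' k, ENNReal.ofReal (weight s k)⁻¹ * ‖x k‖ₑ =
      ENNReal.ofReal (∑' k, (weight s k)⁻¹ * ‖x k‖) := by
    rw [ENNReal.ofReal_tsum_of_nonneg
      (fun k => mul_nonneg (inv_nonneg.2 (weight_pos s k).le) (norm_nonneg _))
      (summable_inv_weight_mul hs x)]
    refine tsum_congr fun k => ?_
    rw [ENNReal.ofReal_mul (inv_nonneg.2 (weight_pos s k).le), ofReal_norm]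
  have h0 : 0 ≤ ∑' k, (weight s k)⁻¹ * ‖x k‖ :=
    tsum_nonneg fun k => mul_nonneg (inv_nonneg.2 (weight_pos s k).le) (norm_nonneg _)
  rw [e, ← ofReal_norm, ← ENNReal.ofReal_pow h0, ← ENNReal.ofReal_pow (norm_nonneg _),
    ← ENNReal.ofReal_mul (invWeightSum_nonneg s),
    ENNReal.ofReal_le_ofReal_iff (mul_nonneg (invWeightSum_nonneg s) (sq_nonneg _))] at h
  rw [← Real.sqrt_sq h0, ← Real.sqrt_sq (norm_nonneg x), ← Real.sqrt_mul (invWeightSum_nonneg s)]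
  exact Real.sqrt_le_sqrt h

end DiracNLS

end

noncomputable section

namespace DiracNLS

open Filter Topology
open scoped ENNReal ComplexConjugate

/-! ### The trilinear operators -/

/-- The quotient of weights `w_k / (w_i w_j w_l)`, `l = k - i + j`. -/
def kern (s : ℝ) (k : ℤ) (q : ℤ × ℤ) : ℝ :=
  weight s k * ((weight s q.1)⁻¹ * (weight s q.2)⁻¹ * (weight s (k - q.1 + q.2))⁻¹)

theorem kern_nonneg (s : ℝ) (k : ℤ) (q : ℤ × ℤ) : 0 ≤ kern s k q := by
  have := weight_pos s
  unfold kern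
  have h1 := (this k).le
  have h2 := (this q.1).le
  have h3 := (this q.2).le
  have h4 := (this (k - q.1 + q.2)).le
  positivity

/-- Dividing `weight_le_add` by the three input weights leaves, in each summand, inverse weights on
two of the factors. These two become absolutely summable and the third stays in ℓ². -/
theorem kern_le {s : ℝ} (hs : 1 / 2 < s) (k : ℤ) (q : ℤ × ℤ) :
    kern s k q ≤ 3 ^ s * ((weight s q.2)⁻¹ * (weight s (k - q.1 + q.2))⁻¹
      + ((weight s q.1)⁻¹ * (weight s (k - q.1 + q.2))⁻¹
      + (weight s q.1)⁻¹ * (weight s q.2)⁻¹)) := by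
  have h := weight_le_add hs q.1 q.2 (k - q.1 + q.2)
  rw [show q.1 - q.2 + (k - q.1 + q.2) = k by ring] at h
  have hi := weight_pos s q.1
  have hj := weight_pos s q.2
  have hl := weight_pos s (k - q.1 + q.2)
  unfold kern
  calc weight s k * ((weight s q.1)⁻¹ * (weight s q.2)⁻¹ * (weight s (k - q.1 + q.2))⁻¹)
      ≤ 3 ^ s * (weight s q.1 + weight s q.2 + weight s (k - q.1 + q.2)) *
        ((weight s q.1)⁻¹ * (weight s q.2)⁻¹ * (weight s (k - q.1 + q.2))⁻¹) := by gcongr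
    _ = _ := by field_simp; ring

/-- The absolute sums majorizing all trilinear operators. -/
def cubMaj (s : ℝ) (x y z : Seq) (k : ℤ) : ℝ≥0∞ :=
  ∑' q : ℤ × ℤ, ENNReal.ofReal (kern s k q) * (‖x q.1‖ₑ * ‖y q.2‖ₑ * ‖z (k - q.1 + q.2)‖ₑ)

/-- The constant in the trilinear estimate. -/
def cubConst (s : ℝ) : ℝ := 4 * 3 ^ s * invWeightSum s

theorem cubConst_nonneg (s : ℝ) : 0 ≤ cubConst s := by
  have := invWeightSum_nonneg s
  unfold cubConst; positivity

/-- `(i, j) ↦ (j, k - i + j)` for fixed `k`. -/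
def pairEquivFst (k : ℤ) : ℤ × ℤ ≃ ℤ × ℤ where
  toFun q := (q.2, k - q.1 + q.2)
  invFun q := (k + q.1 - q.2, q.1)
  left_inv q := by ext <;> simp
  right_inv q := by ext <;> simp; ring

/-- `(i, j) ↦ (i, k - i + j)` for fixed `k`. -/
def pairEquivSnd (k : ℤ) : ℤ × ℤ ≃ ℤ × ℤ where
  toFun q := (q.1, k - q.1 + q.2)
  invFun q := (q.1, q.2 - k + q.1)
  left_inv q := by ext <;> simp; ring
  right_inv q := by ext <;> simp

theorem tsum_prod_sq_le {s : ℝ} (hs : 1 / 2 < s) (x y : Seq) :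
    (∑' q : ℤ × ℤ, ENNReal.ofReal (weight s q.1)⁻¹ * ‖x q.1‖ₑ *
      (ENNReal.ofReal (weight s q.2)⁻¹ * ‖y q.2‖ₑ)) ^ 2 ≤
      ENNReal.ofReal (invWeightSum s) ^ 2 * (‖x‖ₑ ^ 2 * ‖y‖ₑ ^ 2) := by
  rw [ENNReal.tsum_prod (f := fun i j => ENNReal.ofReal (weight s i)⁻¹ * ‖x i‖ₑ *
      (ENNReal.ofReal (weight s j)⁻¹ * ‖y j‖ₑ))]
  simp_rw [ENNReal.tsum_mul_left, ENNReal.tsum_mul_right]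
  rw [mul_pow]
  calc _ ≤ (ENNReal.ofReal (invWeightSum s) * ‖x‖ₑ ^ 2) *
        (ENNReal.ofReal (invWeightSum s) * ‖y‖ₑ ^ 2) :=
        mul_le_mul' (tsum_inv_weight_mul_sq_le hs x) (tsum_inv_weight_mul_sq_le hs y)
    _ = _ := by ring

/-- The two factors with inverse weights form an absolutely summable family over the pairs q; the
third is rearranged by `e q`, and Young's inequality applies. -/
theorem tsum_conv_sq_le {s : ℝ} (hs : 1 / 2 < s) (x y z : Seq) (e : ℤ × ℤ → ℤ ≃ ℤ) :
    ∑' k, (∑' q : ℤ × ℤ, (ENNReal.ofReal (weight s q.1)⁻¹ * ‖x q.1‖ₑ *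
      (ENNReal.ofReal (weight s q.2)⁻¹ * ‖y q.2‖ₑ)) * ‖z (e q k)‖ₑ) ^ 2 ≤
      ENNReal.ofReal (invWeightSum s) ^ 2 * (‖x‖ₑ ^ 2 * ‖y‖ₑ ^ 2 * ‖z‖ₑ ^ 2) := by
  refine (tsum_sq_tsum_mul_le _ (fun k => ‖z k‖ₑ) e).trans ?_
  rw [← enorm_sq_eq_tsum]
  calc _ ≤ ENNReal.ofReal (invWeightSum s) ^ 2 * (‖x‖ₑ ^ 2 * ‖y‖ₑ ^ 2) * ‖z‖ₑ ^ 2 := by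
        gcongr; exact tsum_prod_sq_le hs x y
    _ = _ := by ring

/-- There is one term `A1`, `A2`, `A3` for each factor that may remain in ℓ². A re-indexing at fixed
k makes the other two frequencies the summation variables. -/
theorem tsum_cubMaj_sq_le {s : ℝ} (hs : 1 / 2 < s) (x y z : Seq) :
    ∑' k, cubMaj s x y z k ^ 2 ≤
      ENNReal.ofReal (cubConst s) ^ 2 * (‖x‖ₑ ^ 2 * ‖y‖ₑ ^ 2 * ‖z‖ₑ ^ 2) := by
  set v : ℤ → ℝ≥0∞ := fun k => ENNReal.ofReal (weight s k)⁻¹ with hv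
  set A1 : ℤ → ℝ≥0∞ := fun k => ∑' q : ℤ × ℤ, (v q.1 * ‖y q.1‖ₑ * (v q.2 * ‖z q.2‖ₑ)) *
    ‖x ((Equiv.addRight (q.1 - q.2)) k)‖ₑ
  set A2 : ℤ → ℝ≥0∞ := fun k => ∑' q : ℤ × ℤ, (v q.1 * ‖x q.1‖ₑ * (v q.2 * ‖z q.2‖ₑ)) *
    ‖y ((Equiv.subLeft (q.1 + q.2)) k)‖ₑ
  set A3 : ℤ → ℝ≥0∞ := fun k => ∑' q : ℤ × ℤ, (v q.1 * ‖x q.1‖ₑ * (v q.2 * ‖y q.2‖ₑ)) *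
    ‖z ((Equiv.addRight (q.2 - q.1)) k)‖ₑ
  have hA1 := tsum_conv_sq_le hs y z x fun q => Equiv.addRight (q.1 - q.2)
  have hA2 := tsum_conv_sq_le hs x z y fun q => Equiv.subLeft (q.1 + q.2)
  have hA3 := tsum_conv_sq_le hs x y z fun q => Equiv.addRight (q.2 - q.1)
  have e1 : ∀ k, ∑' q : ℤ × ℤ, v q.2 * v (k - q.1 + q.2) *
      (‖x q.1‖ₑ * ‖y q.2‖ₑ * ‖z (k - q.1 + q.2)‖ₑ) = A1 k := fun k => by
    refine Eq.trans ?_ ((pairEquivFst k).tsum_eq _)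
    refine tsum_congr fun q => ?_
    simp only [pairEquivFst, Equiv.coe_fn_mk, Equiv.coe_addRight]
    rw [show k + (q.2 - (k - q.1 + q.2)) = q.1 by ring]
    ring
  have e2 : ∀ k, ∑' q : ℤ × ℤ, v q.1 * v (k - q.1 + q.2) *
      (‖x q.1‖ₑ * ‖y q.2‖ₑ * ‖z (k - q.1 + q.2)‖ₑ) = A2 k := fun k => by
    refine Eq.trans ?_ ((pairEquivSnd k).tsum_eq _)
    refine tsum_congr fun q => ?_
    simp only [pairEquivSnd, Equiv.coe_fn_mk, Equiv.subLeft_apply]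
    rw [show q.1 + (k - q.1 + q.2) - k = q.2 by ring]
    ring
  have e3 : ∀ k, ∑' q : ℤ × ℤ, v q.1 * v q.2 *
      (‖x q.1‖ₑ * ‖y q.2‖ₑ * ‖z (k - q.1 + q.2)‖ₑ) = A3 k := fun k => by
    refine tsum_congr fun q => ?_
    simp only [Equiv.coe_addRight]
    rw [show k + (q.2 - q.1) = k - q.1 + q.2 by ring]
    ring
  have hle : ∀ k, cubMaj s x y z k ≤ ENNReal.ofReal (3 ^ s) * (A1 k + (A2 k + A3 k)) := fun k => by
    rw [← e1, ← e2, ← e3, ← ENNReal.tsum_add, ← ENNReal.tsum_add, ← ENNReal.tsum_mul_left]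
    refine ENNReal.tsum_le_tsum fun q => ?_
    rw [← add_mul, ← add_mul, ← mul_assoc (ENNReal.ofReal (3 ^ s))]
    refine mul_le_mul' ?_ le_rfl
    refine (ENNReal.ofReal_le_ofReal (kern_le hs k q)).trans (le_of_eq ?_)
    have h := fun i => inv_nonneg.2 (weight_pos s i).le
    simp only [hv]
    rw [ENNReal.ofReal_mul (by positivity), ENNReal.ofReal_add, ENNReal.ofReal_add,
      ENNReal.ofReal_mul (h _), ENNReal.ofReal_mul (h _), ENNReal.ofReal_mul (h _)]
    all_goals
      have := h q.1
      have := h q.2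
      have := h (k - q.1 + q.2)
      positivity
  calc ∑' k, cubMaj s x y z k ^ 2
      ≤ ∑' k, ENNReal.ofReal (3 ^ s) ^ 2 * (4 * (A1 k ^ 2 + (A2 k ^ 2 + A3 k ^ 2))) := by
        refine ENNReal.tsum_le_tsum fun k => ?_
        calc cubMaj s x y z k ^ 2 ≤ (ENNReal.ofReal (3 ^ s) * (A1 k + (A2 k + A3 k))) ^ 2 := by
              gcongr; exact hle k
          _ = ENNReal.ofReal (3 ^ s) ^ 2 * (A1 k + (A2 k + A3 k)) ^ 2 := by rw [mul_pow]
          _ ≤ _ := by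
            gcongr
            calc (A1 k + (A2 k + A3 k)) ^ 2 ≤ 2 * (A1 k ^ 2 + (A2 k + A3 k) ^ 2) :=
                  add_sq_le_two_mul _ _
              _ ≤ 2 * (2 * A1 k ^ 2 + 2 * (A2 k ^ 2 + A3 k ^ 2)) := by
                  gcongr
                  · rw [two_mul]; exact le_self_add
                  · exact add_sq_le_two_mul _ _
              _ = _ := by ring
    _ = ENNReal.ofReal (3 ^ s) ^ 2 * (4 * (∑' k, A1 k ^ 2 + (∑' k, A2 k ^ 2 + ∑' k, A3 k ^ 2))) := by
        rw [ENNReal.tsum_mul_left, ENNReal.tsum_mul_left, ENNReal.tsum_add, ENNReal.tsum_add]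
    _ ≤ ENNReal.ofReal (3 ^ s) ^ 2 * (4 * (4 * (ENNReal.ofReal (invWeightSum s) ^ 2 *
          (‖x‖ₑ ^ 2 * ‖y‖ₑ ^ 2 * ‖z‖ₑ ^ 2)))) := by
        gcongr
        calc _ ≤ ENNReal.ofReal (invWeightSum s) ^ 2 * (‖y‖ₑ ^ 2 * ‖z‖ₑ ^ 2 * ‖x‖ₑ ^ 2)
              + (ENNReal.ofReal (invWeightSum s) ^ 2 * (‖x‖ₑ ^ 2 * ‖z‖ₑ ^ 2 * ‖y‖ₑ ^ 2)
              + ENNReal.ofReal (invWeightSum s) ^ 2 * (‖x‖ₑ ^ 2 * ‖y‖ₑ ^ 2 * ‖z‖ₑ ^ 2)) :=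
              add_le_add hA1 (add_le_add hA2 hA3)
          _ = 3 * (ENNReal.ofReal (invWeightSum s) ^ 2 *
              (‖x‖ₑ ^ 2 * ‖y‖ₑ ^ 2 * ‖z‖ₑ ^ 2)) := by ring
          -- Rounding 3 up to 4 makes the total numerical factor 4 · 4, the square of the 4 in
          -- `cubConst`.
          _ ≤ _ := by gcongr; norm_num
    _ = _ := by
        rw [cubConst, ENNReal.ofReal_mul (by positivity), ENNReal.ofReal_mul (by positivity)]
        simp only [ENNReal.ofReal_ofNat]
        ring

theorem tsum_cubMaj_sq_ne_top {s : ℝ} (hs : 1 / 2 < s) (x y z : Seq) :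
    ∑' k, cubMaj s x y z k ^ 2 ≠ ⊤ :=
  ne_top_of_le_ne_top (ENNReal.mul_ne_top (ENNReal.pow_ne_top ENNReal.ofReal_ne_top)
    (ENNReal.mul_ne_top (ENNReal.mul_ne_top (ENNReal.pow_ne_top enorm_ne_top)
      (ENNReal.pow_ne_top enorm_ne_top)) (ENNReal.pow_ne_top enorm_ne_top)))
    (tsum_cubMaj_sq_le hs x y z)

theorem cubMaj_ne_top {s : ℝ} (hs : 1 / 2 < s) (x y z : Seq) (k : ℤ) :
    cubMaj s x y z k ≠ ⊤ := fun h =>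
  ENNReal.ne_top_of_tsum_ne_top (tsum_cubMaj_sq_ne_top hs x y z) k (by simp [h])

/-- A general term of the trilinear operator with multiplier `m`. -/
def cubTerm (s : ℝ) (m : ℤ → ℤ × ℤ → ℂ) (x y z : Seq) (k : ℤ) (q : ℤ × ℤ) : ℂ :=
  m k q * (kern s k q * (x q.1 * conj (y q.2) * z (k - q.1 + q.2)))

open Classical in
/-- The trilinear operator with multiplier `m`, in weighted coordinates:
`k ↦ ∑_{i, j} m(k, i, j) w_k / (w_i w_j w_l) x_i conj(y_j) z_l` with `l = k - i + j`. -/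
def cub (s : ℝ) (m : ℤ → ℤ × ℤ → ℂ) (x y z : Seq) : Seq :=
  -- The default value plays no role: bounded multipliers always satisfy the condition, by
  -- `memℓp_cub`.
  if h : Memℓp (fun k => ∑' q, cubTerm s m x y z k q) 2 then ⟨_, h⟩ else 0

variable {s : ℝ} {m m' : ℤ → ℤ × ℤ → ℂ} {c : ℝ}

theorem enorm_cubTerm_le (hm : ∀ k q, ‖m k q‖ ≤ c) (x y z : Seq) (k : ℤ) (q : ℤ × ℤ) :
    ‖cubTerm s m x y z k q‖ₑ ≤ ENNReal.ofReal c *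
      (ENNReal.ofReal (kern s k q) * (‖x q.1‖ₑ * ‖y q.2‖ₑ * ‖z (k - q.1 + q.2)‖ₑ)) := by
  unfold cubTerm
  rw [enorm_mul, enorm_mul, enorm_mul, enorm_mul]
  have h1 : ‖m k q‖ₑ ≤ ENNReal.ofReal c := by
    rw [← ofReal_norm]; exact ENNReal.ofReal_le_ofReal (hm k q)
  have h2 : ‖(kern s k q : ℂ)‖ₑ = ENNReal.ofReal (kern s k q) := by
    rw [← ofReal_norm, Complex.norm_of_nonneg (kern_nonneg s k q)]
  have h3 : ‖conj (y q.2)‖ₑ = ‖y q.2‖ₑ := by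
    rw [← ofReal_norm, RCLike.norm_conj, ofReal_norm]
  rw [h2, h3]
  gcongr

theorem summable_norm_cubTerm (hs : 1 / 2 < s) (hm : ∀ k q, ‖m k q‖ ≤ c) (x y z : Seq) (k : ℤ) :
    Summable fun q => ‖cubTerm s m x y z k q‖ := by
  have h : ∑' q, ‖cubTerm s m x y z k q‖ₑ ≠ ⊤ := by
    refine ne_top_of_le_ne_top (ENNReal.mul_ne_top (ENNReal.ofReal_ne_top (r := c))
      (cubMaj_ne_top hs x y z k)) ?_
    rw [cubMaj, ← ENNReal.tsum_mul_left]
    exact ENNReal.tsum_le_tsum fun q => enorm_cubTerm_le hm x y z k q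
  refine (ENNReal.summable_toReal h).congr fun q => ?_
  simp

theorem summable_cubTerm (hs : 1 / 2 < s) (hm : ∀ k q, ‖m k q‖ ≤ c) (x y z : Seq) (k : ℤ) :
    Summable fun q => cubTerm s m x y z k q :=
  (summable_norm_cubTerm hs hm x y z k).of_norm

theorem enorm_tsum_cubTerm_le (hm : ∀ k q, ‖m k q‖ ≤ c) (x y z : Seq) (k : ℤ) :
    ‖∑' q, cubTerm s m x y z k q‖ₑ ≤ ENNReal.ofReal c * cubMaj s x y z k := by
  refine (enorm_tsum_le_tsum_enorm).trans ?_
  rw [cubMaj, ← ENNReal.tsum_mul_left]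
  exact ENNReal.tsum_le_tsum fun q => enorm_cubTerm_le hm x y z k q

theorem memℓp_cub (hs : 1 / 2 < s) (hm : ∀ k q, ‖m k q‖ ≤ c) (x y z : Seq) :
    Memℓp (fun k => ∑' q, cubTerm s m x y z k q) 2 := by
  refine memℓp_of_tsum_ne_top (ne_top_of_le_ne_top (ENNReal.mul_ne_top
    (ENNReal.pow_ne_top (ENNReal.ofReal_ne_top (r := c)) (n := 2))
    (tsum_cubMaj_sq_ne_top hs x y z)) ?_)
  rw [← ENNReal.tsum_mul_left]
  refine ENNReal.tsum_le_tsum fun k => ?_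
  rw [← mul_pow]
  gcongr
  exact enorm_tsum_cubTerm_le hm x y z k

theorem cub_apply (hs : 1 / 2 < s) (hm : ∀ k q, ‖m k q‖ ≤ c) (x y z : Seq) (k : ℤ) :
    cub s m x y z k = ∑' q, cubTerm s m x y z k q := by
  rw [cub, dif_pos (memℓp_cub hs hm x y z)]

/-- The trilinear estimate. -/
theorem norm_cub_le (hs : 1 / 2 < s) (hc : 0 ≤ c) (hm : ∀ k q, ‖m k q‖ ≤ c) (x y z : Seq) :
    ‖cub s m x y z‖ ≤ c * cubConst s * (‖x‖ * ‖y‖ * ‖z‖) := by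
  have h : ‖cub s m x y z‖ₑ ^ 2 ≤
      (ENNReal.ofReal c * (ENNReal.ofReal (cubConst s) * (‖x‖ₑ * ‖y‖ₑ * ‖z‖ₑ))) ^ 2 := by
    rw [enorm_sq_eq_tsum, mul_pow, mul_pow, mul_pow, mul_pow]
    refine le_trans ?_ (mul_le_mul' le_rfl (tsum_cubMaj_sq_le hs x y z))
    rw [← ENNReal.tsum_mul_left]
    refine ENNReal.tsum_le_tsum fun k => ?_
    rw [← mul_pow, cub_apply hs hm]
    gcongr
    exact enorm_tsum_cubTerm_le hm x y z k
  have h' := (ENNReal.pow_le_pow_left_iff two_ne_zero).1 h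
  rw [← ofReal_norm, ← ofReal_norm, ← ofReal_norm, ← ofReal_norm,
    ← ENNReal.ofReal_mul (norm_nonneg _), ← ENNReal.ofReal_mul (by positivity),
    ← ENNReal.ofReal_mul (cubConst_nonneg s), ← ENNReal.ofReal_mul hc,
    ENNReal.ofReal_le_ofReal_iff] at h'
  · linarith
  · have := cubConst_nonneg s
    positivity

theorem cub_sub_fst (hs : 1 / 2 < s) (hm : ∀ k q, ‖m k q‖ ≤ c) (x x' y z : Seq) :
    cub s m (x - x') y z = cub s m x y z - cub s m x' y z := by
  ext k
  rw [lp.coeFn_sub, Pi.sub_apply, cub_apply hs hm, cub_apply hs hm, cub_apply hs hm,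
    ← (summable_cubTerm hs hm x y z k).tsum_sub (summable_cubTerm hs hm x' y z k)]
  refine tsum_congr fun q => ?_
  simp only [cubTerm, lp.coeFn_sub, Pi.sub_apply]
  ring

theorem cub_sub_snd (hs : 1 / 2 < s) (hm : ∀ k q, ‖m k q‖ ≤ c) (x y y' z : Seq) :
    cub s m x (y - y') z = cub s m x y z - cub s m x y' z := by
  ext k
  rw [lp.coeFn_sub, Pi.sub_apply, cub_apply hs hm, cub_apply hs hm, cub_apply hs hm,
    ← (summable_cubTerm hs hm x y z k).tsum_sub (summable_cubTerm hs hm x y' z k)]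
  refine tsum_congr fun q => ?_
  simp only [cubTerm, lp.coeFn_sub, Pi.sub_apply, map_sub]
  ring

theorem cub_sub_thd (hs : 1 / 2 < s) (hm : ∀ k q, ‖m k q‖ ≤ c) (x y z z' : Seq) :
    cub s m x y (z - z') = cub s m x y z - cub s m x y z' := by
  ext k
  rw [lp.coeFn_sub, Pi.sub_apply, cub_apply hs hm, cub_apply hs hm, cub_apply hs hm,
    ← (summable_cubTerm hs hm x y z k).tsum_sub (summable_cubTerm hs hm x y z' k)]
  refine tsum_congr fun q => ?_
  simp only [cubTerm, lp.coeFn_sub, Pi.sub_apply]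
  ring

theorem cub_sub_mul (hs : 1 / 2 < s) {c' : ℝ} (hm : ∀ k q, ‖m k q‖ ≤ c)
    (hm' : ∀ k q, ‖m' k q‖ ≤ c') (x y z : Seq) :
    cub s (m - m') x y z = cub s m x y z - cub s m' x y z := by
  have hmm : ∀ k q, ‖(m - m') k q‖ ≤ c + c' := fun k q =>
    (norm_sub_le _ _).trans (add_le_add (hm k q) (hm' k q))
  ext k
  rw [lp.coeFn_sub, Pi.sub_apply, cub_apply hs hm, cub_apply hs hm', cub_apply hs hmm,
    ← (summable_cubTerm hs hm x y z k).tsum_sub (summable_cubTerm hs hm' x y z k)]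
  refine tsum_congr fun q => ?_
  simp only [cubTerm, Pi.sub_apply]
  ring

theorem cub_add_mul (hs : 1 / 2 < s) {c' : ℝ} (hm : ∀ k q, ‖m k q‖ ≤ c)
    (hm' : ∀ k q, ‖m' k q‖ ≤ c') (x y z : Seq) :
    cub s (m + m') x y z = cub s m x y z + cub s m' x y z := by
  have hmm : ∀ k q, ‖(m + m') k q‖ ≤ c + c' := fun k q =>
    (norm_add_le _ _).trans (add_le_add (hm k q) (hm' k q))
  ext k
  rw [lp.coeFn_add, Pi.add_apply, cub_apply hs hm, cub_apply hs hm', cub_apply hs hmm,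
    ← (summable_cubTerm hs hm x y z k).tsum_add (summable_cubTerm hs hm' x y z k)]
  refine tsum_congr fun q => ?_
  simp only [cubTerm, Pi.add_apply]
  ring

theorem cub_smul_mul (hs : 1 / 2 < s) (hm : ∀ k q, ‖m k q‖ ≤ c) (a : ℂ) (x y z : Seq) :
    cub s (a • m) x y z = a • cub s m x y z := by
  have hmm : ∀ k q, ‖(a • m) k q‖ ≤ ‖a‖ * c := fun k q => by
    simpa using mul_le_mul_of_nonneg_left (hm k q) (norm_nonneg a)
  ext k
  rw [lp.coeFn_smul, Pi.smul_apply, cub_apply hs hm, cub_apply hs hmm, smul_eq_mul, ← tsum_mul_left]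
  refine tsum_congr fun q => ?_
  simp only [cubTerm, Pi.smul_apply, smul_eq_mul]
  ring

theorem cub_smul_fst (hs : 1 / 2 < s) (hm : ∀ k q, ‖m k q‖ ≤ c) (a : ℝ) (x y z : Seq) :
    cub s m (a • x) y z = a • cub s m x y z := by
  ext k
  rw [lp.coeFn_smul, Pi.smul_apply, cub_apply hs hm, cub_apply hs hm, Complex.real_smul,
    ← tsum_mul_left]
  refine tsum_congr fun q => ?_
  simp only [cubTerm, lp.coeFn_smul, Pi.smul_apply, Complex.real_smul]
  ring

theorem cub_smul_snd (hs : 1 / 2 < s) (hm : ∀ k q, ‖m k q‖ ≤ c) (a : ℝ) (x y z : Seq) :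
    cub s m x (a • y) z = a • cub s m x y z := by
  ext k
  rw [lp.coeFn_smul, Pi.smul_apply, cub_apply hs hm, cub_apply hs hm, Complex.real_smul,
    ← tsum_mul_left]
  refine tsum_congr fun q => ?_
  simp only [cubTerm, lp.coeFn_smul, Pi.smul_apply, Complex.real_smul, map_mul, Complex.conj_ofReal]
  ring

theorem cub_smul_thd (hs : 1 / 2 < s) (hm : ∀ k q, ‖m k q‖ ≤ c) (a : ℝ) (x y z : Seq) :
    cub s m x y (a • z) = a • cub s m x y z := by
  ext k
  rw [lp.coeFn_smul, Pi.smul_apply, cub_apply hs hm, cub_apply hs hm, Complex.real_smul,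
    ← tsum_mul_left]
  refine tsum_congr fun q => ?_
  simp only [cubTerm, lp.coeFn_smul, Pi.smul_apply, Complex.real_smul]
  ring

/-- Telescoping of differences of trilinear expressions. -/
theorem cub_sub_cub (hs : 1 / 2 < s) (hm : ∀ k q, ‖m k q‖ ≤ c) (x y z x' y' z' : Seq) :
    cub s m x y z - cub s m x' y' z' =
      cub s m (x - x') y z + cub s m x' (y - y') z + cub s m x' y' (z - z') := by
  rw [cub_sub_fst hs hm, cub_sub_snd hs hm, cub_sub_thd hs hm]
  abel

/-- In the telescoped sum only x', y, y' and z stand next to a difference, so x and z' need no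
bound. -/
theorem norm_cub_sub_cub_le (hs : 1 / 2 < s) (hc : 0 ≤ c) (hm : ∀ k q, ‖m k q‖ ≤ c)
    {x y z x' y' z' : Seq} {b : ℝ} (hx' : ‖x'‖ ≤ b) (hy : ‖y‖ ≤ b) (hy' : ‖y'‖ ≤ b)
    (hz : ‖z‖ ≤ b) :
    ‖cub s m x y z - cub s m x' y' z'‖ ≤
      c * cubConst s * b ^ 2 * (‖x - x'‖ + ‖y - y'‖ + ‖z - z'‖) := by
  have hK := cubConst_nonneg s
  have hb : 0 ≤ b := (norm_nonneg _).trans hx'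
  rw [cub_sub_cub hs hm]
  refine (norm_add₃_le).trans ?_
  have h1 := norm_cub_le hs hc hm (x - x') y z
  have h2 := norm_cub_le hs hc hm x' (y - y') z
  have h3 := norm_cub_le hs hc hm x' y' (z - z')
  have e1 : ‖x - x'‖ * ‖y‖ * ‖z‖ ≤ ‖x - x'‖ * b * b := by gcongr
  have e2 : ‖x'‖ * ‖y - y'‖ * ‖z‖ ≤ b * ‖y - y'‖ * b := by gcongr
  have e3 : ‖x'‖ * ‖y'‖ * ‖z - z'‖ ≤ b * b * ‖z - z'‖ := by gcongr
  calc _ ≤ c * cubConst s * (‖x - x'‖ * b * b) + c * cubConst s * (b * ‖y - y'‖ * b) +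
        c * cubConst s * (b * b * ‖z - z'‖) := by
        refine add_le_add (add_le_add (h1.trans ?_) (h2.trans ?_)) (h3.trans ?_) <;> gcongr
    _ = _ := by ring

/-! ### Continuity and differentiation of trilinear operators with varying multipliers -/

theorem tendsto_tsum_of_dominated {β G ι : Type*} [NormedAddCommGroup G] [CompleteSpace G]
    {l : Filter ι} {f : ι → β → G} {g : β → G} {bound : β → ℝ} (hb : Summable bound)
    (hfg : ∀ k, Tendsto (f · k) l (𝓝 (g k))) (hle : ∀ᶠ n in l, ∀ k, ‖f n k‖ ≤ bound k) :
    Tendsto (fun n => ∑' k, f n k) l (𝓝 (∑' k, g k)) :=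
  tendsto_tsum_of_dominated_convergence hb hfg hle

/-- Strong convergence of the trilinear operators under pointwise bounded convergence of the
multipliers. -/
theorem tendsto_cub_mul (hs : 1 / 2 < s) {ι : Type*} {l : Filter ι} {μ : ι → ℤ → ℤ × ℤ → ℂ}
    (hμ : ∀ᶠ n in l, ∀ k q, ‖μ n k q‖ ≤ c) (h0 : ∀ k q, Tendsto (fun n => μ n k q) l (𝓝 0))
    (x y z : Seq) : Tendsto (fun n => cub s (μ n) x y z) l (𝓝 0) := by
  have hone : ∀ (k : ℤ) (q : ℤ × ℤ), ‖(fun _ _ => 1 : ℤ → ℤ × ℤ → ℂ) k q‖ ≤ 1 := by simp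
  have hterm : ∀ n, (∀ k q, ‖μ n k q‖ ≤ c) → ∀ k q,
      ‖cubTerm s (μ n) x y z k q‖ ≤ c * ‖cubTerm s (fun _ _ => 1) x y z k q‖ := by
    intro n hn k q
    simp only [cubTerm, one_mul]
    rw [norm_mul]
    gcongr
    exact hn k q
  -- Dominated convergence is used twice: here in the pair q at fixed k, against the terms with
  -- multiplier 1, and below in k for the squared coordinates, against `cubMaj`.
  have hcoord : ∀ k, Tendsto (fun n => ∑' q, cubTerm s (μ n) x y z k q) l (𝓝 0) := fun k => by
    have := tendsto_tsum_of_dominated (l := l) (f := fun n q => cubTerm s (μ n) x y z k q)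
      (g := fun _ => 0) ((summable_norm_cubTerm hs hone x y z k).mul_left c)
      (fun q => by
        have := (h0 k q).mul_const (kern s k q * (x q.1 * conj (y q.2) * z (k - q.1 + q.2)) : ℂ)
        simpa only [cubTerm, zero_mul] using this)
      (hμ.mono fun n hn q => hterm n hn k q)
    simpa using this
  have hfin : Summable fun k => ((ENNReal.ofReal c * cubMaj s x y z k) ^ 2).toReal := by
    refine ENNReal.summable_toReal ?_
    simp_rw [mul_pow]
    rw [ENNReal.tsum_mul_left]
    exact ENNReal.mul_ne_top (ENNReal.pow_ne_top ENNReal.ofReal_ne_top)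
      (tsum_cubMaj_sq_ne_top hs x y z)
  have hsq : Tendsto (fun n => ∑' k, ‖∑' q, cubTerm s (μ n) x y z k q‖ ^ 2) l (𝓝 0) := by
    have := tendsto_tsum_of_dominated (l := l)
      (f := fun n k => ‖∑' q, cubTerm s (μ n) x y z k q‖ ^ 2)
      (g := fun _ => (0 : ℝ)) hfin
      (fun k => by simpa using (hcoord k).norm.pow 2)
      (hμ.mono fun n hn k => by
        rw [Real.norm_of_nonneg (by positivity)]
        have h := enorm_tsum_cubTerm_le (s := s) hn x y z k
        have h2 := ENNReal.toReal_mono (ENNReal.mul_ne_top ENNReal.ofReal_ne_top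
          (cubMaj_ne_top hs x y z k)) h
        rw [ENNReal.toReal_pow]
        rw [toReal_enorm] at h2
        gcongr)
    simpa using this
  rw [tendsto_zero_iff_norm_tendsto_zero]
  have hsqrt := (Real.continuous_sqrt.tendsto 0).comp hsq
  rw [Real.sqrt_zero] at hsqrt
  refine hsqrt.congr' (hμ.mono fun n hn => ?_)
  simp only [Function.comp_apply]
  rw [← Real.sqrt_sq (norm_nonneg (cub s (μ n) x y z)), seq_norm_sq]
  simp_rw [cub_apply hs hn]

/-- The multipliers converge only pointwise, so there is no convergence in operator norm. With fixed
arguments `tendsto_cub_mul` suffices; moving the arguments costs only the Lipschitz bound, uniform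
in the multiplier. -/
theorem tendsto_cub (hs : 1 / 2 < s) {ι : Type*} {l : Filter ι} {μ : ι → ℤ → ℤ × ℤ → ℂ}
    (hc : 0 ≤ c) (hμ : ∀ᶠ n in l, ∀ k q, ‖μ n k q‖ ≤ c) (hm : ∀ k q, ‖m k q‖ ≤ c)
    (h : ∀ k q, Tendsto (fun n => μ n k q) l (𝓝 (m k q)))
    {X Y Z : ι → Seq} {x y z : Seq} (hx : Tendsto X l (𝓝 x)) (hy : Tendsto Y l (𝓝 y))
    (hz : Tendsto Z l (𝓝 z)) :
    Tendsto (fun n => cub s (μ n) (X n) (Y n) (Z n)) l (𝓝 (cub s m x y z)) := by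
  have h1 : Tendsto (fun n => cub s (μ n - m) x y z) l (𝓝 0) := by
    refine tendsto_cub_mul hs (c := c + c) (hμ.mono fun n hn k q => ?_) (fun k q => ?_) x y z
    · exact (norm_sub_le _ _).trans (add_le_add (hn k q) (hm k q))
    · simpa using (h k q).sub_const (m k q)
  have h2 : Tendsto (fun n => cub s (μ n) (X n) (Y n) (Z n) - cub s (μ n) x y z) l (𝓝 0) := by
    set b := ‖x‖ + ‖y‖ + ‖z‖ + 1
    have hb : ∀ {V : ι → Seq} {v : Seq}, Tendsto V l (𝓝 v) → ‖v‖ < b → ∀ᶠ n in l, ‖V n‖ ≤ b :=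
      fun hV hv => (hV.norm.eventually_lt_const hv).mono fun n hn => hn.le
    have hx0 := norm_nonneg x
    have hy0 := norm_nonneg y
    have hz0 := norm_nonneg z
    have hd : Tendsto (fun n => c * cubConst s * b ^ 2 *
        (‖X n - x‖ + ‖Y n - y‖ + ‖Z n - z‖)) l (𝓝 0) := by
      have := (((tendsto_iff_norm_sub_tendsto_zero.1 hx).add
        (tendsto_iff_norm_sub_tendsto_zero.1 hy)).add
        (tendsto_iff_norm_sub_tendsto_zero.1 hz)).const_mul (c * cubConst s * b ^ 2)
      simpa using this
    refine squeeze_zero_norm' ?_ hd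
    filter_upwards [hμ, hb hy (by simp only [b]; linarith), hb hz (by simp only [b]; linarith)]
      with n hn hyn hzn
    exact norm_cub_sub_cub_le hs hc hn (by simp only [b]; linarith) hyn
      (by simp only [b]; linarith) hzn
  have h3 := (h2.add h1).add_const (cub s m x y z)
  rw [zero_add, zero_add] at h3
  refine h3.congr' (hμ.mono fun n hn => ?_)
  simp only [cub_sub_mul hs hn hm]
  abel

/-- The product rule for trilinear expressions whose multiplier depends on time. -/
theorem hasDerivAt_cub (hs : 1 / 2 < s) {μ : ℝ → ℤ → ℤ × ℤ → ℂ} {t : ℝ} {X Y Z : ℝ → Seq}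
    {x' y' z' : Seq} (hc : 0 ≤ c) (hμ : ∀ᶠ τ in 𝓝 t, ∀ k q, ‖μ τ k q‖ ≤ c)
    (hm' : ∀ k q, HasDerivAt (fun τ => μ τ k q) (m' k q) t) {d : ℝ} (hd : 0 ≤ d)
    (hlip : ∀ᶠ τ in 𝓝 t, ∀ k q, ‖μ τ k q - μ t k q‖ ≤ d * |τ - t|)
    (hX : HasDerivAt X x' t) (hY : HasDerivAt Y y' t) (hZ : HasDerivAt Z z' t) :
    HasDerivAt (fun τ => cub s (μ τ) (X τ) (Y τ) (Z τ))
      (cub s m' (X t) (Y t) (Z t) + (cub s (μ t) x' (Y t) (Z t) + cub s (μ t) (X t) y' (Z t)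
        + cub s (μ t) (X t) (Y t) z')) t := by
  have hμt : ∀ k q, ‖μ t k q‖ ≤ c := hμ.self_of_nhds
  have hle : 𝓝[≠] t ≤ 𝓝 t := nhdsWithin_le_nhds
  -- The difference quotients of the multiplier converge pointwise and, by `hlip`, are bounded by d
  -- uniformly in k and q. This is what `tendsto_cub` requires, and the limit inherits the bound d.
  have hslope : ∀ k q, Tendsto (fun τ => (((τ - t)⁻¹ : ℝ) : ℂ) • (μ τ k q - μ t k q))
      (𝓝[≠] t) (𝓝 (m' k q)) := fun k q => by
    have := hasDerivAt_iff_tendsto_slope.1 (hm' k q)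
    refine this.congr fun τ => ?_
    simp [slope, Complex.real_smul]
  have hslb : ∀ᶠ τ in 𝓝[≠] t, ∀ k q, ‖((((τ - t)⁻¹ : ℝ) : ℂ) • (μ τ - μ t)) k q‖ ≤ d := by
    filter_upwards [hle hlip, self_mem_nhdsWithin] with τ hτ hne k q
    have hne' : 0 < |τ - t| := abs_pos.2 (sub_ne_zero.2 hne)
    simp only [Pi.smul_apply, Pi.sub_apply, smul_eq_mul, norm_mul, Complex.norm_real,
      Real.norm_eq_abs, abs_inv]
    rw [inv_mul_le_iff₀ hne', mul_comm]
    exact hτ k q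
  have hm'b : ∀ k q, ‖m' k q‖ ≤ d := fun k q => by
    refine le_of_tendsto (hslope k q).norm ?_
    filter_upwards [hslb] with τ hτ using hτ k q
  have hsl : ∀ {V : ℝ → Seq} {v' : Seq}, HasDerivAt V v' t →
      Tendsto (fun τ => (τ - t)⁻¹ • (V τ - V t)) (𝓝[≠] t) (𝓝 v') := fun hV => by
    simpa [slope_fun_def] using hasDerivAt_iff_tendsto_slope.1 hV
  have ct : ∀ {V : ℝ → Seq} {v' : Seq}, HasDerivAt V v' t → Tendsto V (𝓝[≠] t) (𝓝 (V t)) :=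
    fun hV => hV.continuousAt.tendsto.mono_left hle
  rw [hasDerivAt_iff_tendsto_slope]
  have hA := tendsto_cub hs hd hslb hm'b hslope (ct hX) (ct hY) (ct hZ)
  have hcst : ∀ k q, Tendsto (fun _ : ℝ => μ t k q) (𝓝[≠] t) (𝓝 (μ t k q)) := fun k q =>
    tendsto_const_nhds
  have hev : ∀ᶠ _ : ℝ in 𝓝[≠] t, ∀ k q, ‖μ t k q‖ ≤ c := Eventually.of_forall fun _ => hμt
  have hB := tendsto_cub hs hc hev hμt hcst (hsl hX) (ct hY) (ct hZ)
  have hC := tendsto_cub hs hc hev hμt hcst (tendsto_const_nhds (x := X t)) (hsl hY) (ct hZ)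
  have hD := tendsto_cub hs hc hev hμt hcst (tendsto_const_nhds (x := X t))
    (tendsto_const_nhds (x := Y t)) (hsl hZ)
  -- The slope splits into the change of the multiplier at moving arguments and the telescoped
  -- change of the arguments at the frozen multiplier.
  refine (hA.add ((hB.add hC).add hD)).congr' ?_
  filter_upwards [hle hμ] with τ hτ
  have hdiff : ∀ k q, ‖(μ τ - μ t) k q‖ ≤ c + c := fun k q =>
    (norm_sub_le _ _).trans (add_le_add (hτ k q) (hμt k q))
  have h2 := cub_sub_mul hs hτ hμt (X τ) (Y τ) (Z τ)
  have h3 := cub_sub_cub hs hμt (X τ) (Y τ) (Z τ) (X t) (Y t) (Z t)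
  rw [cub_smul_mul hs hdiff, cub_smul_fst hs hμt, cub_smul_snd hs hμt, cub_smul_thd hs hμt,
    slope_def_module, h2]
  rw [show cub s (μ τ) (X τ) (Y τ) (Z τ) - cub s (μ t) (X t) (Y t) (Z t) =
    (cub s (μ τ) (X τ) (Y τ) (Z τ) - cub s (μ t) (X τ) (Y τ) (Z τ)) +
    (cub s (μ t) (X τ) (Y τ) (Z τ) - cub s (μ t) (X t) (Y t) (Z t)) by abel, h3]
  simp only [smul_add]
  congr 1

end DiracNLS

end

noncomputable section

namespace DiracNLS

open Filter Topology
open scoped ENNReal ComplexConjugate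

/-! ### The oscillating multipliers -/

/-- The resonance function `k² - i² + j² - l² = 2 (k - i) (i - j)`, `l = k - i + j`. -/
def reson (k : ℤ) (q : ℤ × ℤ) : ℤ := 2 * (k - q.1) * (q.1 - q.2)

/-- The combination of the logarithmic phases of the four modes `k, i, j, l`. -/
def phaseDefect (σ : ℝ) (α : ℤ → ℂ) (k : ℤ) (q : ℤ × ℤ) : ℝ :=
  σ / (8 * Real.pi) * (‖α k‖ ^ 2 - ‖α q.1‖ ^ 2 + ‖α q.2‖ ^ 2 - ‖α (k - q.1 + q.2)‖ ^ 2)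

/-- The multiplier of the full cubic nonlinearity. -/
def fullMult (σ : ℝ) (α : ℤ → ℂ) (t : ℝ) (k : ℤ) (q : ℤ × ℤ) : ℂ :=
  Complex.exp (Complex.I *
    ((-(reson k q : ℝ) / (4 * t) + phaseDefect σ α k q * Real.log t : ℝ) : ℂ))

/-- The multiplier of the nonresonant part of the nonlinearity. -/
def nrMult (σ : ℝ) (α : ℤ → ℂ) (t : ℝ) (k : ℤ) (q : ℤ × ℤ) : ℂ :=
  if reson k q = 0 then 0 else fullMult σ α t k q

/-- The multiplier of the normal form transformation. -/
def nfMult (σ : ℝ) (α : ℤ → ℂ) (t : ℝ) (k : ℤ) (q : ℤ × ℤ) : ℂ :=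
  fullMult σ α t k q / (reson k q : ℂ)

/-- The normal form multiplier, weighted by the phase defect. -/
def dfMult (σ : ℝ) (α : ℤ → ℂ) (t : ℝ) (k : ℤ) (q : ℤ × ℤ) : ℂ :=
  phaseDefect σ α k q * nfMult σ α t k q

/-- The multiplier of the diagonal terms `i = j = l = k`. -/
def diagMult (k : ℤ) (q : ℤ × ℤ) : ℂ := if q.1 = q.2 ∧ q.1 = k then 1 else 0

/-- The multiplier of the terms with `i = j`, that is `l = k`. -/
def pairMult (_k : ℤ) (q : ℤ × ℤ) : ℂ := if q.1 = q.2 then 1 else 0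

/-- The multiplier of the resonant part of the nonlinearity. -/
def resMult (k : ℤ) (q : ℤ × ℤ) : ℂ := 2 * pairMult k q - diagMult k q

variable {σ s : ℝ} {α : ℤ → ℂ}

theorem norm_fullMult (t : ℝ) (k : ℤ) (q : ℤ × ℤ) : ‖fullMult σ α t k q‖ = 1 := by
  rw [fullMult, mul_comm]
  exact Complex.norm_exp_ofReal_mul_I _

theorem norm_fullMult_le (t : ℝ) (k : ℤ) (q : ℤ × ℤ) : ‖fullMult σ α t k q‖ ≤ 1 :=
  (norm_fullMult t k q).le

theorem norm_nrMult_le (t : ℝ) (k : ℤ) (q : ℤ × ℤ) : ‖nrMult σ α t k q‖ ≤ 1 := by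
  unfold nrMult
  split_ifs
  · simp
  · exact norm_fullMult_le t k q

/-- A nonzero resonance is an integer, so the divisor has modulus at least 1. At a resonance the
convention on division by zero gives the value 0, so this multiplier lives on nonresonant terms
only. -/
theorem norm_nfMult_le (t : ℝ) (k : ℤ) (q : ℤ × ℤ) : ‖nfMult σ α t k q‖ ≤ 1 := by
  rw [nfMult, norm_div, norm_fullMult]
  rcases eq_or_ne (reson k q) 0 with h | h
  · simp [h]
  · have h1 : (1 : ℝ) ≤ ‖(reson k q : ℂ)‖ := by
      rw [Complex.norm_intCast]
      exact_mod_cast Int.one_le_abs h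
    exact div_le_one_of_le₀ h1 (by positivity)

theorem abs_phaseDefect_le (hσ : |σ| ≤ 1) (hα : ∀ k, ‖α k‖ ≤ 1) (k : ℤ) (q : ℤ × ℤ) :
    |phaseDefect σ α k q| ≤ 1 := by
  have h := fun j => pow_le_one₀ (n := 2) (norm_nonneg (α j)) (hα j)
  have h0 := fun j => sq_nonneg ‖α j‖
  have h2 : |‖α k‖ ^ 2 - ‖α q.1‖ ^ 2 + ‖α q.2‖ ^ 2 - ‖α (k - q.1 + q.2)‖ ^ 2| ≤ 2 := by
    rw [abs_le]
    constructor <;> linarith [h k, h q.1, h q.2, h (k - q.1 + q.2), h0 k, h0 q.1, h0 q.2,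
      h0 (k - q.1 + q.2)]
  have h3 : |σ / (8 * Real.pi)| ≤ 1 / 2 := by
    rw [abs_div, abs_of_pos (show 0 < 8 * Real.pi by positivity),
      div_le_div_iff₀ (by positivity) (by norm_num)]
    nlinarith [Real.pi_gt_three]
  rw [phaseDefect, abs_mul]
  calc _ ≤ (1 / 2 : ℝ) * 2 := by gcongr
    _ = 1 := by norm_num

theorem norm_dfMult_le (hσ : |σ| ≤ 1) (hα : ∀ k, ‖α k‖ ≤ 1) (t : ℝ) (k : ℤ) (q : ℤ × ℤ) :
    ‖dfMult σ α t k q‖ ≤ 1 := by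
  rw [dfMult, norm_mul, Complex.norm_real]
  exact mul_le_one₀ (abs_phaseDefect_le hσ hα k q) (norm_nonneg _) (norm_nfMult_le t k q)

theorem norm_diagMult_le (k : ℤ) (q : ℤ × ℤ) : ‖diagMult k q‖ ≤ 1 := by
  unfold diagMult; split_ifs <;> simp

theorem norm_pairMult_le (k : ℤ) (q : ℤ × ℤ) : ‖pairMult k q‖ ≤ 1 := by
  unfold pairMult; split_ifs <;> simp

theorem norm_resMult_le (k : ℤ) (q : ℤ × ℤ) : ‖resMult k q‖ ≤ 2 := by
  unfold resMult pairMult diagMult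
  split_ifs <;> simp_all; norm_num

theorem hasDerivAt_fullMult {t : ℝ} (ht : 0 < t) (k : ℤ) (q : ℤ × ℤ) :
    HasDerivAt (fun τ => fullMult σ α τ k q)
      (Complex.I * (((reson k q : ℝ) / (4 * t ^ 2) + phaseDefect σ α k q / t : ℝ) : ℂ) *
        fullMult σ α t k q) t := by
  have h1 : HasDerivAt (fun τ : ℝ => -(reson k q : ℝ) / (4 * τ) + phaseDefect σ α k q * Real.log τ)
      ((reson k q : ℝ) / (4 * t ^ 2) + phaseDefect σ α k q / t) t := by
    have ha := (((hasDerivAt_id t).const_mul 4).inv (by simpa using ht.ne')).const_mul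
      (-(reson k q : ℝ))
    have hb := (Real.hasDerivAt_log ht.ne').const_mul (phaseDefect σ α k q)
    refine (ha.add hb).congr_deriv ?_
    simp only [id]
    field_simp
  have h2 := (h1.ofReal_comp.const_mul Complex.I).cexp
  refine h2.congr_deriv ?_
  rw [fullMult]
  ring

/-- Differentiating the phase -r/(4t) produces r/(4t²), and r cancels against the divisor. This
recovers the nonresonant multiplier; the logarithmic phase contributes the term with `dfMult`. -/
theorem hasDerivAt_nfMult {t : ℝ} (ht : 0 < t) (k : ℤ) (q : ℤ × ℤ) :
    HasDerivAt (fun τ => nfMult σ α τ k q)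
      (((Complex.I / (4 * t ^ 2)) • nrMult σ α t + (Complex.I / t) • dfMult σ α t) k q) t := by
  refine ((hasDerivAt_fullMult ht k q).div_const _).congr_deriv ?_
  have ht' : (t : ℂ) ≠ 0 := by exact_mod_cast ht.ne'
  simp only [Pi.add_apply, Pi.smul_apply, smul_eq_mul, nrMult, dfMult, nfMult]
  split_ifs with h
  · simp [h]
  · have : (reson k q : ℂ) ≠ 0 := by exact_mod_cast h
    push_cast
    field_simp

/-- The Lipschitz constant is uniform in the frequencies because r has cancelled from the
derivative. Restricting to times beyond t/2 keeps the negative powers of time bounded. -/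
theorem norm_nfMult_sub_le (hσ : |σ| ≤ 1) (hα : ∀ k, ‖α k‖ ≤ 1) {t : ℝ} (ht : 0 < t) :
    ∀ᶠ τ in 𝓝 t, ∀ k q, ‖nfMult σ α τ k q - nfMult σ α t k q‖ ≤ (1 / t ^ 2 + 2 / t) * |τ - t| := by
  filter_upwards [Ioi_mem_nhds (show t / 2 < t by linarith)] with τ hτ k q
  refine (convex_Ioi (t / 2)).norm_image_sub_le_of_norm_hasDerivWithin_le
    (f := fun τ => nfMult σ α τ k q) (fun x hx => (hasDerivAt_nfMult (lt_trans (by linarith) hx)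
      k q).hasDerivWithinAt) (fun x hx => ?_) (show t / 2 < t by linarith) hτ
  have hx0 : 0 < x := lt_trans (by linarith) hx
  have hx' : t / 2 < x := hx
  simp only [Pi.add_apply, Pi.smul_apply, smul_eq_mul]
  refine (norm_add_le _ _).trans (add_le_add ?_ ?_)
  · rw [norm_mul, norm_div, norm_mul, norm_pow, Complex.norm_I, Complex.norm_real,
      Real.norm_of_nonneg hx0.le]
    simp only [Complex.norm_ofNat]
    calc _ ≤ 1 / (4 * x ^ 2) * 1 := by gcongr; exact norm_nrMult_le x k q
      _ ≤ 1 / (4 * (t / 2) ^ 2) * 1 := by gcongr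
      _ = _ := by field_simp; norm_num
  · rw [norm_mul, norm_div, Complex.norm_I, Complex.norm_real, Real.norm_of_nonneg hx0.le]
    calc _ ≤ 1 / x * 1 := by gcongr; exact norm_dfMult_le hσ hα x k q
      _ ≤ 1 / (t / 2) * 1 := by gcongr
      _ = _ := by field_simp

theorem continuousAt_nrMult {t : ℝ} (ht : 0 < t) (k : ℤ) (q : ℤ × ℤ) :
    ContinuousAt (fun τ => nrMult σ α τ k q) t := by
  unfold nrMult
  split_ifs
  · exact continuousAt_const
  · exact (hasDerivAt_fullMult ht k q).continuousAt

theorem continuousAt_nfMult {t : ℝ} (ht : 0 < t) (k : ℤ) (q : ℤ × ℤ) :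
    ContinuousAt (fun τ => nfMult σ α τ k q) t := (hasDerivAt_nfMult ht k q).continuousAt

theorem continuousAt_dfMult {t : ℝ} (ht : 0 < t) (k : ℤ) (q : ℤ × ℤ) :
    ContinuousAt (fun τ => dfMult σ α τ k q) t :=
  continuousAt_const.mul (continuousAt_nfMult ht k q)

theorem continuousAt_cub (hs : 1 / 2 < s) {μ : ℝ → ℤ → ℤ × ℤ → ℂ} {c : ℝ} (hc : 0 ≤ c)
    (hμ : ∀ τ k q, ‖μ τ k q‖ ≤ c) {t : ℝ} (h : ∀ k q, ContinuousAt (fun τ => μ τ k q) t)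
    {X Y Z : ℝ → Seq} (hX : ContinuousAt X t) (hY : ContinuousAt Y t) (hZ : ContinuousAt Z t) :
    ContinuousAt (fun τ => cub s (μ τ) (X τ) (Y τ) (Z τ)) t :=
  tendsto_cub hs hc (Eventually.of_forall hμ) (hμ t) (fun k q => h k q) hX hY hZ

/-! ### The vector field and its normal form -/

/-- The resonant remainder `Q(B) = 2 (∑ |B_j|² - M) B_k - (|B_k|² - |α_k|²) B_k`. -/
def resRem (s : ℝ) (a B : Seq) : Seq := cub s resMult B B B - cub s resMult a a B

/-- The vector field of the equation for `B = α + R`. -/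
def vfield (σ s : ℝ) (α : ℤ → ℂ) (a : Seq) (t : ℝ) (B : Seq) : Seq :=
  (Complex.I * σ / (8 * Real.pi * t)) • (cub s (nrMult σ α t) B B B + resRem s a B)

/-- The normal form correction. -/
def nfTerm (σ s : ℝ) (α : ℤ → ℂ) (t : ℝ) (B : Seq) : Seq :=
  (σ / (2 * Real.pi) * t) • cub s (nfMult σ α t) B B B

/-- The right-hand side of the equation in normal form, with `D = t ∂ₜB`. -/
def nfRhs (σ s : ℝ) (α : ℤ → ℂ) (a : Seq) (t : ℝ) (B D : Seq) : Seq :=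
  (Complex.I * σ / (8 * Real.pi * t)) • resRem s a B -
    (σ / (2 * Real.pi)) • (cub s (nfMult σ α t) B B B + Complex.I • cub s (dfMult σ α t) B B B
      + (cub s (nfMult σ α t) D B B + cub s (nfMult σ α t) B D B + cub s (nfMult σ α t) B B D))

/-- The prefactor is chosen so that (σt/2π) · i/(4t²) = iσ/(8πt), the coefficient of the nonresonant
part of the vector field. The remaining terms of the product rule are collected in `nfRhs`. -/
theorem hasDerivAt_nfTerm (hs : 1 / 2 < s) (hσ : |σ| ≤ 1) (hα : ∀ k, ‖α k‖ ≤ 1) {a : Seq}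
    {B : ℝ → Seq} {V : Seq} {t : ℝ} (ht : 0 < t) (hB : HasDerivAt B V t) :
    HasDerivAt (fun τ => nfTerm σ s α τ (B τ))
      (vfield σ s α a t (B t) - nfRhs σ s α a t (B t) (t • V)) t := by
  have h1 := hasDerivAt_cub hs (μ := nfMult σ α) (d := 1 / t ^ 2 + 2 / t) zero_le_one
    (Eventually.of_forall norm_nfMult_le) (hasDerivAt_nfMult ht) (by positivity)
    (norm_nfMult_sub_le hσ hα ht) hB hB hB
  have hnr : ∀ k q, ‖((Complex.I / (4 * t ^ 2)) • nrMult σ α t) k q‖ ≤ ‖Complex.I / (4 * t ^ 2)‖ :=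
    fun k q => by
      simp only [Pi.smul_apply, smul_eq_mul, norm_mul]
      exact mul_le_of_le_one_right (norm_nonneg _) (norm_nrMult_le t k q)
  have hdf : ∀ k q, ‖((Complex.I / t) • dfMult σ α t) k q‖ ≤ ‖Complex.I / t‖ :=
    fun k q => by
      simp only [Pi.smul_apply, smul_eq_mul, norm_mul]
      exact mul_le_of_le_one_right (norm_nonneg _) (norm_dfMult_le hσ hα t k q)
  rw [cub_add_mul hs hnr hdf, cub_smul_mul hs (norm_nrMult_le t),
    cub_smul_mul hs (norm_dfMult_le hσ hα t)] at h1
  have h2 := ((hasDerivAt_id t).const_mul (σ / (2 * Real.pi))).smul h1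
  refine h2.congr_deriv ?_
  have ht' : (t : ℂ) ≠ 0 := by exact_mod_cast ht.ne'
  have hpi : (Real.pi : ℂ) ≠ 0 := by exact_mod_cast Real.pi_ne_zero
  simp only [vfield, nfRhs, cub_smul_fst hs (norm_nfMult_le t), cub_smul_snd hs (norm_nfMult_le t),
    cub_smul_thd hs (norm_nfMult_le t), id]
  ext k
  simp only [lp.coeFn_sub, lp.coeFn_add, lp.coeFn_smul, Pi.sub_apply, Pi.add_apply, Pi.smul_apply,
    smul_eq_mul, Complex.real_smul]
  push_cast
  field_simp
  ring

/-- The nonresonant 1/t singularity disappears, and 1/t survives only in front of `resRem`, which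
vanishes at B = a. Keeping Z separate from B covers a Picard step as well as a solution, where the
derivative of B is the vector field itself. -/
theorem hasDerivAt_sub_nfTerm (hs : 1 / 2 < s) (hσ : |σ| ≤ 1) (hα : ∀ k, ‖α k‖ ≤ 1) {a : Seq}
    {B Z : ℝ → Seq} {V : Seq} {t : ℝ} (ht : 0 < t) (hB : HasDerivAt B V t)
    (hZ : HasDerivAt Z (vfield σ s α a t (B t)) t) :
    HasDerivAt (fun τ => Z τ - nfTerm σ s α τ (B τ)) (nfRhs σ s α a t (B t) (t • V)) t := by
  refine (hZ.sub (hasDerivAt_nfTerm hs hσ hα (a := a) ht hB)).congr_deriv ?_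
  abel

/-! ### Bounds and Lipschitz bounds on a ball of radius b -/

section Estimates

variable {a B B₁ B₂ D D₁ D₂ : Seq} {b t : ℝ}

theorem norm_cub_cube_sub_le (hs : 1 / 2 < s) {m : ℤ → ℤ × ℤ → ℂ} {c : ℝ} (hc : 0 ≤ c)
    (hm : ∀ k q, ‖m k q‖ ≤ c) (h1 : ‖B₁‖ ≤ b) (h2 : ‖B₂‖ ≤ b) :
    ‖cub s m B₁ B₁ B₁ - cub s m B₂ B₂ B₂‖ ≤ c * cubConst s * b ^ 2 * (3 * ‖B₁ - B₂‖) := by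
  refine (norm_cub_sub_cub_le hs hc hm h2 h1 h2 h1).trans (le_of_eq (by ring))

theorem norm_cub_le_cube (hs : 1 / 2 < s) {m : ℤ → ℤ × ℤ → ℂ} {c : ℝ} (hc : 0 ≤ c)
    (hm : ∀ k q, ‖m k q‖ ≤ c) {x y z : Seq} (hx : ‖x‖ ≤ b) (hy : ‖y‖ ≤ b) (hz : ‖z‖ ≤ b) :
    ‖cub s m x y z‖ ≤ c * cubConst s * b ^ 3 := by
  have hK := cubConst_nonneg s
  have hb : 0 ≤ b := (norm_nonneg _).trans hx
  refine (norm_cub_le hs hc hm x y z).trans ?_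
  calc _ ≤ c * cubConst s * (b * b * b) := by gcongr
    _ = _ := by ring

/-- The two cubic expressions share their last argument, so the difference is linear in B - a; this
factor compensates the coefficient 1/t. -/
theorem norm_resRem_le (hs : 1 / 2 < s) (ha : ‖a‖ ≤ b) (hB : ‖B‖ ≤ b) :
    ‖resRem s a B‖ ≤ 4 * cubConst s * b ^ 2 * ‖B - a‖ := by
  refine (norm_cub_sub_cub_le hs zero_le_two norm_resMult_le ha hB ha hB).trans (le_of_eq ?_)
  rw [sub_self, norm_zero]; ring

theorem norm_resRem_sub_le (hs : 1 / 2 < s) (ha : ‖a‖ ≤ b) (h1 : ‖B₁‖ ≤ b) (h2 : ‖B₂‖ ≤ b) :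
    ‖resRem s a B₁ - resRem s a B₂‖ ≤ 8 * cubConst s * b ^ 2 * ‖B₁ - B₂‖ := by
  have e1 := norm_cub_cube_sub_le hs zero_le_two norm_resMult_le h1 h2
  have e2 := norm_cub_sub_cub_le (x := a) hs zero_le_two norm_resMult_le ha ha ha h1 (z' := B₂)
  rw [sub_self, norm_zero] at e2
  unfold resRem
  rw [sub_sub_sub_comm]
  refine (norm_sub_le _ _).trans ?_
  linarith

theorem abs_div_two_pi_le (hσ : |σ| ≤ 1) : |σ / (2 * Real.pi)| ≤ 1 / 6 := by
  rw [abs_div, abs_of_pos (show 0 < 2 * Real.pi by positivity),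
    div_le_div_iff₀ (by positivity) (by norm_num)]
  nlinarith [Real.pi_gt_three]

theorem norm_vfield_coeff_le (hσ : |σ| ≤ 1) (ht : 0 < t) :
    ‖Complex.I * σ / (8 * Real.pi * t)‖ ≤ 1 / 24 * t⁻¹ := by
  rw [norm_div, norm_mul, norm_mul, norm_mul, Complex.norm_I, Complex.norm_real, Complex.norm_real,
    Complex.norm_real, Real.norm_of_nonneg ht.le, Real.norm_of_nonneg Real.pi_pos.le,
    Complex.norm_ofNat, Real.norm_eq_abs, one_mul]
  rw [div_le_iff₀ (by positivity)]
  calc |σ| ≤ Real.pi / 3 := by linarith [Real.pi_gt_three]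
    _ = _ := by field_simp; norm_num

theorem norm_nfTerm_le (hs : 1 / 2 < s) (hσ : |σ| ≤ 1) (ht : 0 < t) (hB : ‖B‖ ≤ b) :
    ‖nfTerm σ s α t B‖ ≤ cubConst s * b ^ 3 * t := by
  have h := norm_cub_le_cube (m := nfMult σ α t) hs zero_le_one (norm_nfMult_le t) hB hB hB
  have h2 := abs_div_two_pi_le hσ
  have h0 := norm_nonneg (cub s (nfMult σ α t) B B B)
  rw [nfTerm, norm_smul, Real.norm_eq_abs, abs_mul, abs_of_pos ht]
  calc _ ≤ 1 * t * (1 * cubConst s * b ^ 3) := by gcongr; linarith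
    _ = _ := by ring

theorem norm_nfTerm_sub_le (hs : 1 / 2 < s) (hσ : |σ| ≤ 1) (ht : 0 < t) (h1 : ‖B₁‖ ≤ b)
    (h2 : ‖B₂‖ ≤ b) :
    ‖nfTerm σ s α t B₁ - nfTerm σ s α t B₂‖ ≤ cubConst s * b ^ 2 * ‖B₁ - B₂‖ * t := by
  have h := norm_cub_cube_sub_le (m := nfMult σ α t) hs zero_le_one (norm_nfMult_le t) h1 h2
  have h2 := abs_div_two_pi_le hσ
  have hK := cubConst_nonneg s
  rw [nfTerm, nfTerm, ← smul_sub, norm_smul, Real.norm_eq_abs, abs_mul, abs_of_pos ht]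
  calc _ ≤ 1 / 6 * t * (1 * cubConst s * b ^ 2 * (3 * ‖B₁ - B₂‖)) := by gcongr
    _ = 1 / 2 * (cubConst s * b ^ 2 * ‖B₁ - B₂‖ * t) := by ring
    _ ≤ _ := by
      have : 0 ≤ cubConst s * b ^ 2 * ‖B₁ - B₂‖ * t := by positivity
      linarith

/-- The velocity itself is only O(1/t). Multiplied by t it stays bounded down to t = 0, which is why
`nfRhs` takes t∂ₜB as its argument. -/
theorem norm_smul_vfield_le (hs : 1 / 2 < s) (hσ : |σ| ≤ 1) (ht : 0 < t) (ha : ‖a‖ ≤ b)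
    (hB : ‖B‖ ≤ b) : ‖t • vfield σ s α a t B‖ ≤ cubConst s * b ^ 3 := by
  have h1 := norm_cub_le_cube (m := nrMult σ α t) hs zero_le_one (norm_nrMult_le t) hB hB hB
  have h2 := norm_resRem_le hs ha hB
  have h3 : ‖B - a‖ ≤ 2 * b := (norm_sub_le _ _).trans (by linarith)
  have hK := cubConst_nonneg s
  have hb : 0 ≤ b := (norm_nonneg _).trans ha
  have hc := norm_vfield_coeff_le hσ ht
  rw [vfield, norm_smul, norm_smul, Real.norm_of_nonneg ht.le]
  calc _ ≤ t * (1 / 24 * t⁻¹ * (1 * cubConst s * b ^ 3 + 4 * cubConst s * b ^ 2 * (2 * b))) := by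
        gcongr
        refine (norm_add_le _ _).trans (add_le_add h1 (h2.trans ?_))
        gcongr
    _ = 9 / 24 * (cubConst s * b ^ 3) := by field_simp; ring
    _ ≤ _ := by
      have : 0 ≤ cubConst s * b ^ 3 := by positivity
      linarith

theorem norm_smul_vfield_sub_le (hs : 1 / 2 < s) (hσ : |σ| ≤ 1) (ht : 0 < t) (ha : ‖a‖ ≤ b)
    (h1 : ‖B₁‖ ≤ b) (h2 : ‖B₂‖ ≤ b) :
    ‖t • vfield σ s α a t B₁ - t • vfield σ s α a t B₂‖ ≤ cubConst s * b ^ 2 * ‖B₁ - B₂‖ := by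
  have e1 := norm_cub_cube_sub_le (m := nrMult σ α t) hs zero_le_one (norm_nrMult_le t) h1 h2
  have e2 := norm_resRem_sub_le hs ha h1 h2
  have hK := cubConst_nonneg s
  have hb : 0 ≤ b := (norm_nonneg _).trans ha
  have hc := norm_vfield_coeff_le hσ ht
  rw [vfield, vfield, ← smul_sub, ← smul_sub, norm_smul, norm_smul, Real.norm_of_nonneg ht.le,
    add_sub_add_comm]
  calc _ ≤ t * (1 / 24 * t⁻¹ * (1 * cubConst s * b ^ 2 * (3 * ‖B₁ - B₂‖) +
        8 * cubConst s * b ^ 2 * ‖B₁ - B₂‖)) := by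
        gcongr
        exact (norm_add_le _ _).trans (add_le_add e1 e2)
    _ = 11 / 24 * (cubConst s * b ^ 2 * ‖B₁ - B₂‖) := by field_simp; ring
    _ ≤ _ := by
      have : 0 ≤ cubConst s * b ^ 2 * ‖B₁ - B₂‖ := by positivity
      linarith

theorem norm_nfRhs_le (hs : 1 / 2 < s) (hσ : |σ| ≤ 1) (hα : ∀ k, ‖α k‖ ≤ 1) (ht : 0 < t)
    (ha : ‖a‖ ≤ b) (hB : ‖B‖ ≤ b) (hD : ‖D‖ ≤ b) :
    ‖nfRhs σ s α a t B D‖ ≤ 2 * cubConst s * b ^ 2 * (b + t⁻¹ * ‖B - a‖) := by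
  have h := fun {x y z : Seq} => norm_cub_le_cube (m := nfMult σ α t) (x := x) (y := y) (z := z)
    (b := b) hs zero_le_one (norm_nfMult_le t)
  have h2 := norm_cub_le_cube hs zero_le_one (norm_dfMult_le hσ hα t) hB hB hB
  have hQ := norm_resRem_le hs ha hB
  have hc := norm_vfield_coeff_le hσ ht
  have hK := cubConst_nonneg s
  have hb : 0 ≤ b := (norm_nonneg _).trans ha
  have hκ := abs_div_two_pi_le hσ
  unfold nfRhs
  refine (norm_sub_le _ _).trans ?_
  rw [norm_smul, norm_smul, Real.norm_eq_abs]
  calc _ ≤ 1 / 24 * t⁻¹ * (4 * cubConst s * b ^ 2 * ‖B - a‖) +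
        1 / 6 * (1 * cubConst s * b ^ 3 + 1 * cubConst s * b ^ 3 + (1 * cubConst s * b ^ 3 +
          1 * cubConst s * b ^ 3 + 1 * cubConst s * b ^ 3)) := by
        gcongr
        refine (norm_add₃_le).trans (add_le_add (add_le_add (h hB hB hB) ?_)
          ((norm_add₃_le).trans (add_le_add (add_le_add (h hD hB hB) (h hB hD hB)) (h hB hB hD))))
        rw [norm_smul, Complex.norm_I, one_mul]
        exact h2
    _ = 1 / 6 * (cubConst s * b ^ 2 * (t⁻¹ * ‖B - a‖)) + 5 / 6 * (cubConst s * b ^ 3) := by ring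
    _ ≤ _ := by
      have e1 : 0 ≤ cubConst s * b ^ 2 * (t⁻¹ * ‖B - a‖) := by positivity
      have e2 : 0 ≤ cubConst s * b ^ 3 := by positivity
      have : 2 * cubConst s * b ^ 2 * (b + t⁻¹ * ‖B - a‖) =
        2 * (cubConst s * b ^ 3) + 2 * (cubConst s * b ^ 2 * (t⁻¹ * ‖B - a‖)) := by ring
      linarith

theorem norm_nfRhs_sub_le (hs : 1 / 2 < s) (hσ : |σ| ≤ 1) (hα : ∀ k, ‖α k‖ ≤ 1) (ht : 0 < t)
    (ha : ‖a‖ ≤ b) (hB₁ : ‖B₁‖ ≤ b) (hB₂ : ‖B₂‖ ≤ b) (hD₁ : ‖D₁‖ ≤ b) (hD₂ : ‖D₂‖ ≤ b) :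
    ‖nfRhs σ s α a t B₁ D₁ - nfRhs σ s α a t B₂ D₂‖ ≤
      2 * cubConst s * b ^ 2 * (‖B₁ - B₂‖ + ‖D₁ - D₂‖ + t⁻¹ * ‖B₁ - B₂‖) := by
  have h := fun {x y z x' y' z' : Seq} => norm_cub_sub_cub_le (m := nfMult σ α t) (x := x) (y := y)
    (z := z) (x' := x') (y' := y') (z' := z') (b := b) hs zero_le_one (norm_nfMult_le t)
  have h2 := norm_cub_cube_sub_le hs zero_le_one (norm_dfMult_le hσ hα t) hB₁ hB₂
  have hQ := norm_resRem_sub_le hs ha hB₁ hB₂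
  have hc := norm_vfield_coeff_le hσ ht
  have hK := cubConst_nonneg s
  have hb : 0 ≤ b := (norm_nonneg _).trans ha
  have hκ := abs_div_two_pi_le hσ
  unfold nfRhs
  rw [sub_sub_sub_comm, ← smul_sub, ← smul_sub]
  refine (norm_sub_le _ _).trans ?_
  rw [norm_smul, norm_smul, Real.norm_eq_abs, add_sub_add_comm, add_sub_add_comm,
    add_sub_add_comm (cub s (nfMult σ α t) D₁ B₁ B₁ + _), add_sub_add_comm, ← smul_sub]
  calc _ ≤ 1 / 24 * t⁻¹ * (8 * cubConst s * b ^ 2 * ‖B₁ - B₂‖) +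
        1 / 6 * (1 * cubConst s * b ^ 2 * (‖B₁ - B₂‖ + ‖B₁ - B₂‖ + ‖B₁ - B₂‖)
          + 1 * cubConst s * b ^ 2 * (3 * ‖B₁ - B₂‖)
          + (1 * cubConst s * b ^ 2 * (‖D₁ - D₂‖ + ‖B₁ - B₂‖ + ‖B₁ - B₂‖) +
          1 * cubConst s * b ^ 2 * (‖B₁ - B₂‖ + ‖D₁ - D₂‖ + ‖B₁ - B₂‖) +
          1 * cubConst s * b ^ 2 * (‖B₁ - B₂‖ + ‖B₁ - B₂‖ + ‖D₁ - D₂‖))) := by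
        gcongr
        refine (norm_add₃_le).trans (add_le_add (add_le_add (h hB₂ hB₁ hB₂ hB₁) ?_)
          ((norm_add₃_le).trans (add_le_add (add_le_add (h hD₂ hB₁ hB₂ hB₁)
            (h hB₂ hD₁ hD₂ hB₁)) (h hB₂ hB₁ hB₂ hD₁))))
        rw [norm_smul, Complex.norm_I, one_mul]
        exact h2
    _ = 1 / 3 * (cubConst s * b ^ 2 * (t⁻¹ * ‖B₁ - B₂‖)) + 2 * (cubConst s * b ^ 2 * ‖B₁ - B₂‖)
        + 1 / 2 * (cubConst s * b ^ 2 * ‖D₁ - D₂‖) := by ring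
    _ ≤ _ := by
      have e1 : 0 ≤ cubConst s * b ^ 2 * (t⁻¹ * ‖B₁ - B₂‖) := by positivity
      have e2 : 0 ≤ cubConst s * b ^ 2 * ‖D₁ - D₂‖ := by positivity
      have : 2 * cubConst s * b ^ 2 * (‖B₁ - B₂‖ + ‖D₁ - D₂‖ + t⁻¹ * ‖B₁ - B₂‖) =
        2 * (cubConst s * b ^ 2 * ‖B₁ - B₂‖) + 2 * (cubConst s * b ^ 2 * ‖D₁ - D₂‖) +
        2 * (cubConst s * b ^ 2 * (t⁻¹ * ‖B₁ - B₂‖)) := by ring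
      linarith

end Estimates

/-! ### Continuity in time of the vector field and of its normal form -/

theorem continuousAt_resRem (hs : 1 / 2 < s) (a : Seq) {B : ℝ → Seq} {t : ℝ}
    (hB : ContinuousAt B t) : ContinuousAt (fun τ => resRem s a (B τ)) t :=
  (continuousAt_cub (μ := fun _ => resMult) hs zero_le_two (fun _ => norm_resMult_le)
    (fun _ _ => continuousAt_const) hB hB hB).sub
  (continuousAt_cub (μ := fun _ => resMult) hs zero_le_two (fun _ => norm_resMult_le)
    (fun _ _ => continuousAt_const) continuousAt_const continuousAt_const hB)

theorem continuousAt_vfield_coeff {t : ℝ} (ht : 0 < t) :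
    ContinuousAt (fun τ : ℝ => Complex.I * σ / (8 * Real.pi * (τ : ℂ))) t := by
  have ht' : (t : ℂ) ≠ 0 := by exact_mod_cast ht.ne'
  have hpi : (Real.pi : ℂ) ≠ 0 := by exact_mod_cast Real.pi_ne_zero
  exact ContinuousAt.div (by fun_prop) (by fun_prop) (by simp [ht', hpi])

theorem continuousAt_vfield (hs : 1 / 2 < s) (a : Seq) {B : ℝ → Seq} {t : ℝ}
    (ht : 0 < t) (hB : ContinuousAt B t) : ContinuousAt (fun τ => vfield σ s α a τ (B τ)) t :=
  (continuousAt_vfield_coeff ht).smul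
    ((continuousAt_cub hs zero_le_one (fun τ => norm_nrMult_le τ)
      (fun k q => continuousAt_nrMult ht k q) hB hB hB).add (continuousAt_resRem hs a hB))

theorem continuousAt_nfRhs (hs : 1 / 2 < s) (hσ : |σ| ≤ 1) (hα : ∀ k, ‖α k‖ ≤ 1) (a : Seq)
    {B D : ℝ → Seq} {t : ℝ} (ht : 0 < t) (hB : ContinuousAt B t) (hD : ContinuousAt D t) :
    ContinuousAt (fun τ => nfRhs σ s α a τ (B τ) (D τ)) t := by
  have h := fun {X Y Z : ℝ → Seq} => continuousAt_cub (X := X) (Y := Y) (Z := Z) hs zero_le_one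
    (fun τ => norm_nfMult_le (σ := σ) (α := α) τ) (fun k q => continuousAt_nfMult ht k q)
  have h2 := continuousAt_cub hs zero_le_one (fun τ => norm_dfMult_le hσ hα τ)
    (fun k q => continuousAt_dfMult ht k q) hB hB hB
  exact ((continuousAt_vfield_coeff ht).smul (continuousAt_resRem hs a hB)).sub
    ((((h hB hB hB).add (h2.const_smul Complex.I)).add
      (((h hD hB hB).add (h hB hD hB)).add (h hB hB hD))).const_smul (σ / (2 * Real.pi)))

end DiracNLS

end

noncomputable section

namespace DiracNLS

open Filter Topology Set
open scoped ENNReal ComplexConjugate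

/-! ### Two facts about vector-valued primitives with an integrable singularity at the origin -/

section Primitive

variable {E : Type*} [NormedAddCommGroup E] [NormedSpace ℝ E]

/-- The derivative bound is integrated from ε to t, and ε tends to 0; since γ > 0, the singularity
t^{γ-1} is integrable. -/
theorem norm_le_rpow_of_norm_deriv_le {Y y : ℝ → E} {T C γ : ℝ} (hγ : 0 < γ) (hC : 0 ≤ C)
    (hd : ∀ t ∈ Ioo 0 T, HasDerivAt Y (y t) t) (h0 : Tendsto Y (𝓝[>] 0) (𝓝 0))
    (hy : ∀ t ∈ Ioo 0 T, ‖y t‖ ≤ C * t ^ (γ - 1)) :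
    ∀ t ∈ Ioo 0 T, ‖Y t‖ ≤ C / γ * t ^ γ := by
  intro t ht
  have key : ∀ ε ∈ Ioo 0 t, ‖Y t‖ ≤ ‖Y ε‖ + C / γ * t ^ γ := by
    intro ε hε
    have hsub : ∀ x ∈ Icc ε t, x ∈ Ioo 0 T := fun x hx => ⟨hε.1.trans_le hx.1, hx.2.trans_lt ht.2⟩
    have hder : ∀ x ∈ Icc ε t, HasDerivAt (fun x => ‖Y ε‖ + C / γ * (x ^ γ - ε ^ γ))
        (C * x ^ (γ - 1)) x := fun x hx => by
      have h := ((Real.hasDerivAt_rpow_const (p := γ) (Or.inl (hsub x hx).1.ne')).sub_const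
        (ε ^ γ)).const_mul (C / γ)
      refine (h.const_add ‖Y ε‖).congr_deriv ?_
      field_simp
    have h := image_norm_le_of_norm_deriv_right_le_deriv_boundary' (a := ε) (b := t) (f := Y)
      (f' := y) (fun x hx => (hd x (hsub x hx)).continuousAt.continuousWithinAt)
      (fun x hx => (hd x (hsub x (Ico_subset_Icc_self hx))).hasDerivWithinAt)
      (B := fun x => ‖Y ε‖ + C / γ * (x ^ γ - ε ^ γ)) (B' := fun x => C * x ^ (γ - 1)) (by simp)
      (fun x hx => (hder x hx).continuousAt.continuousWithinAt)
      (fun x hx => (hder x (Ico_subset_Icc_self hx)).hasDerivWithinAt)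
      (fun x hx => hy x (hsub x (Ico_subset_Icc_self hx))) (right_mem_Icc.2 hε.2.le)
    -- The contribution of the lower endpoint has a favourable sign and is dropped.
    have h1 : 0 ≤ C / γ * ε ^ γ := by have := hε.1; positivity
    simp only [mul_sub] at h
    linarith
  have hlim : Tendsto (fun ε => ‖Y ε‖ + C / γ * t ^ γ) (𝓝[>] 0) (𝓝 (0 + C / γ * t ^ γ)) :=
    (by simpa using h0.norm : Tendsto (fun ε => ‖Y ε‖) (𝓝[>] 0) (𝓝 0)).add_const _
  rw [zero_add] at hlim
  refine ge_of_tendsto hlim ?_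
  filter_upwards [Ioo_mem_nhdsGT ht.1] with ε hε using key ε hε

theorem exists_primitive_of_norm_le_rpow [CompleteSpace E] {y : ℝ → E} {T C γ : ℝ} (hγ : 0 < γ)
    (hT : 0 < T) (hc : ∀ t ∈ Ioo 0 T, ContinuousAt y t) (hy : ∀ t ∈ Ioo 0 T, ‖y t‖ ≤ C * t ^ (γ - 1)) :
    ∃ Y : ℝ → E, (∀ t ∈ Ioo 0 T, HasDerivAt Y (y t) t) ∧ Tendsto Y (𝓝[>] 0) (𝓝 0) := by
  have hint : ∀ t ∈ Ioo 0 T, IntervalIntegrable y MeasureTheory.volume 0 t := by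
    intro t ht
    have hI := (intervalIntegral.intervalIntegrable_rpow' (a := 0) (b := t)
      (show -1 < γ - 1 by linarith)).const_mul C
    have hsub : uIoc 0 t ⊆ Ioo 0 T := by
      rw [uIoc_of_le ht.1.le]
      exact fun x hx => ⟨hx.1, hx.2.trans_lt ht.2⟩
    refine hI.mono_fun' ?_ ?_
    · exact ContinuousOn.aestronglyMeasurable
        (fun x hx => (hc x (hsub hx)).continuousWithinAt) measurableSet_uIoc
    · exact (MeasureTheory.ae_restrict_iff' measurableSet_uIoc).2
        (Eventually.of_forall fun x hx => hy x (hsub hx))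
  refine ⟨fun t => ∫ τ in (0 : ℝ)..t, y τ, fun t ht => ?_, ?_⟩
  · refine intervalIntegral.integral_hasDerivAt_right (hint t ht) ?_ (hc t ht)
    exact ContinuousOn.stronglyMeasurableAtFilter isOpen_Ioo
      (fun x hx => (hc x hx).continuousWithinAt) t ht
  · have hlim : Tendsto (fun t : ℝ => C / γ * t ^ γ) (𝓝[>] 0) (𝓝 0) := by
      have h := (Real.continuousAt_rpow_const 0 γ (Or.inr hγ.le)).tendsto.const_mul (C / γ)
      rw [Real.zero_rpow hγ.ne', mul_zero] at h
      exact h.mono_left nhdsWithin_le_nhds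
    refine squeeze_zero_norm' ?_ hlim
    filter_upwards [Ioo_mem_nhdsGT hT] with t ht
    have h := intervalIntegral.norm_integral_le_of_norm_le (f := y)
      (g := fun τ => C * τ ^ (γ - 1)) (a := 0) (b := t) (μ := MeasureTheory.volume) ht.1.le
      (Eventually.of_forall fun x hx => hy x ⟨hx.1, hx.2.trans_lt ht.2⟩)
      ((intervalIntegral.intervalIntegrable_rpow' (by linarith)).const_mul C)
    refine h.trans (le_of_eq ?_)
    rw [intervalIntegral.integral_const_mul, integral_rpow (Or.inl (by linarith))]
    simp only [sub_add_cancel, Real.zero_rpow hγ.ne', sub_zero]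
    ring

end Primitive

/-! ### A priori estimates and existence for the equation in normal form -/

/-- The constant in the estimates on `(0, T₀)`. -/
def growthConst (s γ T₀ : ℝ) : ℝ := 5 * cubConst s * T₀ / γ

variable {σ s γ T T₀ : ℝ} {α : ℤ → ℂ}

theorem growthConst_nonneg (hγ : 0 < γ) (hT₀ : 1 ≤ T₀) : 0 ≤ growthConst s γ T₀ := by
  have := cubConst_nonneg s
  unfold growthConst; positivity

theorem cubConst_mul_le_growthConst (hγ : 0 < γ) (hγ1 : γ < 1) (hT₀ : 1 ≤ T₀) :
    cubConst s * T₀ ≤ growthConst s γ T₀ := by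
  have := cubConst_nonneg s
  rw [growthConst, le_div_iff₀ hγ]
  have : 0 ≤ cubConst s * T₀ := by positivity
  nlinarith

theorem cubConst_le_growthConst (hγ : 0 < γ) (hγ1 : γ < 1) (hT₀ : 1 ≤ T₀) :
    cubConst s ≤ growthConst s γ T₀ :=
  (le_mul_of_one_le_right (cubConst_nonneg s) hT₀).trans
    (cubConst_mul_le_growthConst hγ hγ1 hT₀)

theorem rpow_le_of_le_one {t r : ℝ} (ht : 0 < t) (htT : t ≤ T₀) (hT₀ : 1 ≤ T₀) (hr : 0 ≤ r)
    (hr1 : r ≤ 1) : t ^ r ≤ T₀ :=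
  (Real.rpow_le_rpow ht.le htT hr).trans
    ((Real.rpow_le_rpow_of_exponent_le hT₀ hr1).trans_eq (Real.rpow_one _))

/-- On a bounded time interval a bounded source is also O(t^{γ-1}), so bounded and singular terms
can be treated with one power. -/
theorem one_le_mul_rpow_sub_one {t : ℝ} (hγ : 0 < γ) (hγ1 : γ < 1) (ht : 0 < t) (htT : t ≤ T₀)
    (hT₀ : 1 ≤ T₀) : 1 ≤ T₀ * t ^ (γ - 1) := by
  have h := rpow_le_of_le_one ht htT hT₀ (show 0 ≤ 1 - γ by linarith) (by linarith)
  calc 1 = t ^ (1 - γ) * t ^ (γ - 1) := by rw [← Real.rpow_add ht]; simp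
    _ ≤ _ := by gcongr

theorem le_mul_rpow {t : ℝ} (hγ : 0 < γ) (hγ1 : γ < 1) (ht : 0 < t) (htT : t ≤ T₀)
    (hT₀ : 1 ≤ T₀) : t ≤ T₀ * t ^ γ := by
  have h := rpow_le_of_le_one ht htT hT₀ (show 0 ≤ 1 - γ by linarith) (by linarith)
  calc t = t ^ (1 - γ) * t ^ γ := by rw [← Real.rpow_add ht]; simp
    _ ≤ _ := by gcongr

/-- The normal form is O(t), so it does not alter the initial value. -/
theorem tendsto_nfTerm (hs : 1 / 2 < s) (hσ : |σ| ≤ 1) (hT : 0 < T) {B : ℝ → Seq} {b : ℝ}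
    (hB : ∀ t ∈ Ioo 0 T, ‖B t‖ ≤ b) :
    Tendsto (fun t => nfTerm σ s α t (B t)) (𝓝[>] 0) (𝓝 0) := by
  have hlim : Tendsto (fun t : ℝ => cubConst s * b ^ 3 * t) (𝓝[>] 0) (𝓝 0) := by
    have h := (continuous_id.tendsto (0 : ℝ)).const_mul (cubConst s * b ^ 3)
    simp only [id, mul_zero] at h
    exact h.mono_left nhdsWithin_le_nhds
  refine squeeze_zero_norm' ?_ hlim
  filter_upwards [Ioo_mem_nhdsGT hT] with t ht
  exact norm_nfTerm_le hs hσ ht.1 (hB t ht)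

/-- The only singular term is τ⁻¹‖w‖, and the decay of w at the origin turns it into xτ^{γ-1}. -/
theorem norm_nfRhs_le_rpow (hs : 1 / 2 < s) (hσ : |σ| ≤ 1) (hα : ∀ k, ‖α k‖ ≤ 1)
    (hγ : 0 < γ) (hγ1 : γ < 1) (hT₀ : 1 ≤ T₀) {a w v : Seq} {b x τ : ℝ} (hx : 0 ≤ x) (ha : ‖a‖ ≤ b)
    (hτ : 0 < τ) (hτT : τ ≤ T₀) (hw : ‖w‖ ≤ x * τ ^ γ) (hB : ‖a + w‖ ≤ b) (hD : ‖τ • v‖ ≤ b) :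
    ‖nfRhs σ s α a τ (a + w) (τ • v)‖ ≤
      2 * cubConst s * b ^ 2 * (T₀ * (b + x)) * τ ^ (γ - 1) := by
  have hb : 0 ≤ b := (norm_nonneg a).trans ha
  have hK := cubConst_nonneg s
  have h := norm_nfRhs_le hs hσ hα hτ ha hB hD
  rw [add_sub_cancel_left] at h
  refine h.trans ?_
  have h1 := one_le_mul_rpow_sub_one hγ hγ1 hτ hτT hT₀
  have hτγ := Real.rpow_pos_of_pos hτ (γ - 1)
  have h5 : τ⁻¹ * ‖w‖ ≤ x * τ ^ (γ - 1) := by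
    rw [Real.rpow_sub_one hτ.ne', inv_mul_eq_div, ← mul_div_assoc]
    exact div_le_div_of_nonneg_right hw hτ.le
  have h6 := h5.trans (le_mul_of_one_le_left (by positivity) hT₀)
  have h7 := le_mul_of_one_le_right hb h1
  calc _ ≤ 2 * cubConst s * b ^ 2 * (b * (T₀ * τ ^ (γ - 1)) + T₀ * (x * τ ^ (γ - 1))) :=
        mul_le_mul_of_nonneg_left (add_le_add h7 h6) (by positivity)
    _ = _ := by ring

/-- The basic estimate on one Picard step. -/
theorem norm_picard_le (hs : 1 / 2 < s) (hσ : |σ| ≤ 1) (hα : ∀ k, ‖α k‖ ≤ 1)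
    (hγ : 0 < γ) (hγ1 : γ < 1) (hT₀ : 1 ≤ T₀) (hT : T ≤ T₀) {a : Seq} {W V Z : ℝ → Seq}
    {b x : ℝ} (hx : 0 ≤ x) (ha : ‖a‖ ≤ b)
    (hW : ∀ t ∈ Ioo 0 T, HasDerivAt W (V t) t) (hWx : ∀ t ∈ Ioo 0 T, ‖W t‖ ≤ x * t ^ γ)
    (hB : ∀ t ∈ Ioo 0 T, ‖a + W t‖ ≤ b) (hD : ∀ t ∈ Ioo 0 T, ‖t • V t‖ ≤ b)
    (hZ : ∀ t ∈ Ioo 0 T, HasDerivAt Z (vfield σ s α a t (a + W t)) t)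
    (hZ0 : Tendsto Z (𝓝[>] 0) (𝓝 0)) :
    ∀ t ∈ Ioo 0 T, ‖Z t‖ ≤ growthConst s γ T₀ * b ^ 2 * (b + x) * t ^ γ := by
  intro t ht
  have hb : 0 ≤ b := (norm_nonneg a).trans ha
  have hK := cubConst_nonneg s
  have hTpos : 0 < T := ht.1.trans ht.2
  have hT₀0 : 0 < T₀ := by linarith
  -- Not Z but Z minus the normal form has an integrable derivative; the correction is estimated
  -- separately.
  have hY := norm_le_rpow_of_norm_deriv_le (Y := fun τ => Z τ - nfTerm σ s α τ (a + W τ))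
    (y := fun τ => nfRhs σ s α a τ (a + W τ) (τ • V τ)) (T := T)
    (C := 2 * cubConst s * b ^ 2 * (T₀ * (b + x))) hγ (by positivity)
    (fun τ hτ => hasDerivAt_sub_nfTerm hs hσ hα hτ.1 ((hW τ hτ).const_add a) (hZ τ hτ))
    (by simpa using hZ0.sub (tendsto_nfTerm hs hσ hTpos hB)) (fun τ hτ => ?_) t ht
  · have h2 := norm_nfTerm_le (α := α) hs hσ ht.1 (hB t ht)
    have h3 : ‖Z t‖ ≤ _ + _ := norm_le_norm_sub_add (Z t) (nfTerm σ s α t (a + W t))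
    refine h3.trans ((add_le_add hY h2).trans ?_)
    have h4 := le_mul_rpow hγ hγ1 ht.1 (ht.2.le.trans hT) hT₀
    have htγ := Real.rpow_pos_of_pos ht.1 γ
    calc _ ≤ 2 * cubConst s * b ^ 2 * (T₀ * (b + x)) / γ * t ^ γ +
          cubConst s * b ^ 3 * (T₀ * t ^ γ) := by gcongr
      _ ≤ 2 * cubConst s * b ^ 2 * (T₀ * (b + x)) / γ * t ^ γ +
          cubConst s * b ^ 2 * (b + x) * (T₀ * t ^ γ) / γ := by
          gcongr
          rw [le_div_iff₀ hγ]
          calc cubConst s * b ^ 3 * (T₀ * t ^ γ) * γ ≤ cubConst s * b ^ 3 * (T₀ * t ^ γ) * 1 := by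
                gcongr
            _ = cubConst s * b ^ 2 * (b + 0) * (T₀ * t ^ γ) := by ring
            _ ≤ _ := by gcongr
      _ = 3 * (cubConst s * T₀ / γ * b ^ 2 * (b + x) * t ^ γ) := by ring
      -- The 5 in `growthConst` leaves room: 3 is needed here, and 7 out of 2 · 5 in the difference
      -- estimate.
      _ ≤ 5 * (cubConst s * T₀ / γ * b ^ 2 * (b + x) * t ^ γ) := by
          gcongr; norm_num
      _ = _ := by rw [growthConst]; ring
  · exact norm_nfRhs_le_rpow hs hσ hα hγ hγ1 hT₀ hx ha hτ.1 (hτ.2.le.trans hT) (hWx τ hτ)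
      (hB τ hτ) (hD τ hτ)

/-- The basic estimate on the difference of two Picard steps. -/
theorem norm_picard_sub_le (hs : 1 / 2 < s) (hσ : |σ| ≤ 1) (hα : ∀ k, ‖α k‖ ≤ 1)
    (hγ : 0 < γ) (hγ1 : γ < 1) (hT₀ : 1 ≤ T₀) (hT : T ≤ T₀) {a : Seq} {W₁ V₁ Z₁ W₂ V₂ Z₂ : ℝ → Seq}
    {b x : ℝ} (hx : 0 ≤ x) (ha : ‖a‖ ≤ b)
    (hW₁ : ∀ t ∈ Ioo 0 T, HasDerivAt W₁ (V₁ t) t) (hW₂ : ∀ t ∈ Ioo 0 T, HasDerivAt W₂ (V₂ t) t)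
    (hWx : ∀ t ∈ Ioo 0 T, ‖W₁ t - W₂ t‖ ≤ x * t ^ γ)
    (hVx : ∀ t ∈ Ioo 0 T, ‖t • V₁ t - t • V₂ t‖ ≤ x)
    (hB₁ : ∀ t ∈ Ioo 0 T, ‖a + W₁ t‖ ≤ b) (hB₂ : ∀ t ∈ Ioo 0 T, ‖a + W₂ t‖ ≤ b)
    (hD₁ : ∀ t ∈ Ioo 0 T, ‖t • V₁ t‖ ≤ b) (hD₂ : ∀ t ∈ Ioo 0 T, ‖t • V₂ t‖ ≤ b)
    (hZ₁ : ∀ t ∈ Ioo 0 T, HasDerivAt Z₁ (vfield σ s α a t (a + W₁ t)) t)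
    (hZ₂ : ∀ t ∈ Ioo 0 T, HasDerivAt Z₂ (vfield σ s α a t (a + W₂ t)) t)
    (hZ₁0 : Tendsto Z₁ (𝓝[>] 0) (𝓝 0)) (hZ₂0 : Tendsto Z₂ (𝓝[>] 0) (𝓝 0)) :
    ∀ t ∈ Ioo 0 T, ‖Z₁ t - Z₂ t‖ ≤ 2 * growthConst s γ T₀ * b ^ 2 * x * t ^ γ := by
  intro t ht
  have hb : 0 ≤ b := (norm_nonneg a).trans ha
  have hK := cubConst_nonneg s
  have hTpos : 0 < T := ht.1.trans ht.2
  have hT₀0 : 0 < T₀ := by linarith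
  have hlim := (hZ₁0.sub (tendsto_nfTerm (α := α) hs hσ hTpos hB₁)).sub
    (hZ₂0.sub (tendsto_nfTerm (α := α) hs hσ hTpos hB₂))
  simp only [sub_self] at hlim
  have hY := norm_le_rpow_of_norm_deriv_le
    (Y := fun τ => (Z₁ τ - nfTerm σ s α τ (a + W₁ τ)) - (Z₂ τ - nfTerm σ s α τ (a + W₂ τ)))
    (y := fun τ => nfRhs σ s α a τ (a + W₁ τ) (τ • V₁ τ) - nfRhs σ s α a τ (a + W₂ τ) (τ • V₂ τ))
    (T := T) (C := 6 * cubConst s * b ^ 2 * (T₀ * x)) hγ (by positivity)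
    (fun τ hτ => (hasDerivAt_sub_nfTerm hs hσ hα hτ.1 ((hW₁ τ hτ).const_add a) (hZ₁ τ hτ)).sub
      (hasDerivAt_sub_nfTerm hs hσ hα hτ.1 ((hW₂ τ hτ).const_add a) (hZ₂ τ hτ)))
    hlim (fun τ hτ => ?_) t ht
  · have h2 := norm_nfTerm_sub_le (α := α) hs hσ ht.1 (hB₁ t ht) (hB₂ t ht)
    rw [add_sub_add_left_eq_sub] at h2
    have h3 : ‖Z₁ t - Z₂ t‖ ≤ ‖(Z₁ t - nfTerm σ s α t (a + W₁ t)) -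
        (Z₂ t - nfTerm σ s α t (a + W₂ t))‖ +
        ‖nfTerm σ s α t (a + W₁ t) - nfTerm σ s α t (a + W₂ t)‖ := by
      refine le_trans (le_of_eq ?_) (norm_add_le _ _)
      congr 1
      abel
    refine h3.trans ((add_le_add hY h2).trans ?_)
    have h4 := rpow_le_of_le_one ht.1 (ht.2.le.trans hT) hT₀ hγ.le hγ1.le
    have htγ := Real.rpow_pos_of_pos ht.1 γ
    calc _ ≤ 6 * cubConst s * b ^ 2 * (T₀ * x) / γ * t ^ γ +
          cubConst s * b ^ 2 * (x * t ^ γ) * T₀ := by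
          have := ht.1.le
          gcongr
          · exact hWx t ht
          · exact ht.2.le.trans hT
      _ ≤ 6 * cubConst s * b ^ 2 * (T₀ * x) / γ * t ^ γ +
          cubConst s * b ^ 2 * (x * t ^ γ) * T₀ / γ := by
          gcongr
          rw [le_div_iff₀ hγ]
          exact mul_le_of_le_one_right (by positivity) hγ1.le
      _ = 7 * (cubConst s * T₀ / γ * b ^ 2 * x * t ^ γ) := by ring
      _ ≤ 10 * (cubConst s * T₀ / γ * b ^ 2 * x * t ^ γ) := by
          gcongr; norm_num
      _ = _ := by rw [growthConst]; ring
  · have h := norm_nfRhs_sub_le hs hσ hα hτ.1 ha (hB₁ τ hτ) (hB₂ τ hτ) (hD₁ τ hτ) (hD₂ τ hτ)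
    rw [add_sub_add_left_eq_sub] at h
    refine h.trans ?_
    have hτ' := hτ.1
    have h1 := one_le_mul_rpow_sub_one hγ hγ1 hτ.1 (hτ.2.le.trans hT) hT₀
    have hτγ := Real.rpow_pos_of_pos hτ.1 (γ - 1)
    have h5 : τ⁻¹ * ‖W₁ τ - W₂ τ‖ ≤ x * τ ^ (γ - 1) := by
      rw [Real.rpow_sub_one hτ.1.ne', inv_mul_eq_div, ← mul_div_assoc]
      exact div_le_div_of_nonneg_right (hWx τ hτ) hτ.1.le
    have h6 : ‖W₁ τ - W₂ τ‖ ≤ T₀ * (x * τ ^ (γ - 1)) := by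
      calc ‖W₁ τ - W₂ τ‖ = τ * (τ⁻¹ * ‖W₁ τ - W₂ τ‖) := by field_simp
        _ ≤ T₀ * (x * τ ^ (γ - 1)) := by gcongr; exact hτ.2.le.trans hT
    have h7 := (hVx τ hτ).trans (le_mul_of_one_le_right hx h1)
    have h8 := h5.trans (le_mul_of_one_le_left (by positivity) hT₀)
    calc _ ≤ 2 * cubConst s * b ^ 2 * (T₀ * (x * τ ^ (γ - 1)) + x * (T₀ * τ ^ (γ - 1)) +
          T₀ * (x * τ ^ (γ - 1))) :=
          mul_le_mul_of_nonneg_left (add_le_add (add_le_add h6 h7) h8) (by positivity)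
      _ = _ := by ring

/-- Solvability of one Picard step. -/
theorem exists_picard (hs : 1 / 2 < s) (hσ : |σ| ≤ 1) (hα : ∀ k, ‖α k‖ ≤ 1)
    (hγ : 0 < γ) (hγ1 : γ < 1) (hT₀ : 1 ≤ T₀) {a : Seq} {W V : ℝ → Seq}
    {b x : ℝ} (hx : 0 ≤ x) (ha : ‖a‖ ≤ b)
    (hW : ∀ t ∈ Ioo 0 T₀, HasDerivAt W (V t) t) (hV : ∀ t ∈ Ioo 0 T₀, ContinuousAt V t)
    (hWx : ∀ t ∈ Ioo 0 T₀, ‖W t‖ ≤ x * t ^ γ)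
    (hB : ∀ t ∈ Ioo 0 T₀, ‖a + W t‖ ≤ b) (hD : ∀ t ∈ Ioo 0 T₀, ‖t • V t‖ ≤ b) :
    ∃ Z : ℝ → Seq, (∀ t ∈ Ioo 0 T₀, HasDerivAt Z (vfield σ s α a t (a + W t)) t) ∧
      Tendsto Z (𝓝[>] 0) (𝓝 0) := by
  have hT0 : 0 < T₀ := by linarith
  -- The vector field is only O(1/t) and its integral from 0 need not converge absolutely. The
  -- integrable right-hand side in normal form is integrated instead, and the correction is added
  -- back.
  obtain ⟨Y, hY, hY0⟩ := exists_primitive_of_norm_le_rpow (T := T₀)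
    (y := fun τ => nfRhs σ s α a τ (a + W τ) (τ • V τ))
    (C := 2 * cubConst s * b ^ 2 * (T₀ * (b + x))) hγ hT0 (fun t ht =>
      continuousAt_nfRhs hs hσ hα a ht.1 ((hW t ht).continuousAt.const_add a)
        (continuousAt_id.smul (hV t ht))) (fun τ hτ =>
      norm_nfRhs_le_rpow hs hσ hα hγ hγ1 hT₀ hx ha hτ.1 hτ.2.le (hWx τ hτ) (hB τ hτ) (hD τ hτ))
  refine ⟨fun t => Y t + nfTerm σ s α t (a + W t), fun t ht => ?_, ?_⟩
  · have h := hasDerivAt_nfTerm hs hσ hα (a := a) ht.1 ((hW t ht).const_add a)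
    refine ((hY t ht).add h).congr_deriv ?_
    abel
  · simpa using hY0.add (tendsto_nfTerm (α := α) hs hσ hT0 hB)

/-- The radius of the ball in which remainders live. -/
def remRadius (s γ T₀ ε : ℝ) : ℝ := 16 * growthConst s γ T₀ * ε ^ 3

/-- The estimates preserved by the Picard iteration. -/
structure PicardState (γ T₀ x b : ℝ) (p : (ℝ → Seq) × (ℝ → Seq)) : Prop where
  deriv : ∀ t ∈ Ioo 0 T₀, HasDerivAt p.1 (p.2 t) t
  cont : ∀ t ∈ Ioo 0 T₀, ContinuousAt p.2 t
  small : ∀ t ∈ Ioo 0 T₀, ‖p.1 t‖ ≤ x * t ^ γ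
  dsmall : ∀ t ∈ Ioo 0 T₀, ‖t • p.2 t‖ ≤ b
  lim : Tendsto p.1 (𝓝[>] 0) (𝓝 0)

/-! ### Smallness of the data and the radius of the remainder -/

section Small

variable {ε : ℝ} {a : Seq}

theorem growthConst_mul_sq_le (hγ : 0 < γ) (hT₀ : 1 ≤ T₀)
    (hsm : 64 * growthConst s γ T₀ * T₀ * ε ^ 2 ≤ 1) :
    growthConst s γ T₀ * (2 * ε) ^ 2 ≤ 1 / 16 := by
  have h := growthConst_nonneg (s := s) hγ hT₀
  have : growthConst s γ T₀ * ε ^ 2 ≤ growthConst s γ T₀ * ε ^ 2 * T₀ :=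
    le_mul_of_one_le_right (by positivity) hT₀
  nlinarith

theorem remRadius_nonneg (hγ : 0 < γ) (hT₀ : 1 ≤ T₀) (hε : 0 ≤ ε) : 0 ≤ remRadius s γ T₀ ε := by
  have h := growthConst_nonneg (s := s) hγ hT₀
  unfold remRadius; positivity

theorem remRadius_mul_le (hε : 0 ≤ ε)
    (hsm : 64 * growthConst s γ T₀ * T₀ * ε ^ 2 ≤ 1) : remRadius s γ T₀ ε * T₀ ≤ ε / 4 := by
  have : remRadius s γ T₀ ε * T₀ = 64 * growthConst s γ T₀ * T₀ * ε ^ 2 * (ε / 4) := by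
    rw [remRadius]; ring
  rw [this]
  exact mul_le_of_le_one_left (by linarith) hsm

/-- The right-hand side of the Picard estimate is controlled by the radius. -/
theorem growth_le_remRadius (hγ : 0 < γ) (hT₀ : 1 ≤ T₀) (hε : 0 ≤ ε)
    (hsm : 64 * growthConst s γ T₀ * T₀ * ε ^ 2 ≤ 1) {y : ℝ} (hy : 0 ≤ y) :
    growthConst s γ T₀ * (2 * ε) ^ 2 * (2 * ε + (remRadius s γ T₀ ε + y)) ≤
      remRadius s γ T₀ ε + y / 2 := by
  have h1 := growthConst_mul_sq_le hγ hT₀ hsm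
  have h0 := remRadius_nonneg (s := s) hγ hT₀ hε
  -- The 16 in `remRadius` makes the source term G(2ε)³ exactly half of the radius; the other half
  -- absorbs the part linear in the remainder.
  have e : growthConst s γ T₀ * (2 * ε) ^ 2 * (2 * ε) = remRadius s γ T₀ ε / 2 := by
    rw [remRadius]; ring
  rw [mul_add, e]
  have : growthConst s γ T₀ * (2 * ε) ^ 2 * (remRadius s γ T₀ ε + y) ≤
    1 / 16 * (remRadius s γ T₀ ε + y) := by gcongr
  linarith

/-- Remainders in the ball are small. -/
theorem norm_le_of_le_remRadius (hγ : 0 < γ) (hγ1 : γ < 1) (hT₀ : 1 ≤ T₀) (hε : 0 ≤ ε)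
    (hsm : 64 * growthConst s γ T₀ * T₀ * ε ^ 2 ≤ 1) {w : Seq} {t : ℝ} (ht : 0 < t)
    (htT : t ≤ T₀) (hw : ‖w‖ ≤ remRadius s γ T₀ ε * t ^ γ) : ‖w‖ ≤ ε / 4 := by
  have h0 := remRadius_nonneg (s := s) hγ hT₀ hε
  refine hw.trans (le_trans ?_ (remRadius_mul_le hε hsm))
  gcongr
  exact rpow_le_of_le_one ht htT hT₀ hγ.le hγ1.le

end Small

end DiracNLS

end

/-! ### Picard iteration and the a priori bound for all remainders -/

noncomputable section

namespace DiracNLS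

open Filter Topology Set
open scoped ENNReal ComplexConjugate

variable {σ s γ T T₀ ε : ℝ} {α : ℤ → ℂ} {a : Seq}

theorem norm_add_le_two_mul {w : Seq} (ha : ‖a‖ ≤ ε) (hw : ‖w‖ ≤ ε) : ‖a + w‖ ≤ 2 * ε :=
  (norm_add_le _ _).trans (by linarith)

theorem cube_le_of_small (hγ : 0 < γ) (hγ1 : γ < 1) (hT₀ : 1 ≤ T₀) (hε : 0 ≤ ε)
    (hsm : 64 * growthConst s γ T₀ * T₀ * ε ^ 2 ≤ 1) : cubConst s * (2 * ε) ^ 3 ≤ 2 * ε := by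
  have h1 := growthConst_mul_sq_le hγ hT₀ hsm
  have h2 := cubConst_le_growthConst (s := s) hγ hγ1 hT₀
  have h3 : cubConst s * (2 * ε) ^ 2 ≤ 1 := by
    calc _ ≤ growthConst s γ T₀ * (2 * ε) ^ 2 := by gcongr
      _ ≤ 1 := by linarith
  calc _ = cubConst s * (2 * ε) ^ 2 * (2 * ε) := by ring
    _ ≤ 1 * (2 * ε) := by gcongr
    _ = _ := one_mul _

theorem exists_picardState_succ (hs : 1 / 2 < s) (hσ : |σ| ≤ 1) (hα : ∀ k, ‖α k‖ ≤ 1)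
    (hγ : 0 < γ) (hγ1 : γ < 1) (hT₀ : 1 ≤ T₀) (hε : 0 ≤ ε) (ha : ‖a‖ ≤ ε)
    (hsm : 64 * growthConst s γ T₀ * T₀ * ε ^ 2 ≤ 1) {p : (ℝ → Seq) × (ℝ → Seq)}
    (hp : PicardState γ T₀ (remRadius s γ T₀ ε) (2 * ε) p) :
    ∃ p' : (ℝ → Seq) × (ℝ → Seq), PicardState γ T₀ (remRadius s γ T₀ ε) (2 * ε) p' ∧
      ∀ t, p'.2 t = vfield σ s α a t (a + p.1 t) := by
  have h0 := remRadius_nonneg (s := s) hγ hT₀ hε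
  have ha2 : ‖a‖ ≤ 2 * ε := by linarith
  have hB : ∀ t ∈ Ioo 0 T₀, ‖a + p.1 t‖ ≤ 2 * ε := fun t ht =>
    norm_add_le_two_mul ha ((norm_le_of_le_remRadius hγ hγ1 hT₀ hε hsm ht.1 ht.2.le
      (hp.small t ht)).trans (by linarith))
  obtain ⟨Z, hZ, hZ0⟩ := exists_picard hs hσ hα hγ hγ1 hT₀ h0 ha2 hp.deriv hp.cont hp.small hB
    hp.dsmall
  refine ⟨(Z, fun t => vfield σ s α a t (a + p.1 t)), ⟨hZ, fun t ht => ?_, fun t ht => ?_,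
    fun t ht => ?_, hZ0⟩, fun t => rfl⟩
  · exact continuousAt_vfield hs a ht.1 ((hp.deriv t ht).continuousAt.const_add a)
  · have h := norm_picard_le hs hσ hα hγ hγ1 hT₀ le_rfl h0 ha2 hp.deriv hp.small hB hp.dsmall hZ
      hZ0 t ht
    refine h.trans ?_
    have := Real.rpow_pos_of_pos ht.1 γ
    have h2 := growth_le_remRadius (s := s) hγ hT₀ hε hsm (le_refl 0)
    simp only [add_zero, zero_div] at h2
    gcongr
  · exact (norm_smul_vfield_le hs hσ ht.1 ha2 (hB t ht)).trans
      (cube_le_of_small hγ hγ1 hT₀ hε hsm)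

/-- Existence for the equation of the remainder on a given time interval, for small data. -/
theorem exists_remainder (hs : 1 / 2 < s) (hσ : |σ| ≤ 1) (hα : ∀ k, ‖α k‖ ≤ 1)
    (hγ : 0 < γ) (hγ1 : γ < 1) (hT₀ : 1 ≤ T₀) (hε : 0 ≤ ε) (ha : ‖a‖ ≤ ε)
    (hsm : 64 * growthConst s γ T₀ * T₀ * ε ^ 2 ≤ 1) :
    ∃ W : ℝ → Seq, ∀ t ∈ Ioo 0 T₀, HasDerivAt W (vfield σ s α a t (a + W t)) t ∧
      ‖W t‖ ≤ remRadius s γ T₀ ε * t ^ γ := by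
  set r := remRadius s γ T₀ ε with hr
  have h0 : 0 ≤ r := remRadius_nonneg hγ hT₀ hε
  have hG := growthConst_nonneg (s := s) hγ hT₀
  have hK := cubConst_nonneg s
  have hKG := cubConst_mul_le_growthConst (s := s) hγ hγ1 hT₀
  have hGsm := growthConst_mul_sq_le hγ hT₀ hsm
  have ha2 : ‖a‖ ≤ 2 * ε := by linarith
  have step : ∀ p : {p // PicardState γ T₀ r (2 * ε) p},
      ∃ p' : {p // PicardState γ T₀ r (2 * ε) p},
        ∀ t, p'.1.2 t = vfield σ s α a t (a + p.1.1 t) := fun p => by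
    obtain ⟨p', h1, h2⟩ := exists_picardState_succ hs hσ hα hγ hγ1 hT₀ hε ha hsm p.2
    exact ⟨⟨p', h1⟩, h2⟩
  choose f hf using step
  -- The iteration starts from the zero remainder with zero velocity.
  have hz : PicardState γ T₀ r (2 * ε) (fun _ => 0, fun _ => 0) :=
    ⟨fun t _ => hasDerivAt_const t 0, fun t _ => continuousAt_const,
      fun t ht => by simpa using mul_nonneg h0 (Real.rpow_nonneg ht.1.le γ),
      fun t ht => by simpa using hε, tendsto_const_nhds⟩
  set S : ℕ → {p // PicardState γ T₀ r (2 * ε) p} := fun n => f^[n] ⟨_, hz⟩ with hS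
  have hSs : ∀ n, S (n + 1) = f (S n) := fun n => Function.iterate_succ_apply' f n _
  set W : ℕ → ℝ → Seq := fun n => (S n).1.1
  set V : ℕ → ℝ → Seq := fun n => (S n).1.2
  have hV : ∀ n t, V (n + 1) t = vfield σ s α a t (a + W n t) := fun n t => by
    simp only [V, hSs]; exact hf (S n) t
  have hW : ∀ n, ∀ t ∈ Ioo 0 T₀, HasDerivAt (W n) (V n t) t := fun n => (S n).2.deriv
  have hWd : ∀ n, ∀ t ∈ Ioo 0 T₀, HasDerivAt (W (n + 1)) (vfield σ s α a t (a + W n t)) t :=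
    fun n t ht => hV n t ▸ hW (n + 1) t ht
  have hB : ∀ n, ∀ t ∈ Ioo 0 T₀, ‖a + W n t‖ ≤ 2 * ε := fun n t ht =>
    norm_add_le_two_mul ha ((norm_le_of_le_remRadius hγ hγ1 hT₀ hε hsm ht.1 ht.2.le
      ((S n).2.small t ht)).trans (by linarith))
  -- This single constant bounds both first differences: 2r for the remainders and 4ε for t times
  -- the velocities.
  set e := 2 * r + 4 * ε
  have he : 0 ≤ e := by positivity
  -- Remainders and velocities must contract together, since the difference estimate in normal form
  -- involves both. For the velocities the gain comes from `norm_smul_vfield_sub_le` and the bound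
  -- just obtained at the previous index.
  have hdiff : ∀ n : ℕ, ∀ t ∈ Ioo 0 T₀, ‖W (n + 1) t - W n t‖ ≤ e * (1 / 2) ^ n * t ^ γ ∧
      ‖t • V (n + 1) t - t • V n t‖ ≤ e * (1 / 2) ^ n := by
    intro n
    induction n with
    | zero =>
      intro t ht
      have htγ := Real.rpow_pos_of_pos ht.1 γ
      have h1 := (S 1).2.small t ht
      have h2 := (S 0).2.small t ht
      have h3 := (S 1).2.dsmall t ht
      have h4 := (S 0).2.dsmall t ht
      simp only [pow_zero, mul_one]
      refine ⟨(norm_sub_le _ _).trans ((add_le_add h1 h2).trans ?_),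
        (norm_sub_le _ _).trans ((add_le_add h3 h4).trans ?_)⟩
      · rw [← add_mul]
        gcongr
        simp only [e]; linarith
      · simp only [e]; linarith
    | succ n ih =>
      intro t ht
      have htγ := Real.rpow_pos_of_pos ht.1 γ
      have hx : 0 ≤ e * (1 / 2) ^ n := by positivity
      constructor
      · have h := norm_picard_sub_le hs hσ hα hγ hγ1 hT₀ le_rfl hx ha2 (hW (n + 1)) (hW n)
          (fun t ht => (ih t ht).1) (fun t ht => (ih t ht).2) (hB (n + 1)) (hB n)
          (S (n + 1)).2.dsmall (S n).2.dsmall (hWd (n + 1)) (hWd n) (S (n + 1 + 1)).2.lim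
          (S (n + 1)).2.lim t ht
        refine h.trans (mul_le_mul_of_nonneg_right ?_ htγ.le)
        calc 2 * growthConst s γ T₀ * (2 * ε) ^ 2 * (e * (1 / 2) ^ n)
            = (growthConst s γ T₀ * (2 * ε) ^ 2) * (2 * (e * (1 / 2) ^ n)) := by ring
          _ ≤ 1 / 16 * (2 * (e * (1 / 2) ^ n)) := by gcongr
          _ ≤ e * (1 / 2) ^ (n + 1) := by rw [pow_succ]; linarith
      · rw [hV, hV]
        have h := norm_smul_vfield_sub_le (α := α) hs hσ ht.1 ha2 (hB (n + 1) t ht) (hB n t ht)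
        rw [add_sub_add_left_eq_sub] at h
        refine h.trans ?_
        calc _ ≤ cubConst s * (2 * ε) ^ 2 * (e * (1 / 2) ^ n * T₀) := by
              gcongr
              refine (ih t ht).1.trans ?_
              gcongr
              exact rpow_le_of_le_one ht.1 ht.2.le hT₀ hγ.le hγ1.le
          _ = cubConst s * T₀ * (2 * ε) ^ 2 * (e * (1 / 2) ^ n) := by ring
          _ ≤ growthConst s γ T₀ * (2 * ε) ^ 2 * (e * (1 / 2) ^ n) := by gcongr
          _ ≤ 1 / 16 * (e * (1 / 2) ^ n) := by gcongr
          _ ≤ e * (1 / 2) ^ (n + 1) := by rw [pow_succ]; linarith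
  have hgeo : ∀ t ∈ Ioo 0 T₀, ∀ n, dist (W n t) (W (n + 1) t) ≤ e * T₀ * (1 / 2) ^ n := by
    intro t ht n
    rw [dist_comm, dist_eq_norm]
    refine (hdiff n t ht).1.trans ?_
    have := rpow_le_of_le_one ht.1 ht.2.le hT₀ hγ.le hγ1.le
    calc _ ≤ e * (1 / 2) ^ n * T₀ := by gcongr
      _ = _ := by ring
  have hex : ∀ t, ∃ w : Seq, t ∈ Ioo 0 T₀ → Tendsto (fun n => W n t) atTop (𝓝 w) := by
    intro t
    by_cases ht : t ∈ Ioo 0 T₀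
    · obtain ⟨w, hw⟩ := cauchySeq_tendsto_of_complete
        (cauchySeq_of_le_geometric (1 / 2) (e * T₀) (by norm_num) (hgeo t ht))
      exact ⟨w, fun _ => hw⟩
    · exact ⟨0, fun h => absurd h ht⟩
  choose Wl hWl using hex
  have hdist : ∀ t ∈ Ioo 0 T₀, ∀ n, ‖W n t - Wl t‖ ≤ 2 * (e * T₀) * (1 / 2) ^ n := by
    intro t ht n
    have h := dist_le_of_le_geometric_of_tendsto (1 / 2) (e * T₀) (by norm_num) (hgeo t ht)
      (hWl t ht) n
    rw [dist_eq_norm] at h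
    refine h.trans (le_of_eq ?_)
    ring
  have hWls : ∀ t ∈ Ioo 0 T₀, ‖Wl t‖ ≤ r * t ^ γ := fun t ht =>
    le_of_tendsto (hWl t ht).norm (Eventually.of_forall fun n => (S n).2.small t ht)
  have hBl : ∀ t ∈ Ioo 0 T₀, ‖a + Wl t‖ ≤ 2 * ε := fun t ht =>
    norm_add_le_two_mul ha ((norm_le_of_le_remRadius hγ hγ1 hT₀ hε hsm ht.1 ht.2.le
      (hWls t ht)).trans (by linarith))
  refine ⟨Wl, fun t ht => ⟨?_, hWls t ht⟩⟩
  -- The velocities converge uniformly only away from the origin because of the factor 1/t. The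
  -- interval beyond t/2 is enough to differentiate the limit at t.
  have hsub : ∀ x ∈ Ioo (t / 2) T₀, x ∈ Ioo 0 T₀ := fun x hx => ⟨by linarith [hx.1, ht.1], hx.2⟩
  refine hasDerivAt_of_tendstoUniformlyOn (l := atTop) (f := fun n => W (n + 1))
    (f' := fun n t => vfield σ s α a t (a + W n t))
    (g' := fun t => vfield σ s α a t (a + Wl t)) (isOpen_Ioo (a := t / 2) (b := T₀)) ?_
    (Eventually.of_forall fun n x hx => hWd n x (hsub x hx))
    (fun x hx => (hWl x (hsub x hx)).comp (tendsto_add_atTop_nat 1))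
    ⟨by linarith [ht.1], ht.2⟩
  rw [Metric.tendstoUniformlyOn_iff]
  intro δ hδ
  have hlim : Tendsto (fun n : ℕ => 2 / t * (cubConst s * (2 * ε) ^ 2 *
      (2 * (e * T₀) * (1 / 2) ^ n))) atTop (𝓝 0) := by
    have := ((tendsto_pow_atTop_nhds_zero_of_lt_one (r := (1 / 2 : ℝ)) (by norm_num)
      (by norm_num)).const_mul (2 * (e * T₀))).const_mul (cubConst s * (2 * ε) ^ 2)
    simpa using this.const_mul (2 / t)
  filter_upwards [hlim.eventually_lt_const hδ] with n hn x hx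
  have hx' := hsub x hx
  have ht0 := ht.1
  rw [dist_comm, dist_eq_norm]
  refine lt_of_le_of_lt ?_ hn
  have h := norm_smul_vfield_sub_le (α := α) hs hσ hx'.1 ha2 (hB n x hx') (hBl x hx')
  rw [add_sub_add_left_eq_sub, ← smul_sub, norm_smul, Real.norm_of_nonneg hx'.1.le] at h
  calc _ = x⁻¹ * (x * ‖vfield σ s α a x (a + W n x) - vfield σ s α a x (a + Wl x)‖) := by
        rw [inv_mul_cancel_left₀ hx'.1.ne']
    _ ≤ 2 / t * (cubConst s * (2 * ε) ^ 2 * (2 * (e * T₀) * (1 / 2) ^ n)) := by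
        have hi : x⁻¹ ≤ 2 / t := by
          rw [inv_le_comm₀ hx'.1 (by positivity), inv_div]; exact hx.1.le
        have h' := h.trans (mul_le_mul_of_nonneg_left (hdist x hx' n)
          (show 0 ≤ cubConst s * (2 * ε) ^ 2 by positivity))
        exact mul_le_mul hi h' (mul_nonneg hx'.1.le (norm_nonneg _)) (by positivity)

/-- Bootstrap: a remainder that stays in the ball of radius `ε` obeys the sharp bound. -/
theorem remainder_le_of_le (hs : 1 / 2 < s) (hσ : |σ| ≤ 1) (hα : ∀ k, ‖α k‖ ≤ 1)
    (hγ : 0 < γ) (hγ1 : γ < 1) (hT₀ : 1 ≤ T₀) (hε : 0 ≤ ε) (ha : ‖a‖ ≤ ε)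
    (hsm : 64 * growthConst s γ T₀ * T₀ * ε ^ 2 ≤ 1) (hT : T ≤ T₀) {W : ℝ → Seq} {C : ℝ}
    (hC : 0 ≤ C) (hW : ∀ t ∈ Ioo 0 T, HasDerivAt W (vfield σ s α a t (a + W t)) t)
    (hWC : ∀ t ∈ Ioo 0 T, ‖W t‖ ≤ C * t ^ γ) (hWε : ∀ t ∈ Ioo 0 T, ‖W t‖ ≤ ε) :
    ∀ t ∈ Ioo 0 T, ‖W t‖ ≤ remRadius s γ T₀ ε * t ^ γ := by
  have h0 := remRadius_nonneg (s := s) hγ hT₀ hε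
  have ha2 : ‖a‖ ≤ 2 * ε := by linarith
  have hB : ∀ t ∈ Ioo 0 T, ‖a + W t‖ ≤ 2 * ε := fun t ht => norm_add_le_two_mul ha (hWε t ht)
  intro t ht
  have hT0 : 0 < T := ht.1.trans ht.2
  have hW0 : Tendsto W (𝓝[>] 0) (𝓝 0) := by
    have hlim : Tendsto (fun t : ℝ => C * t ^ γ) (𝓝[>] 0) (𝓝 0) := by
      have h := (Real.continuousAt_rpow_const 0 γ (Or.inr hγ.le)).tendsto.const_mul C
      rw [Real.zero_rpow hγ.ne', mul_zero] at h
      exact h.mono_left nhdsWithin_le_nhds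
    refine squeeze_zero_norm' ?_ hlim
    filter_upwards [Ioo_mem_nhdsGT hT0] with t ht using hWC t ht
  -- A solution is its own Picard image, so the Picard estimate improves any bound r + y on the
  -- coefficient of t^γ to r + y/2. Iterating removes the unspecified constant C.
  have key : ∀ n : ℕ, ∀ t ∈ Ioo 0 T, ‖W t‖ ≤ (remRadius s γ T₀ ε + C * (1 / 2) ^ n) * t ^ γ := by
    intro n
    induction n with
    | zero =>
      intro t ht
      have := Real.rpow_pos_of_pos ht.1 γ
      refine (hWC t ht).trans ?_
      gcongr
      simpa using h0
    | succ n ih =>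
      intro t ht
      have := Real.rpow_pos_of_pos ht.1 γ
      have h := norm_picard_le hs hσ hα hγ hγ1 hT₀ hT
        (show 0 ≤ remRadius s γ T₀ ε + C * (1 / 2) ^ n by positivity) ha2 hW ih hB
        (fun t ht => (norm_smul_vfield_le hs hσ ht.1 ha2 (hB t ht)).trans
          (cube_le_of_small hγ hγ1 hT₀ hε hsm)) hW hW0 t ht
      refine h.trans ?_
      have h2 := growth_le_remRadius (s := s) hγ hT₀ hε hsm
        (show 0 ≤ C * (1 / 2 : ℝ) ^ n by positivity)
      gcongr
      refine h2.trans (le_of_eq ?_)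
      ring
  have hlim : Tendsto (fun n : ℕ => (remRadius s γ T₀ ε + C * (1 / 2) ^ n) * t ^ γ) atTop
      (𝓝 ((remRadius s γ T₀ ε + C * 0) * t ^ γ)) :=
    (((tendsto_pow_atTop_nhds_zero_of_lt_one (by norm_num) (by norm_num)).const_mul C).const_add
      _).mul_const _
  rw [mul_zero, add_zero] at hlim
  exact ge_of_tendsto' hlim fun n => key n t ht

/-- A priori bound: every remainder with some power decay at the origin obeys the sharp bound. -/
theorem remainder_le (hs : 1 / 2 < s) (hσ : |σ| ≤ 1) (hα : ∀ k, ‖α k‖ ≤ 1)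
    (hγ : 0 < γ) (hγ1 : γ < 1) (hT₀ : 1 ≤ T₀) (hε : 0 < ε) (ha : ‖a‖ ≤ ε)
    (hsm : 64 * growthConst s γ T₀ * T₀ * ε ^ 2 ≤ 1) (hT : T ≤ T₀) {W : ℝ → Seq} {C : ℝ}
    (hC : 0 ≤ C) (hW : ∀ t ∈ Ioo 0 T, HasDerivAt W (vfield σ s α a t (a + W t)) t)
    (hWC : ∀ t ∈ Ioo 0 T, ‖W t‖ ≤ C * t ^ γ) :
    ∀ t ∈ Ioo 0 T, ‖W t‖ ≤ remRadius s γ T₀ ε * t ^ γ := by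
  have h0 := remRadius_nonneg (s := s) hγ hT₀ hε.le
  refine remainder_le_of_le hs hσ hα hγ hγ1 hT₀ hε.le ha hsm hT hC hW hWC fun t ht => ?_
  -- Continuity argument: A collects the times up to which the remainder stays in the ball of radius
  -- ε. It is nonempty because Ct^γ tends to 0.
  set A : Set ℝ := {τ | τ ∈ Ioc 0 t ∧ ∀ x ∈ Ioo 0 τ, ‖W x‖ ≤ ε} with hA
  have hAb : BddAbove A := ⟨t, fun τ hτ => hτ.1.2⟩
  have hAne : A.Nonempty := by
    have hlim : Tendsto (fun t : ℝ => C * t ^ γ) (𝓝[>] 0) (𝓝 0) := by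
      have h := (Real.continuousAt_rpow_const 0 γ (Or.inr hγ.le)).tendsto.const_mul C
      rw [Real.zero_rpow hγ.ne', mul_zero] at h
      exact h.mono_left nhdsWithin_le_nhds
    obtain ⟨δ, hδ0, hδ⟩ := mem_nhdsGT_iff_exists_Ioo_subset.1 (hlim.eventually_lt_const hε)
    refine ⟨min δ t, ⟨lt_min hδ0 ht.1, min_le_right _ _⟩, fun x hx => ?_⟩
    have hx' := hδ ⟨hx.1, hx.2.trans_le (min_le_left _ _)⟩
    exact (hWC x ⟨hx.1, (hx.2.trans_le (min_le_right _ _)).trans ht.2⟩).trans (le_of_lt hx')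
  set τ := sSup A
  have hτt : τ ≤ t := csSup_le hAne fun x hx => hx.1.2
  have hτ0 : 0 < τ := by
    obtain ⟨x, hx⟩ := hAne
    exact hx.1.1.trans_le (le_csSup hAb hx)
  have hτε : ∀ x ∈ Ioo 0 τ, ‖W x‖ ≤ ε := fun x hx => by
    obtain ⟨y, hy, hxy⟩ := exists_lt_of_lt_csSup hAne hx.2
    exact hy.2 x ⟨hx.1, hxy⟩
  have hsub : ∀ x ∈ Ioo 0 τ, x ∈ Ioo 0 T := fun x hx => ⟨hx.1, (hx.2.trans_le hτt).trans ht.2⟩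
  have hb := remainder_le_of_le hs hσ hα hγ hγ1 hT₀ hε.le ha hsm ((hτt.trans ht.2.le).trans hT) hC
    (fun x hx => hW x (hsub x hx)) (fun x hx => hWC x (hsub x hx)) hτε
  have hτT : τ ∈ Ioo 0 T := ⟨hτ0, hτt.trans_lt ht.2⟩
  have hcont := (hW τ hτT).continuousAt
  -- Up to the supremum the sharp bound holds and improves ε to ε/4, so by continuity the interval
  -- could be prolonged unless the supremum is t.
  have hWτ : ‖W τ‖ ≤ ε / 4 := by
    have h1 : Tendsto (fun x => ‖W x‖) (𝓝[<] τ) (𝓝 ‖W τ‖) :=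
      (hcont.norm.tendsto).mono_left nhdsWithin_le_nhds
    refine le_of_tendsto h1 ?_
    filter_upwards [Ioo_mem_nhdsLT hτ0] with x hx
    exact norm_le_of_le_remRadius hγ hγ1 hT₀ hε.le hsm hx.1 ((hsub x hx).2.le.trans hT) (hb x hx)
  rcases eq_or_lt_of_le hτt with h | h
  · rw [← h]; linarith
  · exfalso
    have hev : ∀ᶠ x in 𝓝[>] τ, ‖W x‖ < ε :=
      nhdsWithin_le_nhds (hcont.norm.eventually_lt_const (by linarith))
    obtain ⟨δ, hδ0, hδ⟩ := mem_nhdsGT_iff_exists_Ioo_subset.1 hev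
    have hmem : min δ t ∈ A := by
      refine ⟨⟨hτ0.trans (lt_min hδ0 h), min_le_right _ _⟩, fun x hx => ?_⟩
      rcases lt_trichotomy x τ with hxτ | hxτ | hxτ
      · exact hτε x ⟨hx.1, hxτ⟩
      · rw [hxτ]; linarith
      · exact (hδ ⟨hxτ, hx.2.trans_le (min_le_left _ _)⟩ : ‖W x‖ < ε).le
    exact absurd (le_csSup hAb hmem) (not_le.2 (lt_min hδ0 h))

end DiracNLS

end

noncomputable section

namespace DiracNLS

open Filter Topology Set
open scoped ENNReal ComplexConjugate

variable {σ s : ℝ} {α : ℤ → ℂ}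

/-! ### Algebra of the resonant multipliers -/

/-- A vanishing resonance means i = k or i = j. The frequencies then cancel in pairs, and so do the
logarithmic phases. -/
theorem phaseDefect_eq_zero {k : ℤ} {q : ℤ × ℤ} (h : reson k q = 0) : phaseDefect σ α k q = 0 := by
  unfold reson at h
  unfold phaseDefect
  rcases mul_eq_zero.1 h with h | h
  · have : q.1 = k := by omega
    rw [this, show k - k + q.2 = q.2 by ring]
    ring
  · have : q.2 = q.1 := by omega
    rw [this, show k - q.1 + q.1 = k by ring]
    ring

theorem fullMult_eq_one {t : ℝ} {k : ℤ} {q : ℤ × ℤ} (h : reson k q = 0) :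
    fullMult σ α t k q = 1 := by
  simp [fullMult, phaseDefect_eq_zero h, h]

/-- The multiplier of the terms with `i = k`, that is `j = l`. -/
def swapMult (k : ℤ) (q : ℤ × ℤ) : ℂ := if q.1 = k then 1 else 0

theorem norm_swapMult_le (k : ℤ) (q : ℤ × ℤ) : ‖swapMult k q‖ ≤ 1 := by
  unfold swapMult; split_ifs <;> simp

/-- Inclusion–exclusion: the resonant set is the union of {i = j} and {i = k}, whose intersection is
the diagonal. -/
theorem fullMult_eq (t : ℝ) :
    fullMult σ α t = nrMult σ α t + ((pairMult + swapMult) - diagMult) := by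
  funext k q
  simp only [Pi.add_apply, Pi.sub_apply, nrMult, pairMult, swapMult, diagMult]
  by_cases h : reson k q = 0
  · rw [if_pos h, fullMult_eq_one h]
    have h' : q.1 = k ∨ q.1 = q.2 := by
      unfold reson at h
      rcases mul_eq_zero.1 h with h | h <;> [left; right] <;> omega
    by_cases h1 : q.1 = k <;> by_cases h2 : q.1 = q.2 <;> simp_all
  · rw [if_neg h]
    have h1 : q.1 ≠ k := fun h' => h (by simp [reson, h'])
    have h2 : q.1 ≠ q.2 := fun h' => h (by simp [reson, h'])
    simp [h1, h2]

/-- `(i, j) ↦ (k - i + j, j)` for fixed `k`. -/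
def pairSwap (k : ℤ) : ℤ × ℤ ≃ ℤ × ℤ where
  toFun q := (k - q.1 + q.2, q.2)
  invFun q := (k - q.1 + q.2, q.2)
  left_inv q := by ext <;> simp; ring
  right_inv q := by ext <;> simp; ring

/-- Exchanging i and l at fixed k and j preserves the summand when all three arguments agree, and it
carries {i = k} to {i = j}. -/
theorem cub_swapMult (hs : 1 / 2 < s) (B : Seq) : cub s swapMult B B B = cub s pairMult B B B := by
  ext k
  rw [cub_apply hs norm_swapMult_le, cub_apply hs norm_pairMult_le, ← (pairSwap k).tsum_eq]
  refine tsum_congr fun q => ?_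
  have e1 : k - (k - q.1 + q.2) + q.2 = q.1 := by ring
  simp only [cubTerm, pairSwap, Equiv.coe_fn_mk, swapMult, pairMult, kern, e1]
  have e2 : (k - q.1 + q.2 = k) ↔ q.1 = q.2 := by omega
  simp only [e2]
  push_cast
  ring

theorem cub_fullMult (hs : 1 / 2 < s) (t : ℝ) (B : Seq) :
    cub s (fullMult σ α t) B B B = cub s (nrMult σ α t) B B B + cub s resMult B B B := by
  have h1 : ∀ k q, ‖(pairMult + swapMult) k q‖ ≤ 1 + 1 := fun k q =>
    (norm_add_le _ _).trans (add_le_add (norm_pairMult_le k q) (norm_swapMult_le k q))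
  have h2 : ∀ k q, ‖((pairMult + swapMult) - diagMult) k q‖ ≤ 1 + 1 + 1 := fun k q =>
    (norm_sub_le _ _).trans (add_le_add (h1 k q) (norm_diagMult_le k q))
  have h3 : resMult = (pairMult + pairMult) - diagMult := by
    funext k q; simp only [resMult, Pi.add_apply, Pi.sub_apply]; ring
  have h4 : ∀ k q, ‖(pairMult + pairMult) k q‖ ≤ 1 + 1 := fun k q =>
    (norm_add_le _ _).trans (add_le_add (norm_pairMult_le k q) (norm_pairMult_le k q))
  rw [fullMult_eq, cub_add_mul hs (norm_nrMult_le t) h2, h3, cub_sub_mul hs h1 norm_diagMult_le,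
    cub_sub_mul hs h4 norm_diagMult_le, cub_add_mul hs norm_pairMult_le norm_swapMult_le,
    cub_add_mul hs norm_pairMult_le norm_pairMult_le, cub_swapMult hs]

theorem cub_diagMult_apply (hs : 1 / 2 < s) {a : Seq} (ha : ∀ k, a k = weight s k * α k)
    (B : Seq) (k : ℤ) : cub s diagMult a a B k = ((‖α k‖ ^ 2 : ℝ) : ℂ) * B k := by
  rw [cub_apply hs norm_diagMult_le, tsum_eq_single (k, k)]
  · have hw : (weight s k : ℂ) ≠ 0 := by exact_mod_cast weight_ne_zero s k
    simp only [cubTerm, diagMult, kern, ha, map_mul, Complex.conj_ofReal, and_self, if_true,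
      sub_self, zero_add]
    push_cast
    rw [← Complex.mul_conj']
    field_simp
  · intro q hq
    have : ¬ (q.1 = q.2 ∧ q.1 = k) := fun h => hq (by ext <;> simp [← h.1, h.2])
    simp [cubTerm, diagMult, this]

/-- With i = j the weights of the pair cancel, l equals k, and the sum over i decouples. -/
theorem cub_pairMult_apply (hs : 1 / 2 < s) {a : Seq} (ha : ∀ k, a k = weight s k * α k)
    (B : Seq) : cub s pairMult a a B = (mass α : ℂ) • B := by
  ext k
  rw [cub_apply hs norm_pairMult_le, lp.coeFn_smul, Pi.smul_apply, smul_eq_mul, mass,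
    Complex.ofReal_tsum, ← tsum_mul_right]
  have hinj : Function.Injective fun i : ℤ => (i, i) := fun i j h => (Prod.ext_iff.1 h).1
  rw [← hinj.tsum_eq]
  · refine tsum_congr fun i => ?_
    have hw : ∀ k, (weight s k : ℂ) ≠ 0 := fun k => by exact_mod_cast weight_ne_zero s k
    have h1 := hw k
    have h2 := hw i
    simp only [cubTerm, pairMult, kern, ha, map_mul, Complex.conj_ofReal, if_true, sub_add_cancel]
    push_cast
    rw [← Complex.mul_conj']
    field_simp
  · intro q hq
    by_contra h
    refine hq ?_
    have : q.1 ≠ q.2 := fun h' => h ⟨q.1, by ext <;> simp [h']⟩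
    simp [cubTerm, pairMult, this]

/-- This is the resonant contribution subtracted in `resRem`. The multiple of the mass is cancelled
by M/(2πt) in the equation, the diagonal part by the logarithmic phases of the modes. -/
theorem cub_resMult_eq (hs : 1 / 2 < s) {a : Seq} (ha : ∀ k, a k = weight s k * α k)
    (B : Seq) : cub s resMult a a B = (2 * mass α : ℂ) • B - cub s diagMult a a B := by
  have h3 : resMult = (pairMult + pairMult) - diagMult := by
    funext k q; simp only [resMult, Pi.add_apply, Pi.sub_apply]; ring
  have h4 : ∀ k q, ‖(pairMult + pairMult) k q‖ ≤ 1 + 1 := fun k q =>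
    (norm_add_le _ _).trans (add_le_add (norm_pairMult_le k q) (norm_pairMult_le k q))
  rw [h3, cub_sub_mul hs h4 norm_diagMult_le, cub_add_mul hs norm_pairMult_le norm_pairMult_le,
    cub_pairMult_apply hs ha, ← add_smul, two_mul]

/-! ### The modes of the solution -/

/-- The square root `√(4πit)`. -/
def rootDen (t : ℝ) : ℂ := (4 * (Real.pi : ℂ) * Complex.I * (t : ℂ)) ^ (1 / 2 : ℂ)

/-- The total phase of the mode `k`. -/
def modePhase (σ : ℝ) (α : ℤ → ℂ) (k : ℤ) (t x : ℝ) : ℝ :=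
  (x - k) ^ 2 / (4 * t) - σ * (‖α k‖ ^ 2 / (8 * Real.pi)) * Real.log t

/-- The mode `k`, including the logarithmic phase and the weight. -/
def mode (σ s : ℝ) (α : ℤ → ℂ) (k : ℤ) (t x : ℝ) : ℂ :=
  Complex.exp (Complex.I * modePhase σ α k t x) / rootDen t * ((weight s k)⁻¹ : ℝ)

/-- The superposition of modes with (weighted) coefficients `X`. -/
def field (σ s : ℝ) (α : ℤ → ℂ) (t x : ℝ) (X : Seq) : ℂ := ∑' k, mode σ s α k t x * X k

theorem norm_rootDen {t : ℝ} (ht : 0 < t) : ‖rootDen t‖ = √(4 * Real.pi * t) := by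
  have h0 : (4 * (Real.pi : ℂ) * Complex.I * (t : ℂ)) ≠ 0 := by
    simp [Real.pi_ne_zero, ht.ne']
  rw [rootDen, Complex.norm_cpow_of_ne_zero h0]
  have : (1 / 2 : ℂ).im = 0 := by norm_num
  have h2 : (1 / 2 : ℂ).re = 1 / 2 := by norm_num
  rw [this, h2, mul_zero, Real.exp_zero, div_one, Real.sqrt_eq_rpow]
  simp [abs_of_pos Real.pi_pos, abs_of_pos ht]

theorem norm_rootDen_sq {t : ℝ} (ht : 0 < t) : ‖rootDen t‖ ^ 2 = 4 * Real.pi * t := by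
  rw [norm_rootDen ht, Real.sq_sqrt (by positivity)]

theorem rootDen_ne_zero {t : ℝ} (ht : 0 < t) : rootDen t ≠ 0 := by
  rw [← norm_ne_zero_iff, norm_rootDen ht]
  positivity

theorem hasDerivAt_rootDen {t : ℝ} (ht : 0 < t) :
    HasDerivAt rootDen (rootDen t / (2 * t)) t := by
  have h0 : (4 * (Real.pi : ℂ) * Complex.I * (t : ℂ)) ≠ 0 := by
    simp [Real.pi_ne_zero, ht.ne']
  -- For t > 0 the base lies on the positive imaginary axis, off the cut of the principal branch.
  have hsl : (4 * (Real.pi : ℂ) * Complex.I * (t : ℂ)) ∈ Complex.slitPlane := by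
    rw [Complex.mem_slitPlane_iff]
    right
    simp [Real.pi_ne_zero, ht.ne']
  have h1 : HasDerivAt (fun z : ℂ => 4 * (Real.pi : ℂ) * Complex.I * z)
      (4 * (Real.pi : ℂ) * Complex.I * 1) (t : ℂ) :=
    (hasDerivAt_id (t : ℂ)).const_mul (4 * (Real.pi : ℂ) * Complex.I)
  have h2 := (h1.cpow_const (c := (1 / 2 : ℂ)) hsl).comp_ofReal
  refine h2.congr_deriv ?_
  have ht' : (t : ℂ) ≠ 0 := by exact_mod_cast ht.ne'
  rw [Complex.cpow_sub _ _ h0, Complex.cpow_one, rootDen]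
  have hpi : (Real.pi : ℂ) ≠ 0 := by exact_mod_cast Real.pi_ne_zero
  field_simp

theorem norm_exp_I_mul (r : ℝ) : ‖Complex.exp (Complex.I * r)‖ = 1 := by
  rw [mul_comm]; exact Complex.norm_exp_ofReal_mul_I r

theorem norm_mode {t : ℝ} (ht : 0 < t) (k : ℤ) (x : ℝ) :
    ‖mode σ s α k t x‖ = (√(4 * Real.pi * t))⁻¹ * (weight s k)⁻¹ := by
  rw [mode, norm_mul, norm_div, norm_exp_I_mul, norm_rootDen ht, Complex.norm_real,
    Real.norm_of_nonneg (inv_nonneg.2 (weight_pos s k).le), one_div]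

theorem summable_norm_mode_mul (hs : 1 / 2 < s) {t : ℝ} (ht : 0 < t) (x : ℝ) (X : Seq) :
    Summable fun k => ‖mode σ s α k t x * X k‖ := by
  have := (summable_inv_weight_mul hs X).mul_left (√(4 * Real.pi * t))⁻¹
  refine this.congr fun k => ?_
  rw [norm_mul, norm_mode ht]
  ring

theorem tsum_norm_mode_mul_le (hs : 1 / 2 < s) {t : ℝ} (ht : 0 < t) (x : ℝ) (X : Seq) :
    ∑' k, ‖mode σ s α k t x * X k‖ ≤ (√(4 * Real.pi * t))⁻¹ * (√(invWeightSum s) * ‖X‖) := by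
  have := tsum_inv_weight_mul_le hs X
  simp_rw [norm_mul, norm_mode ht, mul_assoc]
  rw [tsum_mul_left]
  gcongr

theorem norm_field_le (hs : 1 / 2 < s) {t : ℝ} (ht : 0 < t) (x : ℝ) (X : Seq) :
    ‖field σ s α t x X‖ ≤ (√(4 * Real.pi * t))⁻¹ * (√(invWeightSum s) * ‖X‖) :=
  (norm_tsum_le_tsum_norm (summable_norm_mode_mul hs ht x X)).trans
    (tsum_norm_mode_mul_le hs ht x X)

theorem field_add (hs : 1 / 2 < s) {t : ℝ} (ht : 0 < t) (x : ℝ) (X Y : Seq) :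
    field σ s α t x (X + Y) = field σ s α t x X + field σ s α t x Y := by
  rw [field, field, field, ← (summable_norm_mode_mul hs ht x X).of_norm.tsum_add
    (summable_norm_mode_mul hs ht x Y).of_norm]
  refine tsum_congr fun k => ?_
  rw [lp.coeFn_add, Pi.add_apply, mul_add]

theorem field_sub (hs : 1 / 2 < s) {t : ℝ} (ht : 0 < t) (x : ℝ) (X Y : Seq) :
    field σ s α t x (X - Y) = field σ s α t x X - field σ s α t x Y := by
  rw [field, field, field, ← (summable_norm_mode_mul hs ht x X).of_norm.tsum_sub
    (summable_norm_mode_mul hs ht x Y).of_norm]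
  refine tsum_congr fun k => ?_
  rw [lp.coeFn_sub, Pi.sub_apply, mul_sub]

theorem field_smul (t x : ℝ) (c : ℂ) (X : Seq) :
    field σ s α t x (c • X) = c * field σ s α t x X := by
  rw [field, field, ← tsum_mul_left]
  refine tsum_congr fun k => ?_
  rw [lp.coeFn_smul, Pi.smul_apply, smul_eq_mul]
  ring

theorem hasDerivAt_modePhase_time {t : ℝ} (ht : 0 < t) (k : ℤ) (x : ℝ) :
    HasDerivAt (fun τ => modePhase σ α k τ x)
      (-((x - k) ^ 2 / (4 * t ^ 2)) - σ * (‖α k‖ ^ 2 / (8 * Real.pi)) / t) t := by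
  have ha := (((hasDerivAt_id t).const_mul 4).inv (by simpa using ht.ne')).const_mul ((x - k) ^ 2)
  have hb := (Real.hasDerivAt_log ht.ne').const_mul (σ * (‖α k‖ ^ 2 / (8 * Real.pi)))
  refine (ha.sub hb).congr_deriv ?_
  simp only [id]
  field_simp

theorem hasDerivAt_modePhase_space (t : ℝ) (k : ℤ) (x : ℝ) :
    HasDerivAt (fun y => modePhase σ α k t y) (2 * (x - k) / (4 * t)) x := by
  have h := (((((hasDerivAt_id x).sub_const (k : ℝ)).pow 2).div_const (4 * t)).sub_const
    (σ * (‖α k‖ ^ 2 / (8 * Real.pi)) * Real.log t))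
  refine h.congr_deriv ?_
  simp

/-- The logarithmic derivative of a mode in time. -/
def modeT (σ : ℝ) (α : ℤ → ℂ) (k : ℤ) (t x : ℝ) : ℂ :=
  Complex.I * ((-((x - k) ^ 2 / (4 * t ^ 2)) - σ * (‖α k‖ ^ 2 / (8 * Real.pi)) / t : ℝ) : ℂ)
    - 1 / (2 * t)

/-- The logarithmic derivative of a mode in space. -/
def modeX (k : ℤ) (t x : ℝ) : ℂ := Complex.I * ((2 * (x - k) / (4 * t) : ℝ) : ℂ)

theorem hasDerivAt_mode_time {t : ℝ} (ht : 0 < t) (k : ℤ) (x : ℝ) :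
    HasDerivAt (fun τ => mode σ s α k τ x) (modeT σ α k t x * mode σ s α k t x) t := by
  have h1 := ((hasDerivAt_modePhase_time (σ := σ) (α := α) ht k x).ofReal_comp.const_mul
    Complex.I).cexp
  have h2 := (h1.div (hasDerivAt_rootDen ht) (rootDen_ne_zero ht)).mul_const
    (((weight s k)⁻¹ : ℝ) : ℂ)
  refine h2.congr_deriv ?_
  have hr := rootDen_ne_zero ht
  have ht' : (t : ℂ) ≠ 0 := by exact_mod_cast ht.ne'
  simp only [mode, modeT]
  field_simp

theorem hasDerivAt_mode_space {t : ℝ} (ht : 0 < t) (k : ℤ) (x : ℝ) :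
    HasDerivAt (fun y => mode σ s α k t y) (modeX k t x * mode σ s α k t x) x := by
  have h1 := ((hasDerivAt_modePhase_space (σ := σ) (α := α) t k x).ofReal_comp.const_mul
    Complex.I).cexp
  have h2 := (h1.div_const (rootDen t)).mul_const (((weight s k)⁻¹ : ℝ) : ℂ)
  refine h2.congr_deriv ?_
  have hr := rootDen_ne_zero ht
  simp only [mode, modeX]
  field_simp

theorem hasDerivAt_modeX (t : ℝ) (k : ℤ) (x : ℝ) :
    HasDerivAt (fun y => modeX k t y) (Complex.I / (2 * t)) x := by
  have h := ((((hasDerivAt_id x).sub_const (k : ℝ)).const_mul 2).div_const (4 * t)).ofReal_comp.const_mul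
    Complex.I
  refine h.congr_deriv ?_
  push_cast
  rcases eq_or_ne (t : ℂ) 0 with h0 | h0
  · simp [h0]
  · field_simp; norm_num

/-- Each mode solves the free equation up to its logarithmic phase. -/
theorem mode_equation {t : ℝ} (ht : 0 < t) (k : ℤ) (x : ℝ) :
    Complex.I * modeT σ α k t x + (Complex.I / (2 * t) + modeX k t x * modeX k t x) =
      ((σ / (8 * Real.pi * t) * ‖α k‖ ^ 2 : ℝ) : ℂ) := by
  have ht' : (t : ℂ) ≠ 0 := by exact_mod_cast ht.ne'
  have hpi : (Real.pi : ℂ) ≠ 0 := by exact_mod_cast Real.pi_ne_zero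
  simp only [modeT, modeX]
  push_cast
  field_simp
  ring_nf
  simp only [Complex.I_sq]
  ring

theorem continuousOn_modePhase (k : ℤ) :
    ContinuousOn (fun z : ℝ × ℝ => modePhase σ α k z.1 z.2) (Ioi 0 ×ˢ univ) := by
  unfold modePhase
  have h : ∀ z ∈ (Ioi (0 : ℝ) ×ˢ (univ : Set ℝ)), z.1 ≠ 0 := fun z hz => (show 0 < z.1 from hz.1).ne'
  refine ContinuousOn.sub (ContinuousOn.div (by fun_prop) (by fun_prop) fun z hz => ?_)
    (continuousOn_const.mul (ContinuousOn.log (by fun_prop) h))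
  simpa using h z hz

theorem continuousOn_mode (k : ℤ) :
    ContinuousOn (fun z : ℝ × ℝ => mode σ s α k z.1 z.2) (Ioi 0 ×ˢ univ) := by
  unfold mode
  have hr : ContinuousOn (fun z : ℝ × ℝ => rootDen z.1) (Ioi 0 ×ˢ univ) := fun z hz =>
    ((hasDerivAt_rootDen (show 0 < z.1 from hz.1)).continuousAt.comp
      continuous_fst.continuousAt).continuousWithinAt
  exact ((Complex.continuous_exp.comp_continuousOn (continuousOn_const.mul
    (Complex.continuous_ofReal.comp_continuousOn (continuousOn_modePhase k)))).div hr
    fun z hz => rootDen_ne_zero hz.1).mul continuousOn_const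

theorem continuousOn_modeT (k : ℤ) :
    ContinuousOn (fun z : ℝ × ℝ => modeT σ α k z.1 z.2) (Ioi 0 ×ˢ univ) := by
  unfold modeT
  have h : ∀ z ∈ (Ioi (0 : ℝ) ×ˢ (univ : Set ℝ)), z.1 ≠ 0 := fun z hz => (show 0 < z.1 from hz.1).ne'
  refine ContinuousOn.sub (continuousOn_const.mul (Complex.continuous_ofReal.comp_continuousOn
    (ContinuousOn.sub (ContinuousOn.neg (ContinuousOn.div (by fun_prop) (by fun_prop)
      fun z hz => ?_)) (ContinuousOn.div (by fun_prop) (by fun_prop) h))))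
    (ContinuousOn.div (by fun_prop) (by fun_prop) fun z hz => ?_)
  · simpa using h z hz
  · simpa using h z hz

theorem continuousOn_modeX (k : ℤ) :
    ContinuousOn (fun z : ℝ × ℝ => modeX k z.1 z.2) (Ioi 0 ×ˢ univ) := by
  unfold modeX
  have h : ∀ z ∈ (Ioi (0 : ℝ) ×ˢ (univ : Set ℝ)), z.1 ≠ 0 := fun z hz => (show 0 < z.1 from hz.1).ne'
  refine continuousOn_const.mul (Complex.continuous_ofReal.comp_continuousOn
    (ContinuousOn.div (by fun_prop) (by fun_prop) fun z hz => ?_))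
  simpa using h z hz

/-- Joint continuity of superpositions of modes. -/
theorem continuousOn_field (hs : 1 / 2 < s) {X : ℝ → Seq} {T : ℝ}
    (hX : ∀ t ∈ Ioo 0 T, ContinuousAt X t) :
    ContinuousOn (fun z : ℝ × ℝ => field σ s α z.1 z.2 (X z.1)) (Ioo 0 T ×ˢ univ) := by
  intro z₀ hz₀
  refine ContinuousAt.continuousWithinAt ?_
  have ht₀ : 0 < z₀.1 := hz₀.1.1
  -- Times beyond half of the base time give a common bound on the prefactor of the modes.
  have hnear : ∀ᶠ z : ℝ × ℝ in 𝓝 z₀, z₀.1 / 2 < z.1 :=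
    continuous_fst.continuousAt.eventually_const_lt (by linarith)
  set c := (√(4 * Real.pi * (z₀.1 / 2)))⁻¹
  have hc : ∀ t, z₀.1 / 2 < t → (√(4 * Real.pi * t))⁻¹ ≤ c := fun t ht => by
    refine inv_anti₀ (Real.sqrt_pos.2 (by positivity)) (Real.sqrt_le_sqrt ?_)
    have := Real.pi_pos
    gcongr
  have h1 : Tendsto (fun z : ℝ × ℝ => field σ s α z.1 z.2 (X z₀.1)) (𝓝 z₀)
      (𝓝 (field σ s α z₀.1 z₀.2 (X z₀.1))) := by
    refine tendsto_tsum_of_dominated ((summable_inv_weight_mul hs (X z₀.1)).mul_left c)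
      (fun k => ?_) ?_
    · have := ((continuousOn_mode (σ := σ) (s := s) (α := α) k).continuousAt
        ((isOpen_Ioi.prod isOpen_univ).mem_nhds ⟨ht₀, mem_univ z₀.2⟩))
      exact this.tendsto.mul_const _
    · filter_upwards [hnear] with z hz k
      rw [norm_mul, norm_mode (by linarith), mul_assoc]
      have := weight_pos s k
      gcongr
      exact hc _ hz
  have h2 : Tendsto (fun z : ℝ × ℝ => field σ s α z.1 z.2 (X z.1 - X z₀.1)) (𝓝 z₀) (𝓝 0) := by
    have hlim : Tendsto (fun z : ℝ × ℝ => c * (√(invWeightSum s) * ‖X z.1 - X z₀.1‖)) (𝓝 z₀)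
        (𝓝 0) := by
      have h := ((hX z₀.1 hz₀.1).tendsto.comp (continuous_fst.tendsto z₀)).sub_const (X z₀.1)
      rw [sub_self] at h
      simpa using (h.norm.const_mul √(invWeightSum s)).const_mul c
    refine squeeze_zero_norm' ?_ hlim
    filter_upwards [hnear] with z hz
    refine (norm_field_le hs (by linarith) _ _).trans ?_
    gcongr
    exact hc _ hz
  have h3 := h2.add h1
  rw [zero_add] at h3
  refine h3.congr' ?_
  filter_upwards [hnear] with z hz
  rw [← field_add hs (by linarith), sub_add_cancel]

/-! ### The cubic nonlinearity on superpositions of modes -/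

/-- `((i, j), l)` in terms of `(k, (i, j))`, `k = i - j + l`. -/
def tripleEquiv : ℤ × (ℤ × ℤ) ≃ (ℤ × ℤ) × ℤ where
  toFun p := (p.2, p.1 - p.2.1 + p.2.2)
  invFun p := (p.2 + p.1.1 - p.1.2, p.1)
  left_inv p := by ext <;> simp; ring
  right_inv p := by ext <;> simp; ring

/-- Since k = i - j + l, the terms of (x-i)² - (x-j)² + (x-l)² - (x-k)² involving x cancel, leaving
the constant -r. The logarithmic phases add up to the phase defect, and |√(4πit)|² = 4πt gives the
prefactor. -/
theorem mode_mul_mode {t : ℝ} (ht : 0 < t) (x : ℝ) (k : ℤ) (q : ℤ × ℤ) :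
    mode σ s α q.1 t x * conj (mode σ s α q.2 t x) * mode σ s α (k - q.1 + q.2) t x =
      ((4 * Real.pi * t : ℝ) : ℂ)⁻¹ * (mode σ s α k t x * (fullMult σ α t k q * kern s k q)) := by
  have hr := rootDen_ne_zero ht
  have hr' : conj (rootDen t) ≠ 0 := by simpa using hr
  have hrr : ((4 * Real.pi * t : ℝ) : ℂ) = rootDen t * conj (rootDen t) := by
    rw [Complex.mul_conj', ← norm_rootDen_sq ht]; push_cast; rfl
  have hw : (weight s k : ℂ) ≠ 0 := by exact_mod_cast weight_ne_zero s k
  have hexp : Complex.exp (Complex.I * modePhase σ α q.1 t x) *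
      conj (Complex.exp (Complex.I * modePhase σ α q.2 t x)) *
      Complex.exp (Complex.I * modePhase σ α (k - q.1 + q.2) t x) =
      Complex.exp (Complex.I * modePhase σ α k t x) * fullMult σ α t k q := by
    rw [← Complex.exp_conj, fullMult, ← Complex.exp_add, ← Complex.exp_add, ← Complex.exp_add]
    congr 1
    rw [map_mul, Complex.conj_I, Complex.conj_ofReal, neg_mul, ← sub_eq_add_neg, ← mul_sub,
      ← mul_add, ← mul_add]
    congr 1
    norm_cast
    simp only [modePhase, phaseDefect, reson]
    push_cast
    field_simp
    ring
  simp only [mode, map_mul, map_div₀, Complex.conj_ofReal, hrr, kern]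
  calc _ = (Complex.exp (Complex.I * modePhase σ α q.1 t x) *
      conj (Complex.exp (Complex.I * modePhase σ α q.2 t x)) *
      Complex.exp (Complex.I * modePhase σ α (k - q.1 + q.2) t x)) *
      (((weight s q.1)⁻¹ * (weight s q.2)⁻¹ * (weight s (k - q.1 + q.2))⁻¹ : ℝ) : ℂ) /
      (rootDen t * conj (rootDen t) * rootDen t) := by
        push_cast
        field_simp
    _ = _ := by
        rw [hexp]
        push_cast
        field_simp

theorem tripleEquiv_apply (p : ℤ × (ℤ × ℤ)) :
    tripleEquiv p = (p.2, p.1 - p.2.1 + p.2.2) := rfl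

theorem tsum_triple {f : ℤ → ℂ}
    (h : Summable fun p : (ℤ × ℤ) × ℤ => ‖f p.1.1 * conj (f p.1.2) * f p.2‖) :
    ∑' p : (ℤ × ℤ) × ℤ, f p.1.1 * conj (f p.1.2) * f p.2 =
      ∑' (k : ℤ) (q : ℤ × ℤ), f q.1 * conj (f q.2) * f (k - q.1 + q.2) := by
  have hs2 : Summable fun p : ℤ × (ℤ × ℤ) =>
      f p.2.1 * conj (f p.2.2) * f (p.1 - p.2.1 + p.2.2) := by
    have h := (tripleEquiv.summable_iff
      (f := fun p : (ℤ × ℤ) × ℤ => f p.1.1 * conj (f p.1.2) * f p.2)).2 h.of_norm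
    exact h
  rw [← tripleEquiv.tsum_eq]
  simp only [tripleEquiv_apply]
  exact hs2.tsum_prod

theorem norm_sq_mul_tsum_eq {f : ℤ → ℂ} (hsum : Summable fun k => ‖f k‖)
    (hsum' : Summable fun k => ‖conj (f k)‖)
    (hprod : Summable fun p : ℤ × ℤ => ‖f p.1 * conj (f p.2)‖) :
    ((‖∑' k, f k‖ ^ 2 : ℝ) : ℂ) * ∑' k, f k =
      ∑' p : (ℤ × ℤ) × ℤ, f p.1.1 * conj (f p.1.2) * f p.2 := by
  rw [← tsum_mul_tsum_of_summable_norm hprod hsum, ← tsum_mul_tsum_of_summable_norm hsum hsum',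
    ← Complex.conj_tsum]
  push_cast
  rw [← Complex.mul_conj']

/-- Absolute convergence allows the triple product to be expanded and regrouped by the output
frequency k = i - j + l. -/
theorem norm_sq_mul_tsum {f : ℤ → ℂ} (hsum : Summable fun k => ‖f k‖) :
    ((‖∑' k, f k‖ ^ 2 : ℝ) : ℂ) * ∑' k, f k =
      ∑' (k : ℤ) (q : ℤ × ℤ), f q.1 * conj (f q.2) * f (k - q.1 + q.2) := by
  have hsum' : Summable fun k => ‖conj (f k)‖ := hsum.congr fun k => by rw [RCLike.norm_conj]
  have hprod : Summable fun p : ℤ × ℤ => ‖f p.1 * conj (f p.2)‖ :=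
    Summable.mul_norm (f := f) (g := fun k => conj (f k)) hsum hsum'
  have htrip : Summable fun p : (ℤ × ℤ) × ℤ => ‖f p.1.1 * conj (f p.1.2) * f p.2‖ :=
    Summable.mul_norm (f := fun p : ℤ × ℤ => f p.1 * conj (f p.2)) (g := f) hprod hsum
  rw [norm_sq_mul_tsum_eq hsum hsum' hprod, tsum_triple htrip]

/-- The cubic nonlinearity in terms of the trilinear operator. -/
theorem norm_sq_mul_field (hs : 1 / 2 < s) {t : ℝ} (ht : 0 < t) (x : ℝ) (B : Seq) :
    ((‖field σ s α t x B‖ ^ 2 : ℝ) : ℂ) * field σ s α t x B =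
      ((4 * Real.pi * t : ℝ) : ℂ)⁻¹ * field σ s α t x (cub s (fullMult σ α t) B B B) := by
  rw [field, norm_sq_mul_tsum (summable_norm_mode_mul hs ht x B), field, ← tsum_mul_left]
  refine tsum_congr fun k => ?_
  rw [cub_apply hs (norm_fullMult_le t), ← tsum_mul_left, ← tsum_mul_left]
  refine tsum_congr fun q => ?_
  have h := mode_mul_mode (σ := σ) (s := s) (α := α) ht x k q
  simp only [map_mul, cubTerm]
  calc _ = mode σ s α q.1 t x * conj (mode σ s α q.2 t x) * mode σ s α (k - q.1 + q.2) t x *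
        (B q.1 * conj (B q.2) * B (k - q.1 + q.2)) := by ring
    _ = _ := by rw [h]; ring

end DiracNLS

end

noncomputable section

namespace DiracNLS

open Filter Topology Set MeasureTheory

/-! ### Integration by parts against test functions on a strip -/

theorem HasCompactSupport.slice_fst {G : ℝ × ℝ → ℂ} (hG : HasCompactSupport G) (x : ℝ) :
    HasCompactSupport fun t => G (t, x) :=
  HasCompactSupport.intro (hG.isCompact.image continuous_fst) fun t ht => by
    by_contra h
    exact ht ⟨(t, x), subset_tsupport _ h, rfl⟩

theorem HasCompactSupport.slice_snd {G : ℝ × ℝ → ℂ} (hG : HasCompactSupport G) (t : ℝ) :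
    HasCompactSupport fun x => G (t, x) :=
  HasCompactSupport.intro (hG.isCompact.image continuous_snd) fun x hx => by
    by_contra h
    exact hx ⟨(t, x), subset_tsupport _ h, rfl⟩

/-- By Fubini, each time slice is the integral of the derivative of a compactly supported function.
-/
theorem integral_eq_zero_of_hasDerivAt_fst {F F' : ℝ × ℝ → ℂ} (hF : Continuous F)
    (hFc : HasCompactSupport F) (hF' : Continuous F') (hFc' : HasCompactSupport F')
    (h : ∀ t x, HasDerivAt (fun τ => F (τ, x)) (F' (t, x)) t) : ∫ z, F' z = 0 := by
  rw [Measure.volume_eq_prod, integral_prod_symm _ (by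
    rw [← Measure.volume_eq_prod]; exact hF'.integrable_of_hasCompactSupport hFc')]
  refine integral_eq_zero_of_ae (Eventually.of_forall fun x => ?_)
  exact integral_eq_zero_of_hasDerivAt_of_integrable (fun t => h t x)
    ((hF'.comp (by fun_prop)).integrable_of_hasCompactSupport (HasCompactSupport.slice_fst hFc' x))
    ((hF.comp (by fun_prop)).integrable_of_hasCompactSupport (HasCompactSupport.slice_fst hFc x))

theorem integral_eq_zero_of_hasDerivAt_snd {F F' : ℝ × ℝ → ℂ} (hF : Continuous F)
    (hFc : HasCompactSupport F) (hF' : Continuous F') (hFc' : HasCompactSupport F')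
    (h : ∀ t x, HasDerivAt (fun y => F (t, y)) (F' (t, x)) x) : ∫ z, F' z = 0 := by
  rw [Measure.volume_eq_prod, integral_prod _ (by
    rw [← Measure.volume_eq_prod]; exact hF'.integrable_of_hasCompactSupport hFc')]
  refine integral_eq_zero_of_ae (Eventually.of_forall fun t => ?_)
  exact integral_eq_zero_of_hasDerivAt_of_integrable (fun x => h t x)
    ((hF'.comp (by fun_prop)).integrable_of_hasCompactSupport (HasCompactSupport.slice_snd hFc' t))
    ((hF.comp (by fun_prop)).integrable_of_hasCompactSupport (HasCompactSupport.slice_snd hFc t))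

/-- The modes are controlled only for t > 0. A factor supported inside the open set makes the
product continuous on the whole plane. -/
theorem continuous_mul_of_tsupport_subset {U : Set (ℝ × ℝ)} (hU : IsOpen U) {f ψ : ℝ × ℝ → ℂ}
    (hf : ContinuousOn f U) (hψ : Continuous ψ) (hsub : tsupport ψ ⊆ U) :
    Continuous fun z => f z * ψ z :=
  (hf.mul hψ.continuousOn).continuous_of_tsupport_subset hU
    ((tsupport_mul_subset_right (f := f) (g := ψ)).trans hsub)

theorem integrable_mul_of_tsupport_subset {U : Set (ℝ × ℝ)} (hU : IsOpen U) {f ψ : ℝ × ℝ → ℂ}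
    (hf : ContinuousOn f U) (hψ : Continuous ψ) (hc : HasCompactSupport ψ)
    (hsub : tsupport ψ ⊆ U) : Integrable fun z => f z * ψ z :=
  (continuous_mul_of_tsupport_subset hU hf hψ hsub).integrable_of_hasCompactSupport hc.mul_left

/-! ### Partial derivatives of test functions -/

section Test

variable {Φ : ℝ × ℝ → ℂ}

/-- The time derivative of a function on the plane. -/
def partialT (Φ : ℝ × ℝ → ℂ) (z : ℝ × ℝ) : ℂ := fderiv ℝ Φ z (1, 0)

/-- The space derivative of a function on the plane. -/
def partialX (Φ : ℝ × ℝ → ℂ) (z : ℝ × ℝ) : ℂ := fderiv ℝ Φ z (0, 1)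

theorem contDiff_partialT (h : ContDiff ℝ ∞ Φ) : ContDiff ℝ ∞ (partialT Φ) :=
  (h.fderiv_right le_rfl).clm_apply contDiff_const

theorem contDiff_partialX (h : ContDiff ℝ ∞ Φ) : ContDiff ℝ ∞ (partialX Φ) :=
  (h.fderiv_right le_rfl).clm_apply contDiff_const

theorem tsupport_partialT_subset : tsupport (partialT Φ) ⊆ tsupport Φ :=
  tsupport_fderiv_apply_subset ℝ _

theorem tsupport_partialX_subset : tsupport (partialX Φ) ⊆ tsupport Φ :=
  tsupport_fderiv_apply_subset ℝ _

theorem hasDerivAt_partialT (h : ContDiff ℝ ∞ Φ) (t x : ℝ) :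
    HasDerivAt (fun τ => Φ (τ, x)) (partialT Φ (t, x)) t := by
  have h1 := (h.differentiable (by simp)).differentiableAt (x := (t, x)) |>.hasFDerivAt
  exact h1.comp_hasDerivAt t ((hasDerivAt_id t).prodMk (hasDerivAt_const t x))

theorem hasDerivAt_partialX (h : ContDiff ℝ ∞ Φ) (t x : ℝ) :
    HasDerivAt (fun y => Φ (t, y)) (partialX Φ (t, x)) x := by
  have h1 := (h.differentiable (by simp)).differentiableAt (x := (t, x)) |>.hasFDerivAt
  exact h1.comp_hasDerivAt x ((hasDerivAt_const x t).prodMk (hasDerivAt_id x))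

theorem iteratedDeriv_two_eq (h : ContDiff ℝ ∞ Φ) (t x : ℝ) :
    iteratedDeriv 2 (fun y => Φ (t, y)) x = partialX (partialX Φ) (t, x) := by
  rw [iteratedDeriv_succ, iteratedDeriv_one]
  have : deriv (fun y => Φ (t, y)) = fun y => partialX Φ (t, y) :=
    funext fun y => (hasDerivAt_partialX h t y).deriv
  rw [this]
  exact (hasDerivAt_partialX (contDiff_partialX h) t x).deriv

variable {U : Set (ℝ × ℝ)} {f ft fx fxx : ℝ × ℝ → ℂ}

theorem eventually_zero_of_notMem_tsupport {z : ℝ × ℝ} (hz : z ∉ tsupport Φ) :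
    ∀ᶠ w in 𝓝 z, Φ w = 0 :=
  notMem_tsupport_iff_eventuallyEq.1 hz

theorem integral_time_parts (hU : IsOpen U) (hΦ : ContDiff ℝ ∞ Φ) (hc : HasCompactSupport Φ)
    (hsub : tsupport Φ ⊆ U) (hf : ContinuousOn f U) (hft : ContinuousOn ft U)
    (hdt : ∀ t x, (t, x) ∈ U → HasDerivAt (fun τ => f (τ, x)) (ft (t, x)) t) :
    ∫ z, (ft z * Φ z + f z * partialT Φ z) = 0 := by
  have hsubT := tsupport_partialT_subset.trans hsub
  have hcT : HasCompactSupport (partialT Φ) := hc.fderiv_apply ℝ _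
  have hΦT := (contDiff_partialT hΦ).continuous
  refine integral_eq_zero_of_hasDerivAt_fst (F := fun z => f z * Φ z)
    (continuous_mul_of_tsupport_subset hU hf hΦ.continuous hsub) hc.mul_left
    ((continuous_mul_of_tsupport_subset hU hft hΦ.continuous hsub).add
      (continuous_mul_of_tsupport_subset hU hf hΦT hsubT)) (hc.mul_left.add hcT.mul_left)
    fun t x => ?_
  by_cases h : (t, x) ∈ tsupport Φ
  · exact (hdt t x (hsub h)).mul (hasDerivAt_partialT hΦ t x)
  · have h1 : Φ (t, x) = 0 := image_eq_zero_of_notMem_tsupport h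
    have h2 : partialT Φ (t, x) = 0 :=
      image_eq_zero_of_notMem_tsupport fun h' => h (tsupport_partialT_subset h')
    simp only [h1, h2, mul_zero, add_zero]
    -- Nothing is known about f here, but the product vanishes in a neighbourhood of the point.
    refine (hasDerivAt_const t (0 : ℂ)).congr_of_eventuallyEq ?_
    have hcont : Tendsto (fun τ : ℝ => (τ, x)) (𝓝 t) (𝓝 (t, x)) :=
      (Continuous.tendsto (by fun_prop) t)
    filter_upwards [hcont.eventually (eventually_zero_of_notMem_tsupport h)] with τ hτ
    rw [hτ, mul_zero]

theorem integral_space_parts (hU : IsOpen U) (hΦ : ContDiff ℝ ∞ Φ) (hc : HasCompactSupport Φ)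
    (hsub : tsupport Φ ⊆ U) (hf : ContinuousOn f U) (hfx : ContinuousOn fx U)
    (hfxx : ContinuousOn fxx U)
    (hdx : ∀ t x, (t, x) ∈ U → HasDerivAt (fun y => f (t, y)) (fx (t, x)) x)
    (hdxx : ∀ t x, (t, x) ∈ U → HasDerivAt (fun y => fx (t, y)) (fxx (t, x)) x) :
    ∫ z, (f z * partialX (partialX Φ) z - fxx z * Φ z) = 0 := by
  have hX := contDiff_partialX hΦ
  have hXX := contDiff_partialX hX
  have hsubX := tsupport_partialX_subset.trans hsub
  have hsubXX := tsupport_partialX_subset.trans hsubX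
  have hcX : HasCompactSupport (partialX Φ) := hc.fderiv_apply ℝ _
  have hcXX : HasCompactSupport (partialX (partialX Φ)) := hcX.fderiv_apply ℝ _
  refine integral_eq_zero_of_hasDerivAt_snd (F := fun z => f z * partialX Φ z - fx z * Φ z)
    ((continuous_mul_of_tsupport_subset hU hf hX.continuous hsubX).sub
      (continuous_mul_of_tsupport_subset hU hfx hΦ.continuous hsub))
    (hcX.mul_left.sub hc.mul_left)
    ((continuous_mul_of_tsupport_subset hU hf hXX.continuous hsubXX).sub
      (continuous_mul_of_tsupport_subset hU hfxx hΦ.continuous hsub))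
    (hcXX.mul_left.sub hc.mul_left) fun t x => ?_
  by_cases h : (t, x) ∈ tsupport Φ
  · refine (((hdx t x (hsub h)).mul (hasDerivAt_partialX hX t x)).sub
      ((hdxx t x (hsub h)).mul (hasDerivAt_partialX hΦ t x))).congr_deriv ?_
    ring
  · have hX' : (t, x) ∉ tsupport (partialX Φ) := fun h' => h (tsupport_partialX_subset h')
    have h1 : Φ (t, x) = 0 := image_eq_zero_of_notMem_tsupport h
    have h2 : partialX (partialX Φ) (t, x) = 0 :=
      image_eq_zero_of_notMem_tsupport fun h' => hX' (tsupport_partialX_subset h')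
    simp only [h1, h2, mul_zero, sub_zero]
    refine (hasDerivAt_const x (0 : ℂ)).congr_of_eventuallyEq ?_
    have hcont : Tendsto (fun y : ℝ => (t, y)) (𝓝 x) (𝓝 (t, x)) :=
      (Continuous.tendsto (by fun_prop) x)
    filter_upwards [hcont.eventually (eventually_zero_of_notMem_tsupport h),
      hcont.eventually (eventually_zero_of_notMem_tsupport hX')] with y hy hy'
    rw [hy, hy', mul_zero, mul_zero, sub_zero]

/-- Integration by parts for the free Schrödinger operator. -/
theorem integral_mul_schrodinger (hU : IsOpen U) (hΦ : ContDiff ℝ ∞ Φ) (hc : HasCompactSupport Φ)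
    (hsub : tsupport Φ ⊆ U) (hf : ContinuousOn f U) (hft : ContinuousOn ft U)
    (hfx : ContinuousOn fx U) (hfxx : ContinuousOn fxx U)
    (hdt : ∀ t x, (t, x) ∈ U → HasDerivAt (fun τ => f (τ, x)) (ft (t, x)) t)
    (hdx : ∀ t x, (t, x) ∈ U → HasDerivAt (fun y => f (t, y)) (fx (t, x)) x)
    (hdxx : ∀ t x, (t, x) ∈ U → HasDerivAt (fun y => fx (t, y)) (fxx (t, x)) x) :
    ∫ z, f z * (-(Complex.I * partialT Φ z) + partialX (partialX Φ) z) =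
      ∫ z, (Complex.I * ft z + fxx z) * Φ z := by
  have hX := contDiff_partialX hΦ
  have hXX := contDiff_partialX hX
  have hT := contDiff_partialT hΦ
  have hsubT := tsupport_partialT_subset.trans hsub
  have hsubX := tsupport_partialX_subset.trans hsub
  have hsubXX := tsupport_partialX_subset.trans hsubX
  have hcT : HasCompactSupport (partialT Φ) := hc.fderiv_apply ℝ _
  have hcX : HasCompactSupport (partialX Φ) := hc.fderiv_apply ℝ _
  have hcXX : HasCompactSupport (partialX (partialX Φ)) := hcX.fderiv_apply ℝ _
  have i1 := integrable_mul_of_tsupport_subset hU hf hT.continuous hcT hsubT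
  have i2 := integrable_mul_of_tsupport_subset hU hf hXX.continuous hcXX hsubXX
  have i3 := integrable_mul_of_tsupport_subset hU hft hΦ.continuous hc hsub
  have i4 := integrable_mul_of_tsupport_subset hU hfxx hΦ.continuous hc hsub
  have e1 := integral_time_parts hU hΦ hc hsub hf hft hdt
  have e2 := integral_space_parts hU hΦ hc hsub hf hfx hfxx hdx hdxx
  rw [integral_add i3 i1] at e1
  rw [integral_sub i2 i4] at e2
  have l : ∫ z, f z * (-(Complex.I * partialT Φ z) + partialX (partialX Φ) z) =
      -Complex.I * (∫ z, f z * partialT Φ z) + ∫ z, f z * partialX (partialX Φ) z := by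
    rw [← integral_const_mul, ← integral_add (i1.const_mul _) i2]
    refine integral_congr_ae (Eventually.of_forall fun z => ?_)
    ring
  have r : ∫ z, (Complex.I * ft z + fxx z) * Φ z =
      Complex.I * (∫ z, ft z * Φ z) + ∫ z, fxx z * Φ z := by
    rw [← integral_const_mul, ← integral_add (i3.const_mul _) i4]
    refine integral_congr_ae (Eventually.of_forall fun z => ?_)
    ring
  rw [l, r]
  linear_combination -Complex.I * e1 + e2

end Test

end DiracNLS

end

noncomputable section

namespace DiracNLS

open Filter Topology Set MeasureTheory

/-! ### Uniqueness of absolutely convergent Fourier series -/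

theorem integral_exp_int_mul (m : ℤ) (hm : m ≠ 0) :
    ∫ y in (0 : ℝ)..(2 * Real.pi), Complex.exp (Complex.I * m * y) = 0 := by
  have hc : Complex.I * (m : ℂ) ≠ 0 := by simp [hm]
  rw [integral_exp_mul_complex hc]
  have : Complex.I * (m : ℂ) * ((2 * Real.pi : ℝ) : ℂ) = m * (2 * Real.pi * Complex.I) := by
    push_cast; ring
  rw [this, Complex.exp_int_mul_two_pi_mul_I]
  simp

/-- Multiplying by e^{iny} and integrating over one period isolates d n; absolute summability
justifies integration term by term. -/
theorem eq_zero_of_tsum_exp_eq_zero {d : ℤ → ℂ} (hd : Summable fun k => ‖d k‖)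
    (h : ∀ y : ℝ, ∑' k, d k * Complex.exp (-(Complex.I * k * y)) = 0) (n : ℤ) : d n = 0 := by
  have hpi : (0 : ℝ) ≤ 2 * Real.pi := by positivity
  set F : ℤ → ℝ → ℂ := fun k y => d k * Complex.exp (Complex.I * ((n - k : ℤ) : ℂ) * y)
  have hn : ∀ k y, ‖F k y‖ = ‖d k‖ := fun k y => by
    have : Complex.I * ((n - k : ℤ) : ℂ) * y = Complex.I * (((n - k : ℤ) * y : ℝ) : ℂ) := by
      push_cast; ring
    simp only [F]
    rw [norm_mul, this, norm_exp_I_mul, mul_one]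
  have hint : ∀ k, Integrable (F k) (volume.restrict (Ioc 0 (2 * Real.pi))) := fun k =>
    (Continuous.integrableOn_Ioc (by fun_prop))
  have hS := hasSum_integral_of_summable_integral_norm hint (by
    simp_rw [hn, integral_const]
    exact hd.const_smul _)
  have hzero : ∀ y, ∑' k, F k y = 0 := fun y => by
    have e : ∀ k, F k y = Complex.exp (Complex.I * n * y) *
        (d k * Complex.exp (-(Complex.I * k * y))) := fun k => by
      simp only [F]
      rw [mul_left_comm, ← Complex.exp_add]
      congr 2
      push_cast; ring
    simp_rw [e]
    rw [tsum_mul_left, h, mul_zero]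
  simp_rw [hzero] at hS
  have hk : ∀ k, k ≠ n → ∫ y, F k y ∂(volume.restrict (Ioc 0 (2 * Real.pi))) = 0 := fun k hk => by
    rw [← intervalIntegral.integral_of_le hpi]
    simp only [F]
    rw [intervalIntegral.integral_const_mul, integral_exp_int_mul _ (sub_ne_zero.2 hk.symm),
      mul_zero]
  have h1 := (hasSum_single n hk).unique hS
  rw [← intervalIntegral.integral_of_le hpi] at h1
  simp only [F, sub_self, Int.cast_zero, mul_zero, zero_mul, Complex.exp_zero, mul_one,
    intervalIntegral.integral_const, sub_zero, integral_zero] at h1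
  rcases smul_eq_zero.1 h1 with h2 | h2
  · exact absurd h2 (by positivity)
  · exact h2

/-! ### The weak equation for superpositions of modes -/

variable {σ s T : ℝ} {α : ℤ → ℂ}

theorem isOpen_strip (T : ℝ) : IsOpen (Ioo 0 T ×ˢ (univ : Set ℝ)) := isOpen_Ioo.prod isOpen_univ

theorem strip_subset (T : ℝ) : Ioo 0 T ×ˢ (univ : Set ℝ) ⊆ Ioi 0 ×ˢ univ :=
  fun _ hz => ⟨hz.1.1, hz.2⟩

theorem continuousOn_coord {X : ℝ → Seq} (hX : ∀ t ∈ Ioo 0 T, ContinuousAt X t) (k : ℤ) :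
    ContinuousOn (fun z : ℝ × ℝ => X z.1 k) (Ioo 0 T ×ˢ univ) := fun z hz => by
  have h1 : Continuous fun x : Seq => x k := (lp.lipschitzWith_one_eval 2 k).continuous
  have h2 : ContinuousAt (fun z : ℝ × ℝ => X z.1) z :=
    ContinuousAt.comp (g := X) (f := Prod.fst) (hX z.1 hz.1) continuous_fst.continuousAt
  exact (ContinuousAt.comp (g := fun x : Seq => x k) h1.continuousAt h2).continuousWithinAt

/-- Spatial derivatives of a mode grow with k, so the sum need not be differentiable in x.
Integrating term by term lets the integration by parts act on one mode at a time. The majorant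
depends on t alone and is continuous on the strip. -/
theorem hasSum_integral_mode (hs : 1 / 2 < s) {X : ℝ → Seq}
    (hX : ∀ t ∈ Ioo 0 T, ContinuousAt X t) {ψ : ℝ × ℝ → ℂ} (hψ : Continuous ψ)
    (hc : HasCompactSupport ψ) (hsub : tsupport ψ ⊆ Ioo 0 T ×ˢ univ) :
    HasSum (fun k => ∫ z : ℝ × ℝ, mode σ s α k z.1 z.2 * X z.1 k * ψ z)
      (∫ z : ℝ × ℝ, field σ s α z.1 z.2 (X z.1) * ψ z) := by
  have hU := isOpen_strip T
  have hoff : ∀ z, z ∉ Ioo 0 T ×ˢ (univ : Set ℝ) → ψ z = 0 := fun z hz =>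
    image_eq_zero_of_notMem_tsupport fun h => hz (hsub h)
  have hint : ∀ k, Integrable fun z : ℝ × ℝ => mode σ s α k z.1 z.2 * X z.1 k * ψ z := fun k =>
    integrable_mul_of_tsupport_subset hU (((continuousOn_mode k).mono (strip_subset T)).mul
      (continuousOn_coord hX k)) hψ hc hsub
  set g : ℝ × ℝ → ℂ := fun z => (((√(4 * Real.pi * z.1))⁻¹ *
    (√(invWeightSum s) * ‖X z.1‖) : ℝ) : ℂ)
  have hg : ContinuousOn g (Ioo 0 T ×ˢ univ) := by
    refine Complex.continuous_ofReal.comp_continuousOn (ContinuousOn.mul (ContinuousOn.inv₀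
      (by fun_prop) fun z hz => ?_) (continuousOn_const.mul fun z hz => ?_))
    · have := hz.1.1
      positivity
    · have h2 : ContinuousAt (fun z : ℝ × ℝ => X z.1) z :=
        ContinuousAt.comp (g := X) (f := Prod.fst) (hX z.1 hz.1) continuous_fst.continuousAt
      exact h2.norm.continuousWithinAt
  have hgi := (integrable_mul_of_tsupport_subset hU hg hψ hc hsub).norm
  have hsum : Summable fun k => ∫ z : ℝ × ℝ, ‖mode σ s α k z.1 z.2 * X z.1 k * ψ z‖ := by
    refine summable_of_sum_le (c := ∫ z, ‖g z * ψ z‖) (fun k => integral_nonneg fun z =>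
      norm_nonneg _) fun F => ?_
    rw [← integral_finsetSum F fun k _ => (hint k).norm]
    refine integral_mono (integrable_finsetSum F fun k _ => (hint k).norm) hgi fun z => ?_
    by_cases hz : z ∈ Ioo 0 T ×ˢ (univ : Set ℝ)
    · have ht : 0 < z.1 := hz.1.1
      simp only [norm_mul (_ * _) (ψ z)]
      rw [← Finset.sum_mul, norm_mul]
      refine mul_le_mul_of_nonneg_right ?_ (norm_nonneg _)
      refine ((summable_norm_mode_mul hs ht z.2 (X z.1)).sum_le_tsum F
        fun k _ => norm_nonneg _).trans ((tsum_norm_mode_mul_le hs ht z.2 (X z.1)).trans ?_)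
      simp only [g, Complex.norm_real]
      exact le_abs_self _
    · simp [hoff z hz]
  have h := hasSum_integral_of_summable_integral_norm hint hsum
  simp_rw [tsum_mul_right] at h
  exact h

/-- The transport identity: the free Schrödinger operator applied to a superposition of modes. -/
theorem integral_field_mul_schrodinger (hs : 1 / 2 < s) {a : Seq}
    (ha : ∀ k, a k = weight s k * α k) {B V : ℝ → Seq}
    (hB : ∀ t ∈ Ioo 0 T, HasDerivAt B (V t) t) (hV : ∀ t ∈ Ioo 0 T, ContinuousAt V t)
    {X : ℝ → Seq} (hXc : ∀ t ∈ Ioo 0 T, ContinuousAt X t)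
    (hX : ∀ t ∈ Ioo 0 T, X t = Complex.I • V t +
      ((σ / (8 * Real.pi * t) : ℝ) : ℂ) • cub s diagMult a a (B t))
    {Φ : ℝ × ℝ → ℂ} (hΦ : ContDiff ℝ ∞ Φ) (hc : HasCompactSupport Φ)
    (hsub : tsupport Φ ⊆ Ioo 0 T ×ˢ univ) :
    ∫ z : ℝ × ℝ, field σ s α z.1 z.2 (B z.1) *
        (-(Complex.I * partialT Φ z) + partialX (partialX Φ) z) =
      ∫ z : ℝ × ℝ, field σ s α z.1 z.2 (X z.1) * Φ z := by
  have hU := isOpen_strip T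
  have hXX := contDiff_partialX (contDiff_partialX hΦ)
  have hT := contDiff_partialT hΦ
  have hcX : HasCompactSupport (partialX Φ) := hc.fderiv_apply ℝ _
  have hcXX : HasCompactSupport (partialX (partialX Φ)) := hcX.fderiv_apply ℝ _
  have hcT : HasCompactSupport (partialT Φ) := hc.fderiv_apply ℝ _
  have hBc : ∀ t ∈ Ioo 0 T, ContinuousAt B t := fun t ht => (hB t ht).continuousAt
  have hψsub : tsupport (fun z => -(Complex.I * partialT Φ z) + partialX (partialX Φ) z) ⊆
      Ioo 0 T ×ˢ univ := by
    refine (closure_minimal (fun z hz => ?_) (isClosed_tsupport Φ)).trans hsub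
    by_contra h
    refine hz ?_
    have h1 : partialT Φ z = 0 :=
      image_eq_zero_of_notMem_tsupport fun h' => h (tsupport_partialT_subset h')
    have h2 : partialX (partialX Φ) z = 0 :=
      image_eq_zero_of_notMem_tsupport fun h' =>
        h (tsupport_partialX_subset (tsupport_partialX_subset h'))
    simp [h1, h2]
  have hψc : HasCompactSupport fun z => -(Complex.I * partialT Φ z) + partialX (partialX Φ) z :=
    (hcT.mul_left (f := fun _ => Complex.I)).neg.add hcXX
  have hψ : Continuous fun z => -(Complex.I * partialT Φ z) + partialX (partialX Φ) z :=
    (continuous_const.mul hT.continuous).neg.add hXX.continuous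
  have h1 := hasSum_integral_mode (σ := σ) (α := α) hs hBc hψ hψc hψsub
  have h2 := hasSum_integral_mode (σ := σ) (α := α) hs hXc hΦ.continuous hc hsub
  refine h1.unique (h2.congr_fun fun k => ?_)
  have cm := (continuousOn_mode (σ := σ) (s := s) (α := α) k).mono (strip_subset T)
  have cT := (continuousOn_modeT (σ := σ) (α := α) k).mono (strip_subset T)
  have cX := (continuousOn_modeX k).mono (strip_subset T)
  have cB := continuousOn_coord hBc k
  have cV := continuousOn_coord hV k
  have c2 : ContinuousOn (fun z : ℝ × ℝ => Complex.I / (2 * (z.1 : ℂ))) (Ioo 0 T ×ˢ univ) :=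
    ContinuousOn.div (by fun_prop) (by fun_prop) fun z hz => by
      have : (z.1 : ℂ) ≠ 0 := by exact_mod_cast hz.1.1.ne'
      simpa using this
  have hcoord : ∀ t ∈ Ioo 0 T, HasDerivAt (fun τ => B τ k) (V t k) t := fun t ht => by
    have h := ((lp.evalCLM ℝ (fun _ : ℤ => ℂ) 2 k).hasFDerivAt (x := B t)).comp_hasDerivAt t
      (hB t ht)
    exact h
  have hxx : ∀ t x, (t, x) ∈ Ioo 0 T ×ˢ (univ : Set ℝ) →
      HasDerivAt (fun y => modeX k t y * mode σ s α k t y * B t k)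
        ((Complex.I / (2 * (t : ℂ)) * mode σ s α k t x +
          modeX k t x * (modeX k t x * mode σ s α k t x)) * B t k) x := fun t x h => by
    have h3 : HasDerivAt (fun y => modeX k t y * mode σ s α k t y)
        (Complex.I / (2 * (t : ℂ)) * mode σ s α k t x +
          modeX k t x * (modeX k t x * mode σ s α k t x)) x :=
      (hasDerivAt_modeX t k x).mul (hasDerivAt_mode_space h.1.1 k x)
    exact h3.mul_const (B t k)
  have key := integral_mul_schrodinger hU hΦ hc hsub
    (f := fun z => mode σ s α k z.1 z.2 * B z.1 k)
    (ft := fun z => modeT σ α k z.1 z.2 * mode σ s α k z.1 z.2 * B z.1 k +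
      mode σ s α k z.1 z.2 * V z.1 k)
    (fx := fun z => modeX k z.1 z.2 * mode σ s α k z.1 z.2 * B z.1 k)
    (fxx := fun z => (Complex.I / (2 * (z.1 : ℂ)) * mode σ s α k z.1 z.2 +
      modeX k z.1 z.2 * (modeX k z.1 z.2 * mode σ s α k z.1 z.2)) * B z.1 k)
    (cm.mul cB) (((cT.mul cm).mul cB).add (cm.mul cV)) ((cX.mul cm).mul cB)
    (((c2.mul cm).add (cX.mul (cX.mul cm))).mul cB)
    (fun t x h => (hasDerivAt_mode_time h.1.1 k x).mul (hcoord t h.1))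
    (fun t x h => (hasDerivAt_mode_space (σ := σ) (s := s) (α := α) h.1.1 k x).mul_const (B t k))
    hxx
  rw [key]
  refine integral_congr_ae (Eventually.of_forall fun z => ?_)
  by_cases hz : z ∈ Ioo 0 T ×ˢ (univ : Set ℝ)
  · have h := mode_equation (σ := σ) (α := α) (show 0 < z.1 from hz.1.1) k z.2
    simp only [hX z.1 hz.1, lp.coeFn_add, lp.coeFn_smul, Pi.add_apply, Pi.smul_apply, smul_eq_mul,
      cub_diagMult_apply hs ha]
    push_cast at h ⊢
    -- By `mode_equation` the free operator leaves of each mode only its logarithmic phase, which is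
    -- the diagonal term in X.
    linear_combination mode σ s α k z.1 z.2 * B z.1 k * Φ z * h
  · have : Φ z = 0 := image_eq_zero_of_notMem_tsupport fun h => hz (hsub h)
    simp [this]

/-! ### From the weak equation to the equation for the coefficients -/

/-- The modes in terms of exponentials. -/
theorem mode_eq {t : ℝ} (ht : 0 < t) (k : ℤ) (x : ℝ) :
    mode σ s α k t x = Complex.exp (Complex.I * ((x ^ 2 / (4 * t) : ℝ) : ℂ)) / rootDen t *
      (Complex.exp (Complex.I * modePhase σ α k t 0) * ((weight s k)⁻¹ : ℝ) *
        Complex.exp (-(Complex.I * k * ((x / (2 * t) : ℝ) : ℂ)))) := by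
  have : Complex.exp (Complex.I * modePhase σ α k t x) =
      Complex.exp (Complex.I * ((x ^ 2 / (4 * t) : ℝ) : ℂ)) *
      Complex.exp (Complex.I * modePhase σ α k t 0) *
      Complex.exp (-(Complex.I * k * ((x / (2 * t) : ℝ) : ℂ))) := by
    rw [← Complex.exp_add, ← Complex.exp_add]
    congr 1
    have ht' : (t : ℂ) ≠ 0 := by exact_mod_cast ht.ne'
    simp only [modePhase]
    push_cast
    field_simp
    ring
  rw [mode, this]
  ring

/-- A superposition of modes vanishing identically in space has vanishing coefficients. -/
theorem eq_zero_of_field_eq_zero (hs : 1 / 2 < s) {t : ℝ} (ht : 0 < t) {X : Seq}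
    (h : ∀ x, field σ s α t x X = 0) : X = 0 := by
  set d : ℤ → ℂ := fun k => Complex.exp (Complex.I * modePhase σ α k t 0) *
    ((weight s k)⁻¹ : ℝ) * X k with hd
  have hsum : Summable fun k => ‖d k‖ := (summable_inv_weight_mul hs X).congr fun k => by
    rw [hd, norm_mul, norm_mul, norm_exp_I_mul, one_mul, Complex.norm_real,
      Real.norm_of_nonneg (inv_nonneg.2 (weight_pos s k).le)]
  -- At x = 2ty the superposition is a nonvanishing factor times a Fourier series in y.
  have hz := eq_zero_of_tsum_exp_eq_zero hsum fun y => by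
    have hx := h (2 * t * y)
    simp only [field, mode_eq ht] at hx
    have e : 2 * t * y / (2 * t) = y := by field_simp
    rw [e] at hx
    have hx2 : Complex.exp (Complex.I * (((2 * t * y) ^ 2 / (4 * t) : ℝ) : ℂ)) / rootDen t *
        ∑' k, d k * Complex.exp (-(Complex.I * k * y)) = 0 := by
      rw [← hx, ← tsum_mul_left]
      refine tsum_congr fun k => ?_
      simp only [hd]
      ring
    exact (mul_eq_zero.1 hx2).resolve_left
      (div_ne_zero (Complex.exp_ne_zero _) (rootDen_ne_zero ht))
  ext k
  have h1 := hz k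
  have hw : (((weight s k)⁻¹ : ℝ) : ℂ) ≠ 0 := by
    exact_mod_cast inv_ne_zero (weight_ne_zero s k)
  simpa [hd, Complex.exp_ne_zero, weight_ne_zero] using h1

/-- The fundamental lemma of the calculus of variations gives vanishing almost everywhere. Joint
continuity upgrades this to every point, so uniqueness of Fourier series applies at each fixed time.
-/
theorem eq_zero_of_integral_field_eq_zero (hs : 1 / 2 < s) {Z : ℝ → Seq}
    (hZ : ∀ t ∈ Ioo 0 T, ContinuousAt Z t)
    (h : ∀ Φ : ℝ × ℝ → ℂ, ContDiff ℝ ∞ Φ → HasCompactSupport Φ →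
      tsupport Φ ⊆ Ioo 0 T ×ˢ univ → ∫ z : ℝ × ℝ, field σ s α z.1 z.2 (Z z.1) * Φ z = 0) :
    ∀ t ∈ Ioo 0 T, Z t = 0 := by
  have hU := isOpen_strip T
  have hcont := continuousOn_field (σ := σ) (α := α) hs hZ
  have hae := hU.ae_eq_zero_of_integral_contDiff_smul_eq_zero (μ := volume)
    (hcont.locallyIntegrableOn hU.measurableSet) fun g hg hgc hgs => by
      have hsupp : tsupport (fun z => (g z : ℂ)) ⊆ tsupport g :=
        closure_mono fun z hz => by simpa using hz
      have h1 := h (fun z => (g z : ℂ)) (Complex.ofRealCLM.contDiff.comp hg)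
        (hgc.of_isClosed_subset (isClosed_tsupport _) hsupp) (hsupp.trans hgs)
      rw [← h1]
      refine integral_congr_ae (Eventually.of_forall fun z => ?_)
      simp only [Complex.real_smul]
      ring
  have heq : EqOn (fun z : ℝ × ℝ => field σ s α z.1 z.2 (Z z.1)) 0 (Ioo 0 T ×ˢ univ) := by
    refine Measure.eqOn_open_of_ae_eq (μ := volume) ?_ hU hcont continuousOn_const
    exact (ae_restrict_iff' hU.measurableSet).2 hae
  exact fun t ht => eq_zero_of_field_eq_zero hs ht.1 fun x => heq (x := (t, x)) ⟨ht, mem_univ x⟩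

/-- The weak form of the equation, expressed through the defect `V - F(t, B)`. -/
theorem integral_weak_eq (hs : 1 / 2 < s) {a : Seq} (ha : ∀ k, a k = weight s k * α k)
    {B V : ℝ → Seq} (hB : ∀ t ∈ Ioo 0 T, HasDerivAt B (V t) t)
    (hV : ∀ t ∈ Ioo 0 T, ContinuousAt V t) {u : ℝ → ℝ → ℂ}
    (hu : ∀ t ∈ Ioo 0 T, ∀ x, u t x = field σ s α t x (B t))
    {φ : ℝ → ℝ → ℂ} (hφ : ContDiff ℝ ∞ (Function.uncurry φ))
    (hc : HasCompactSupport (Function.uncurry φ))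
    (hsub : tsupport (Function.uncurry φ) ⊆ Ioo 0 T ×ˢ univ) :
    ∫ z : ℝ × ℝ,
      (u z.1 z.2 * (-(Complex.I * deriv (fun t => φ t z.2) z.1)
          + iteratedDeriv 2 (fun x => φ z.1 x) z.2)
        + ((σ / 2 * (‖u z.1 z.2‖ ^ 2 - mass α / (2 * Real.pi * z.1)) : ℝ) : ℂ)
          * u z.1 z.2 * φ z.1 z.2) =
    ∫ z : ℝ × ℝ, field σ s α z.1 z.2 (Complex.I • (V z.1 - vfield σ s α a z.1 (B z.1))) *
      Function.uncurry φ z := by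
  set Φ := Function.uncurry φ with hΦdef
  have hU := isOpen_strip T
  have hBc : ∀ t ∈ Ioo 0 T, ContinuousAt B t := fun t ht => (hB t ht).continuousAt
  set c : ℝ → ℂ := fun t => ((σ / (8 * Real.pi * t) : ℝ) : ℂ)
  have hcc : ∀ t ∈ Ioo 0 T, ContinuousAt c t := fun t ht => by
    refine Complex.continuous_ofReal.continuousAt.comp (ContinuousAt.div (by fun_prop)
      (by fun_prop) ?_)
    have := ht.1
    positivity
  -- X holds the coefficients produced by the free Schrödinger operator, Y those of the nonlinearity
  -- with its mass term.
  set X : ℝ → Seq := fun t => Complex.I • V t + c t • cub s diagMult a a (B t)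
  set Y : ℝ → Seq := fun t => c t • (cub s (fullMult σ α t) (B t) (B t) (B t) -
    (2 * mass α : ℂ) • B t)
  have hX : ∀ t ∈ Ioo 0 T, ContinuousAt X t := fun t ht => by
    refine ((hV t ht).const_smul Complex.I).add ((hcc t ht).smul ?_)
    exact continuousAt_cub (μ := fun _ => diagMult) hs zero_le_one (fun _ => norm_diagMult_le)
      (fun _ _ => continuousAt_const) continuousAt_const continuousAt_const (hBc t ht)
  have hY : ∀ t ∈ Ioo 0 T, ContinuousAt Y t := fun t ht => by
    refine (hcc t ht).smul (ContinuousAt.sub ?_ ((hBc t ht).const_smul (2 * mass α : ℂ)))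
    exact continuousAt_cub hs zero_le_one (fun τ => norm_fullMult_le τ)
      (fun k q => (hasDerivAt_fullMult ht.1 k q).continuousAt) (hBc t ht) (hBc t ht) (hBc t ht)
  have hXX := contDiff_partialX (contDiff_partialX hφ)
  have hT := contDiff_partialT hφ
  have hcX : HasCompactSupport (partialX Φ) := hc.fderiv_apply ℝ _
  have hcXX : HasCompactSupport (partialX (partialX Φ)) := hcX.fderiv_apply ℝ _
  have hcT : HasCompactSupport (partialT Φ) := hc.fderiv_apply ℝ _
  have hFB := continuousOn_field (σ := σ) (α := α) hs hBc
  have i1 : Integrable fun z : ℝ × ℝ => field σ s α z.1 z.2 (B z.1) *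
      (-(Complex.I * partialT Φ z) + partialX (partialX Φ) z) := by
    have j1 := integrable_mul_of_tsupport_subset hU hFB hT.continuous hcT
      (tsupport_partialT_subset.trans hsub)
    have j2 := integrable_mul_of_tsupport_subset hU hFB hXX.continuous hcXX
      (tsupport_partialX_subset.trans (tsupport_partialX_subset.trans hsub))
    refine ((j1.const_mul (-Complex.I)).add j2).congr (Eventually.of_forall fun z => ?_)
    simp only [Pi.add_apply]
    ring
  have i2 := integrable_mul_of_tsupport_subset hU (continuousOn_field (σ := σ) (α := α) hs hY)
    hφ.continuous hc hsub
  have i3 := integrable_mul_of_tsupport_subset hU (continuousOn_field (σ := σ) (α := α) hs hX)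
    hφ.continuous hc hsub
  have htr := integral_field_mul_schrodinger (σ := σ) hs ha hB hV hX (fun t _ => rfl) hφ hc hsub
  have e1 : ∫ z : ℝ × ℝ,
      (u z.1 z.2 * (-(Complex.I * deriv (fun t => φ t z.2) z.1)
          + iteratedDeriv 2 (fun x => φ z.1 x) z.2)
        + ((σ / 2 * (‖u z.1 z.2‖ ^ 2 - mass α / (2 * Real.pi * z.1)) : ℝ) : ℂ)
          * u z.1 z.2 * φ z.1 z.2) =
      ∫ z : ℝ × ℝ, (field σ s α z.1 z.2 (B z.1) *
        (-(Complex.I * partialT Φ z) + partialX (partialX Φ) z) +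
        field σ s α z.1 z.2 (Y z.1) * Φ z) := by
    refine integral_congr_ae (Eventually.of_forall fun z => ?_)
    have d1 : deriv (fun t => φ t z.2) z.1 = partialT Φ z :=
      (hasDerivAt_partialT hφ z.1 z.2).deriv
    have d2 : iteratedDeriv 2 (fun x => φ z.1 x) z.2 = partialX (partialX Φ) z :=
      iteratedDeriv_two_eq hφ z.1 z.2
    have d3 : φ z.1 z.2 = Φ z := rfl
    simp only [d1, d2, d3]
    by_cases hz : z ∈ Ioo 0 T ×ˢ (univ : Set ℝ)
    · have ht : 0 < z.1 := hz.1.1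
      have h3 := norm_sq_mul_field (σ := σ) (α := α) hs ht z.2 (B z.1)
      rw [hu z.1 hz.1]
      simp only [Y, c]
      rw [field_smul, field_sub hs ht, field_smul]
      have ht' : (z.1 : ℂ) ≠ 0 := by exact_mod_cast ht.ne'
      have hpi : (Real.pi : ℂ) ≠ 0 := by exact_mod_cast Real.pi_ne_zero
      have h4 : field σ s α z.1 z.2 (cub s (fullMult σ α z.1) (B z.1) (B z.1) (B z.1)) =
          4 * Real.pi * z.1 * (((‖field σ s α z.1 z.2 (B z.1)‖ ^ 2 : ℝ) : ℂ) *
            field σ s α z.1 z.2 (B z.1)) := by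
        rw [h3]; push_cast; field_simp
      rw [h4]
      push_cast
      field_simp
      ring
    · have n1 : z ∉ tsupport Φ := fun h => hz (hsub h)
      have h1 : partialT Φ z = 0 :=
        image_eq_zero_of_notMem_tsupport fun h' => n1 (tsupport_partialT_subset h')
      have h2 : partialX (partialX Φ) z = 0 :=
        image_eq_zero_of_notMem_tsupport fun h' =>
          n1 (tsupport_partialX_subset (tsupport_partialX_subset h'))
      have h3 : Φ z = 0 := image_eq_zero_of_notMem_tsupport n1
      simp [h1, h2, h3]
  rw [e1, integral_add i1 i2, htr, ← integral_add i3 i2]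
  refine integral_congr_ae (Eventually.of_forall fun z => ?_)
  by_cases hz : z ∈ Ioo 0 T ×ˢ (univ : Set ℝ)
  · have ht : 0 < z.1 := hz.1.1
    simp only []
    rw [← add_mul, ← field_add hs ht]
    congr 2
    -- In X + Y the diagonal part and the mass part assemble to the subtraction in `resRem`, so the
    -- sum is i times the defect of the differential equation.
    simp only [X, Y, c, vfield, resRem, cub_fullMult hs, cub_resMult_eq hs ha]
    have ht' : (z.1 : ℂ) ≠ 0 := by exact_mod_cast ht.ne'
    have hpi : (Real.pi : ℂ) ≠ 0 := by exact_mod_cast Real.pi_ne_zero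
    have hI : Complex.I * (Complex.I * σ / (8 * Real.pi * z.1)) =
        -((σ / (8 * Real.pi * z.1) : ℝ) : ℂ) := by
      push_cast
      rw [← mul_div_assoc, ← mul_assoc, Complex.I_mul_I]
      ring
    rw [smul_sub Complex.I, smul_smul, hI]
    module
  · have h3 : Φ z = 0 := image_eq_zero_of_notMem_tsupport fun h => hz (hsub h)
    simp [h3]

/-- A superposition of modes solves the equation weakly iff its coefficients solve the equation
for the remainder. -/
theorem isWeakNLS_iff (hs : 1 / 2 < s) {a : Seq} (ha : ∀ k, a k = weight s k * α k)
    {B V : ℝ → Seq} (hB : ∀ t ∈ Ioo 0 T, HasDerivAt B (V t) t)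
    (hV : ∀ t ∈ Ioo 0 T, ContinuousAt V t) {u : ℝ → ℝ → ℂ}
    (hu : ∀ t ∈ Ioo 0 T, ∀ x, u t x = field σ s α t x (B t)) :
    IsWeakNLS σ (mass α) T u ↔ ∀ t ∈ Ioo 0 T, V t = vfield σ s α a t (B t) := by
  constructor
  · intro h
    have hZ : ∀ t ∈ Ioo 0 T, ContinuousAt
        (fun t => Complex.I • (V t - vfield σ s α a t (B t))) t := fun t ht =>
      ((hV t ht).sub (continuousAt_vfield hs a ht.1 (hB t ht).continuousAt)).const_smul Complex.I
    have h0 := eq_zero_of_integral_field_eq_zero (σ := σ) (α := α) hs hZ fun Φ hΦ hc hsub => by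
      have h1 := h (Function.curry Φ) hΦ hc hsub
      rw [integral_weak_eq hs ha hB hV hu (φ := Function.curry Φ) hΦ hc hsub] at h1
      exact h1
    intro t ht
    have := h0 t ht
    rw [smul_eq_zero] at this
    exact sub_eq_zero.1 (this.resolve_left Complex.I_ne_zero)
  · intro h φ hφ hc hsub
    rw [integral_weak_eq hs ha hB hV hu hφ hc hsub]
    refine integral_eq_zero_of_ae (Eventually.of_forall fun z => ?_)
    by_cases hz : z ∈ Ioo 0 T ×ˢ (univ : Set ℝ)
    · simp only [h z.1 hz.1, sub_self, smul_zero, Pi.zero_apply]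
      simp [field]
    · have h3 : Function.uncurry φ z = 0 :=
        image_eq_zero_of_notMem_tsupport fun h => hz (hsub h)
      simp [h3]

end DiracNLS

end

noncomputable section

namespace DiracNLS

open Filter Topology Set
open scoped ENNReal ComplexConjugate

variable {σ s γ T : ℝ} {α : ℤ → ℂ}

/-! ### Solutions as superpositions of modes -/

theorem exists_seq (h : MemL2s s α) :
    ∃ a : Seq, (∀ k, a k = weight s k * α k) ∧ ‖a‖ = l2sNorm s α := by
  have e : ∀ k, ‖(weight s k : ℂ) * α k‖ = weight s k * ‖α k‖ := fun k => by
    rw [norm_mul, Complex.norm_real, Real.norm_of_nonneg (weight_pos s k).le]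
  have hm : Memℓp (fun k => (weight s k : ℂ) * α k) 2 := by
    refine memℓp_gen ?_
    refine h.congr fun k => ?_
    rw [e]
    norm_num
  refine ⟨⟨_, hm⟩, fun k => rfl, ?_⟩
  rw [l2sNorm, ← Real.sqrt_sq (norm_nonneg _), seq_norm_sq]
  congr 1
  exact tsum_congr fun k => by rw [← e]

theorem norm_le_norm_seq (hs : 1 / 2 < s) {a : Seq} (ha : ∀ k, a k = weight s k * α k) (k : ℤ) :
    ‖α k‖ ≤ ‖a‖ := by
  have h1 : ‖a k‖ ≤ ‖a‖ := lp.norm_apply_le_norm (by norm_num) a k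
  rw [ha, norm_mul, Complex.norm_real, Real.norm_of_nonneg (weight_pos s k).le] at h1
  exact (le_mul_of_one_le_left (norm_nonneg _) (one_le_weight hs k)).trans h1

theorem mode_mul_weight {t : ℝ} (ht : 0 < t) (k : ℤ) (x : ℝ) (c : ℂ) :
    mode σ s α k t x * (weight s k * c) =
      Complex.exp (-(Complex.I *
        ((σ * (‖α k‖ ^ 2 / (4 * Real.pi)) * Real.log (Real.sqrt t) : ℝ) : ℂ))) * c *
        freeDirac k t x := by
  have hw : (weight s k : ℂ) ≠ 0 := by exact_mod_cast weight_ne_zero s k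
  have e : Complex.exp (Complex.I * modePhase σ α k t x) =
      Complex.exp (-(Complex.I *
        ((σ * (‖α k‖ ^ 2 / (4 * Real.pi)) * Real.log (Real.sqrt t) : ℝ) : ℂ))) *
      Complex.exp (Complex.I * (((x - k) ^ 2 / (4 * t) : ℝ) : ℂ)) := by
    -- The identity log √t = (log t)/2 turns the 4π of the ansatz into the 8π of `modePhase`.
    rw [← Complex.exp_add, Real.log_sqrt ht.le, modePhase]
    congr 1
    push_cast
    ring
  rw [mode, e, freeDirac, ← rootDen]
  push_cast
  field_simp

theorem field_eq_tsum {a W : Seq} (ha : ∀ k, a k = weight s k * α k) {R : ℤ → ℂ}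
    (hW : ∀ k, W k = weight s k * R k) {t : ℝ} (ht : 0 < t) (x : ℝ) :
    field σ s α t x (a + W) = ∑' k : ℤ,
      Complex.exp (-(Complex.I *
        ((σ * (‖α k‖ ^ 2 / (4 * Real.pi)) * Real.log (Real.sqrt t) : ℝ) : ℂ))) * (α k + R k) *
        freeDirac k t x := by
  refine tsum_congr fun k => ?_
  rw [lp.coeFn_add, Pi.add_apply, ha, hW, ← mul_add, mode_mul_weight ht]

/-- Solutions are superpositions of modes whose coefficients solve the remainder equation. -/
theorem IsDiracSolution.exists_field (hs : 1 / 2 < s) {u : ℝ → ℝ → ℂ} {a : Seq}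
    (ha : ∀ k, a k = weight s k * α k) (hu : IsDiracSolution σ s γ α T u) :
    ∃ (W : ℝ → Seq) (C : ℝ), 0 ≤ C ∧ ∀ t ∈ Ioo 0 T,
      HasDerivAt W (vfield σ s α a t (a + W t)) t ∧ ‖W t‖ ≤ C * t ^ γ ∧
      ∀ x, u t x = field σ s α t x (a + W t) := by
  obtain ⟨⟨R, ⟨W, hWR, hW, C, hC⟩, huR⟩, hweak⟩ := hu
  have hfield : ∀ t ∈ Ioo 0 T, ∀ x, u t x = field σ s α t x (a + W t) := fun t ht x => by
    rw [huR t ht x, field_eq_tsum ha (hWR t ht) ht.1]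
  have hd : ∀ t ∈ Ioo 0 T, HasDerivAt W (deriv W t) t := fun t ht =>
    ((hW.differentiableOn (by norm_num)).differentiableAt (isOpen_Ioo.mem_nhds ht)).hasDerivAt
  have hcd : ∀ t ∈ Ioo 0 T, ContinuousAt (deriv W) t := fun t ht =>
    (hW.continuousOn_deriv_of_isOpen isOpen_Ioo le_rfl).continuousAt (isOpen_Ioo.mem_nhds ht)
  have hv := (isWeakNLS_iff hs ha (B := fun t => a + W t) (V := deriv W)
    (fun t ht => (hd t ht).const_add a) hcd hfield).1 hweak
  refine ⟨W, max C 0, le_max_right _ _, fun t ht => ⟨?_, ?_, hfield t ht⟩⟩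
  · rw [← hv t ht]
    exact hd t ht
  · have h1 : t ^ (-γ) * ‖W t‖ ≤ max C 0 := by
      have := mul_nonneg ht.1.le (norm_nonneg (deriv W t))
      exact (by linarith [hC t ht] : _ ≤ C).trans (le_max_left _ _)
    have h2 : 0 < t ^ γ := Real.rpow_pos_of_pos ht.1 γ
    rw [Real.rpow_neg ht.1.le, inv_mul_eq_div, div_le_iff₀ h2] at h1
    exact h1

/-- Coefficients solving the remainder equation give a solution. -/
theorem isDiracSolution_of_field (hs : 1 / 2 < s) {a : Seq}
    (ha : ∀ k, a k = weight s k * α k) {W : ℝ → Seq} {C D : ℝ}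
    (hW : ∀ t ∈ Ioo 0 T, HasDerivAt W (vfield σ s α a t (a + W t)) t)
    (hC : ∀ t ∈ Ioo 0 T, ‖W t‖ ≤ C * t ^ γ)
    (hD : ∀ t ∈ Ioo 0 T, ‖t • vfield σ s α a t (a + W t)‖ ≤ D) :
    IsDiracSolution σ s γ α T fun t x => field σ s α t x (a + W t) := by
  have hcont : ∀ t ∈ Ioo 0 T, ContinuousAt (fun t => vfield σ s α a t (a + W t)) t :=
    fun t ht => continuousAt_vfield hs a ht.1
      (B := fun t => a + W t) ((hW t ht).continuousAt.const_add a)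
  have hderiv : EqOn (deriv W) (fun t => vfield σ s α a t (a + W t)) (Ioo 0 T) :=
    fun t ht => (hW t ht).deriv
  have hWR : ∀ t, ∀ k : ℤ, W t k = weight s k * ((weight s k : ℂ)⁻¹ * W t k) := fun t k => by
    have hw : (weight s k : ℂ) ≠ 0 := by exact_mod_cast weight_ne_zero s k
    field_simp
  refine ⟨⟨fun t k => (weight s k : ℂ)⁻¹ * W t k, ⟨W, fun t _ => hWR t, ?_, C + D, ?_⟩, ?_⟩, ?_⟩
  · refine (contDiffOn_succ_iff_deriv_of_isOpen (n := 0) isOpen_Ioo).2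
      ⟨fun t ht => (hW t ht).differentiableAt.differentiableWithinAt, by simp, ?_⟩
    rw [contDiffOn_zero]
    exact ContinuousOn.congr (fun t ht => (hcont t ht).continuousWithinAt) hderiv
  · intro t ht
    have h2 : 0 < t ^ γ := Real.rpow_pos_of_pos ht.1 γ
    refine add_le_add ?_ ?_
    · rw [Real.rpow_neg ht.1.le, inv_mul_eq_div, div_le_iff₀ h2]
      exact hC t ht
    · rw [hderiv ht]
      have := hD t ht
      rwa [norm_smul, Real.norm_of_nonneg ht.1.le] at this
  · intro t ht x
    exact field_eq_tsum ha (hWR t) ht.1 x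
  · exact (isWeakNLS_iff hs ha (B := fun t => a + W t)
      (V := fun t => vfield σ s α a t (a + W t)) (fun t ht => (hW t ht).const_add a) hcont
      fun t _ x => rfl).2 fun t _ => rfl

variable {T₀ ε : ℝ}

theorem exists_isDiracSolution (hs : 1 / 2 < s) (hσ : |σ| ≤ 1) (hγ : 0 < γ) (hγ1 : γ < 1)
    (hT₀ : 1 ≤ T₀) (hε : 0 ≤ ε) (hε1 : ε ≤ 1) (hα : MemL2s s α) (hn : l2sNorm s α ≤ ε)
    (hsm : 64 * growthConst s γ T₀ * T₀ * ε ^ 2 ≤ 1) :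
    ∃ u, IsDiracSolution σ s γ α T₀ u := by
  obtain ⟨a, ha, han⟩ := exists_seq hα
  have haε : ‖a‖ ≤ ε := han.trans_le hn
  have hα1 : ∀ k, ‖α k‖ ≤ 1 := fun k =>
    (norm_le_norm_seq hs ha k).trans (haε.trans hε1)
  obtain ⟨W, hW⟩ := exists_remainder hs hσ hα1 hγ hγ1 hT₀ hε haε hsm
  have h0 := remRadius_nonneg (s := s) hγ hT₀ hε
  refine ⟨_, isDiracSolution_of_field hs ha (fun t ht => (hW t ht).1) (fun t ht => (hW t ht).2)
    (D := cubConst s * (‖a‖ + remRadius s γ T₀ ε * T₀ ^ γ) ^ 3) fun t ht => ?_⟩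
  refine norm_smul_vfield_le hs hσ ht.1 (b := ‖a‖ + remRadius s γ T₀ ε * T₀ ^ γ) ?_ ?_
  · have : 0 ≤ T₀ ^ γ := by positivity
    have := mul_nonneg h0 this
    linarith
  · refine (norm_add_le _ _).trans (add_le_add_right ((hW t ht).2.trans ?_) _)
    exact mul_le_mul_of_nonneg_left (Real.rpow_le_rpow ht.1.le ht.2.le hγ.le) h0

/-- Every solution has a small remainder. -/
theorem IsDiracSolution.exists_field_of_small (hs : 1 / 2 < s) (hσ : |σ| ≤ 1) (hγ : 0 < γ)
    (hγ1 : γ < 1) (hT₀ : 1 ≤ T₀) (hε : 0 < ε) (hε1 : ε ≤ 1) {a : Seq}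
    (ha : ∀ k, a k = weight s k * α k) (han : ‖a‖ ≤ ε)
    (hsm : 64 * growthConst s γ T₀ * T₀ * ε ^ 2 ≤ 1) {u : ℝ → ℝ → ℂ}
    (hu : IsDiracSolution σ s γ α T u) {t : ℝ} (ht : 0 < t) (htT : t < T) (htT₀ : t < T₀) :
    ∃ w : Seq, ‖w‖ ≤ remRadius s γ T₀ ε * t ^ γ ∧ ∀ x, u t x = field σ s α t x (a + w) := by
  have hα1 : ∀ k, ‖α k‖ ≤ 1 := fun k =>
    (norm_le_norm_seq hs ha k).trans (han.trans hε1)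
  obtain ⟨W, C, hC, hW⟩ := hu.exists_field hs ha
  -- The lifespan T of the given solution is unrelated to T₀, so the a priori bound is applied on
  -- the shorter interval.
  have hsub : ∀ τ ∈ Ioo 0 (min T T₀), τ ∈ Ioo 0 T := fun τ hτ =>
    ⟨hτ.1, hτ.2.trans_le (min_le_left _ _)⟩
  exact ⟨W t, remainder_le hs hσ hα1 hγ hγ1 hT₀ hε han hsm (min_le_right T T₀) hC
    (fun τ hτ => (hW τ (hsub τ hτ)).1) (fun τ hτ => (hW τ (hsub τ hτ)).2.1) t
    ⟨ht, lt_min htT htT₀⟩, (hW t ⟨ht, htT⟩).2.2⟩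

end DiracNLS

end

noncomputable section

namespace DiracNLS

open Filter Topology Set
open scoped ENNReal ComplexConjugate ZMod

variable {σ s γ T : ℝ} {α : ℤ → ℂ}

/-! ### Quadratic phases and Gauss sums -/

/-- The quadratic phase `k ↦ e^{iπqk²/(2p)}` on `ℤ/2pℤ`. -/
def quadPhase (p q : ℕ) (j : ZMod (2 * p)) : ℂ :=
  Complex.exp (Complex.I * ((Real.pi * q * (j.val : ℝ) ^ 2 / (2 * p) : ℝ) : ℂ))

theorem norm_quadPhase (p q : ℕ) (j : ZMod (2 * p)) : ‖quadPhase p q j‖ = 1 := by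
  rw [quadPhase, norm_exp_I_mul]

section Gauss

variable {p : ℕ} [NeZero p]

/-- Replacing r by k = r + 2pd changes the phase by 2πq(rd + pd²), so the value depends only on the
residue class. -/
theorem quadPhase_intCast (q : ℕ) (k : ℤ) :
    quadPhase p q (k : ZMod (2 * p)) =
      Complex.exp (Complex.I * ((Real.pi * q * (k : ℝ) ^ 2 / (2 * p) : ℝ) : ℂ)) := by
  have hp : (p : ℂ) ≠ 0 := by exact_mod_cast NeZero.ne p
  have hv : (((k : ZMod (2 * p)).val : ℕ) : ℤ) = k % ((2 * p : ℕ) : ℤ) := ZMod.val_intCast k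
  set r : ℤ := k % ((2 * p : ℕ) : ℤ)
  set d : ℤ := k / ((2 * p : ℕ) : ℤ)
  have hk : k = r + 2 * p * d := by
    have := Int.emod_add_mul_ediv k ((2 * p : ℕ) : ℤ)
    push_cast at this
    exact this.symm
  have hvr : (((k : ZMod (2 * p)).val : ℝ)) = (r : ℝ) := by exact_mod_cast hv
  rw [quadPhase, hvr, Complex.exp_eq_exp_iff_exists_int]
  refine ⟨-(q * (r * d + p * d ^ 2)), ?_⟩
  have hkc : (k : ℂ) = r + 2 * p * d := by exact_mod_cast hk
  push_cast
  rw [hkc]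
  field_simp
  ring

/-- The cross term of the square is 2πqjh/(2p), a value of the standard additive character. -/
theorem quadPhase_add (q : ℕ) (j h : ZMod (2 * p)) :
    quadPhase p q (j + h) =
      quadPhase p q j * quadPhase p q h * ZMod.stdAddChar (j * ((q : ZMod (2 * p)) * h)) := by
  have hp : (p : ℂ) ≠ 0 := by exact_mod_cast NeZero.ne p
  obtain ⟨j, rfl⟩ := ZMod.intCast_surjective j
  obtain ⟨h, rfl⟩ := ZMod.intCast_surjective h
  have e : ((j : ZMod (2 * p)) * (q * (h : ZMod (2 * p)))) = ((j * (q * h) : ℤ) : ZMod (2 * p)) := by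
    push_cast; ring
  rw [e, ← Int.cast_add, quadPhase_intCast, quadPhase_intCast, quadPhase_intCast,
    ZMod.stdAddChar_coe, ← Complex.exp_add, ← Complex.exp_add]
  congr 1
  push_cast
  field_simp
  ring

/-- Oddness of q enters here: if 2p divides qh, then h is even, and with qh = 2pm and h = 2n the
phase is 2πmn. For p = 1, q = 2, h = 1 the value is -1, and the Gauss sum vanishes. -/
theorem quadPhase_eq_one {q : ℕ} (hq : Odd q) {h : ZMod (2 * p)} (hh : (q : ZMod (2 * p)) * h = 0) :
    quadPhase p q h = 1 := by
  have hp : (p : ℂ) ≠ 0 := by exact_mod_cast NeZero.ne p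
  obtain ⟨h, rfl⟩ := ZMod.intCast_surjective h
  have h1 : ((2 * p : ℕ) : ℤ) ∣ q * h := by
    rw [← ZMod.intCast_zmod_eq_zero_iff_dvd]
    push_cast
    exact hh
  obtain ⟨m, hm⟩ := h1
  have h2 : Even h := by
    have h3 : Even ((q : ℤ) * h) := ⟨p * m, by rw [hm]; push_cast; ring⟩
    rcases Int.even_mul.1 h3 with h4 | h4
    · exact absurd h4 (by simpa using hq)
    · exact h4
  obtain ⟨n, hn⟩ := h2
  rw [quadPhase_intCast, Complex.exp_eq_one_iff]
  refine ⟨n * m, ?_⟩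
  have hmc : (q : ℂ) * h = 2 * p * m := by exact_mod_cast hm
  have hnc : (h : ℂ) = n + n := by exact_mod_cast hn
  push_cast
  field_simp
  rw [pow_two, ← mul_assoc, hmc, hnc]
  ring

/-- The squared modulus is the sum over all shifts h of the autocorrelation. By orthogonality of
characters, a shift contributes 2p if qh = 0 and nothing otherwise, so the total is positive.
Coprimality of p and q is not needed. -/
theorem sum_quadPhase_ne_zero {q : ℕ} (hq : Odd q) :
    ∑ j : ZMod (2 * p), quadPhase p q j ≠ 0 := by
  classical
  intro h0
  have h1 : ∑ h : ZMod (2 * p), ∑ j : ZMod (2 * p),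
      quadPhase p q (j + h) * conj (quadPhase p q j) = 0 := by
    rw [Finset.sum_comm]
    refine Finset.sum_eq_zero fun j _ => ?_
    rw [← Finset.sum_mul, Fintype.sum_equiv (Equiv.addLeft j)
      (fun h => quadPhase p q (j + h)) (quadPhase p q) (fun _ => rfl), h0, zero_mul]
  have h2 : ∀ h : ZMod (2 * p), ∑ j : ZMod (2 * p),
      quadPhase p q (j + h) * conj (quadPhase p q j) =
      if (q : ZMod (2 * p)) * h = 0 then (2 * p : ℂ) else 0 := fun h => by
    have h3 : ∀ j : ZMod (2 * p), quadPhase p q (j + h) * conj (quadPhase p q j) =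
        quadPhase p q h * ZMod.stdAddChar (j * ((q : ZMod (2 * p)) * h)) := fun j => by
      have h4 : quadPhase p q j * conj (quadPhase p q j) = 1 := by
        rw [Complex.mul_conj, Complex.normSq_eq_norm_sq, norm_quadPhase]
        simp
      rw [quadPhase_add]
      linear_combination quadPhase p q h * ZMod.stdAddChar (j * ((q : ZMod (2 * p)) * h)) * h4
    simp only [h3]
    rw [← Finset.mul_sum, AddChar.sum_mulShift _ (ZMod.isPrimitive_stdAddChar (2 * p))]
    split_ifs with hh
    · rw [quadPhase_eq_one hq hh, ZMod.card]
      push_cast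
      ring
    · simp
  simp only [h2] at h1
  rw [← Finset.sum_filter, Finset.sum_const, nsmul_eq_mul] at h1
  have hp : (p : ℂ) ≠ 0 := by exact_mod_cast NeZero.ne p
  have h5 : (Finset.univ.filter fun h : ZMod (2 * p) => (q : ZMod (2 * p)) * h = 0).card ≠ 0 :=
    Finset.card_ne_zero_of_mem (a := 0) (by simp)
  rcases mul_eq_zero.1 h1 with h | h
  · exact h5 (by exact_mod_cast h)
  · simp [hp] at h

/-- The Fourier coefficients of the quadratic phase. -/
def gaussCoeff (p : ℕ) [NeZero p] (q : ℕ) (m : ZMod (2 * p)) : ℂ :=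
  ((2 * p : ℕ) : ℂ)⁻¹ * 𝓕 (quadPhase p q) m

theorem gaussCoeff_zero_ne_zero {q : ℕ} (hq : Odd q) : gaussCoeff p q 0 ≠ 0 := by
  rw [gaussCoeff, ZMod.dft_apply_zero]
  exact mul_ne_zero (inv_ne_zero (by exact_mod_cast NeZero.ne (2 * p))) (sum_quadPhase_ne_zero hq)

theorem quadPhase_eq_sum (q : ℕ) (k : ℤ) :
    quadPhase p q (k : ZMod (2 * p)) = ∑ m : ZMod (2 * p), gaussCoeff p q m *
      Complex.exp (Complex.I * k * ((Real.pi * m.val / p : ℝ) : ℂ)) := by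
  have hp : (p : ℂ) ≠ 0 := by exact_mod_cast NeZero.ne p
  have h := congrFun (ZMod.dft.symm_apply_apply (quadPhase p q)) (k : ZMod (2 * p))
  rw [← h, ZMod.invDFT_apply, smul_eq_mul, Finset.mul_sum]
  refine Finset.sum_congr rfl fun m _ => ?_
  have e : m * (k : ZMod (2 * p)) = (((m.val : ℤ) * k : ℤ) : ZMod (2 * p)) := by
    push_cast
    rw [ZMod.natCast_zmod_val]
  rw [e, ZMod.stdAddChar_coe, gaussCoeff, smul_eq_mul]
  have e2 : Complex.exp (2 * Real.pi * Complex.I * (((m.val : ℤ) * k : ℤ) : ℂ) / ((2 * p : ℕ) : ℂ)) =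
      Complex.exp (Complex.I * k * ((Real.pi * m.val / p : ℝ) : ℂ)) := by
    congr 1
    push_cast
    field_simp
  rw [e2]
  ring

/-- The Poisson summation behind the Talbot effect. -/
theorem tsum_quadPhase_mul (hα : Summable fun k => ‖α k‖) (q : ℕ) (ξ : ℝ) :
    ∑' k : ℤ, α k * quadPhase p q k * Complex.exp (-(Complex.I * k * (ξ : ℂ))) =
      ∑ m : ZMod (2 * p), gaussCoeff p q m * hatData α (ξ - Real.pi * m.val / p) := by
  have hsum : ∀ y : ℝ, Summable fun k : ℤ => α k * Complex.exp (-(Complex.I * k * (y : ℂ))) :=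
    fun y => Summable.of_norm <| hα.congr fun k => by
      have : -(Complex.I * k * (y : ℂ)) = Complex.I * ((-(k * y) : ℝ) : ℂ) := by push_cast; ring
      rw [norm_mul, this, norm_exp_I_mul, mul_one]
  simp only [hatData, ← tsum_mul_left]
  rw [← Summable.tsum_finsetSum fun m _ => (hsum _).mul_left _]
  refine tsum_congr fun k => ?_
  rw [quadPhase_eq_sum, Finset.mul_sum, Finset.sum_mul]
  refine Finset.sum_congr rfl fun m _ => ?_
  have : Complex.exp (-(Complex.I * k * ((ξ - Real.pi * m.val / p : ℝ) : ℂ))) =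
      Complex.exp (Complex.I * k * ((Real.pi * m.val / p : ℝ) : ℂ)) *
        Complex.exp (-(Complex.I * k * (ξ : ℂ))) := by
    rw [← Complex.exp_add]
    congr 1
    push_cast
    ring
  rw [this]
  ring

variable {q : ℕ} {η : ℝ}

/-- Away from the lattice the linear evolution of localized data vanishes at the Talbot times. -/
theorem tsum_quadPhase_mul_eq_zero (hα : Summable fun k => ‖α k‖) (hq : 1 ≤ q)
    (hloc : FourierLocalized α (η * (Real.pi / p))) {x : ℝ}
    (hx : η / q < Metric.infDist x (lattice q)) :
    ∑' k : ℤ, α k * quadPhase p q k *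
      Complex.exp (-(Complex.I * k * ((Real.pi * q * x / p : ℝ) : ℂ))) = 0 := by
  have hp : (0 : ℝ) < p := by exact_mod_cast NeZero.pos p
  have hq0 : (0 : ℝ) < q := by exact_mod_cast hq
  rw [tsum_quadPhase_mul hα]
  refine Finset.sum_eq_zero fun m _ => mul_eq_zero_of_right _ (hloc _ fun n => ?_)
  have h1 : η / q < |x - ((m.val + 2 * p * n : ℤ) : ℝ) / q| :=
    hx.trans_le (Metric.infDist_le_dist_of_mem ⟨_, rfl⟩)
  -- The translates by πm/p and the periods 2πn together correspond to the points (m + 2pn)/q of the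
  -- lattice, with distances scaled by πq/p.
  have e : Real.pi * q * x / p - Real.pi * m.val / p - 2 * Real.pi * n =
      Real.pi / p * q * (x - ((m.val + 2 * p * n : ℤ) : ℝ) / q) := by
    push_cast
    field_simp
    ring
  have hc : 0 < Real.pi / p * q := by positivity
  rw [e, abs_mul, abs_of_pos hc]
  calc η * (Real.pi / p) = Real.pi / p * q * (η / q) := by field_simp
    _ ≤ _ := mul_le_mul_of_nonneg_left h1.le hc.le

/-- At the origin the linear evolution of localized data concentrates at the Talbot times. -/
theorem tsum_quadPhase (hα : Summable fun k => ‖α k‖) (hη : η ≤ 1)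
    (hloc : FourierLocalized α (η * (Real.pi / p))) :
    ∑' k : ℤ, α k * quadPhase p q k = gaussCoeff p q 0 * hatData α 0 := by
  have hp : (0 : ℝ) < p := by exact_mod_cast NeZero.pos p
  have h := tsum_quadPhase_mul (p := p) hα q 0
  simp only [Complex.ofReal_zero, mul_zero, neg_zero, Complex.exp_zero, mul_one] at h
  rw [h, Finset.sum_eq_single 0]
  · simp
  · intro m _ hm
    refine mul_eq_zero_of_right _ (hloc _ fun n => ?_)
    -- For a nonzero residue m, m + 2pn is a nonzero integer, so the evaluation point is at distance
    -- at least π/p from 2πℤ.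
    have hv : (m.val : ℤ) + 2 * p * n ≠ 0 := fun hv => by
      apply hm
      have h2 : (m.val : ZMod (2 * p)) = m := ZMod.natCast_zmod_val m
      have h3 : (((m.val : ℤ) + 2 * p * n : ℤ) : ZMod (2 * p)) = 0 := by rw [hv]; simp
      have h4 : (2 * p : ZMod (2 * p)) = 0 := by exact_mod_cast ZMod.natCast_self (2 * p)
      push_cast at h3
      rw [h4, h2] at h3
      simpa using h3
    have h1 : (1 : ℝ) ≤ |(((m.val : ℤ) + 2 * p * n : ℤ) : ℝ)| := by
      exact_mod_cast Int.one_le_abs hv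
    have e : 0 - Real.pi * m.val / p - 2 * Real.pi * n =
        -(Real.pi / p * (((m.val : ℤ) + 2 * p * n : ℤ) : ℝ)) := by
      push_cast
      field_simp
      ring
    have hc : 0 < Real.pi / p := by positivity
    rw [e, abs_neg, abs_mul, abs_of_pos hc]
    nlinarith
  · simp

end Gauss

end DiracNLS

end

noncomputable section

namespace DiracNLS

open Filter Topology Set
open scoped ENNReal ComplexConjugate FourierTransform SchwartzMap

/-! ### Frequency-localized data -/

/-- Decay of order N + 1 with N ≥ s absorbs the weight and leaves one inverse power of 1 + |k|,
which is square summable. -/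
theorem memL2s_fourier (s : ℝ) (f : 𝓢(ℝ, ℂ)) : MemL2s s fun k => 𝓕 f (k : ℝ) := by
  set N := ⌈s⌉₊ with hN
  obtain ⟨C, hC0, hC⟩ : ∃ C, 0 ≤ C ∧ ∀ x : ℝ, (1 + |x|) ^ (N + 1) * ‖𝓕 f x‖ ≤ C := by
    refine ⟨2 ^ (N + 1) * (Finset.Iic (N + 1, 0)).sup
      (fun m : ℕ × ℕ => SchwartzMap.seminorm ℝ m.1 m.2) (𝓕 f), by positivity, fun x => ?_⟩
    have h := SchwartzMap.one_add_le_sup_seminorm_apply (𝕜 := ℝ) (m := (N + 1, 0)) (k := N + 1)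
      (n := 0) le_rfl le_rfl (𝓕 f) x
    rwa [norm_iteratedFDeriv_zero, Real.norm_eq_abs] at h
  have hsum : Summable fun k : ℤ => C ^ 2 * ((weight 1 k)⁻¹) ^ 2 :=
    (summable_inv_weight_sq (by norm_num : (1 : ℝ) / 2 < 1)).mul_left _
  refine Summable.of_nonneg_of_le (fun k => by positivity) (fun k => ?_) hsum
  rw [← mul_pow]
  have hw := weight_pos s k
  refine pow_le_pow_left₀ (by positivity) ?_ 2
  have h1 : 0 < 1 + |(k : ℝ)| := by positivity
  have h2 : weight s k ≤ (1 + |(k : ℝ)|) ^ N := by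
    rw [weight, ← Real.rpow_natCast]
    exact Real.rpow_le_rpow_of_exponent_le (by linarith [abs_nonneg (k : ℝ)]) (Nat.le_ceil s)
  have h3 : weight 1 k = 1 + |(k : ℝ)| := by rw [weight, Real.rpow_one]
  rw [h3, ← div_eq_mul_inv, le_div_iff₀ h1]
  calc weight s k * ‖𝓕 f (k : ℝ)‖ * (1 + |(k : ℝ)|)
      ≤ (1 + |(k : ℝ)|) ^ N * ‖𝓕 f (k : ℝ)‖ * (1 + |(k : ℝ)|) := by gcongr
    _ = (1 + |(k : ℝ)|) ^ (N + 1) * ‖𝓕 f (k : ℝ)‖ := by ring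
    _ ≤ C := hC k

/-- Poisson summation: integer samples of a Fourier transform are the Fourier coefficients of the
periodization. -/
theorem hatData_fourier (f : 𝓢(ℝ, ℂ)) (ξ : ℝ) :
    hatData (fun k => 𝓕 f (k : ℝ)) ξ = ∑' n : ℤ, f (-(ξ / (2 * Real.pi)) + n) := by
  rw [SchwartzMap.tsum_eq_tsum_fourier]
  refine tsum_congr fun k => ?_
  rw [fourier_coe_apply]
  congr 2
  have : (Real.pi : ℂ) ≠ 0 := by exact_mod_cast Real.pi_ne_zero
  push_cast
  field_simp

/-- Data with Fourier transform equal to `1` at the origin, supported near `2πℤ`, and with a small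
coefficient at the origin. -/
theorem exists_localized_data (s : ℝ) {δ : ℝ} (hδ : 0 < δ) (hδ1 : δ ≤ 1) :
    ∃ β : ℤ → ℂ, MemL2s s β ∧ (∀ r, 2 * Real.pi * δ ≤ r → FourierLocalized β r) ∧
      hatData β 0 = 1 ∧ β 0 ≠ 0 ∧ ‖β 0‖ ≤ 2 * δ := by
  -- The bump equals 1 near 0 and is supported within δ ≤ 1, so at the origin its periodization has
  -- the single nonzero term 1. The coefficient at 0 is its integral, at most 2δ.
  let g : ContDiffBump (0 : ℝ) := ⟨δ / 2, δ, by positivity, by linarith⟩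
  have hgc : HasCompactSupport fun x => (g x : ℂ) :=
    g.hasCompactSupport.comp_left (g := ((↑) : ℝ → ℂ)) Complex.ofReal_zero
  let f : 𝓢(ℝ, ℂ) := hgc.toSchwartzMap (Complex.ofRealCLM.contDiff.comp g.contDiff)
  have hf : ∀ x, f x = (g x : ℂ) := fun x => rfl
  have hf0 : ∀ x, δ ≤ |x| → f x = 0 := fun x hx => by
    rw [hf, g.zero_of_le_dist (by simpa [g] using hx), Complex.ofReal_zero]
  have hint : 𝓕 f ((0 : ℤ) : ℝ) = ((∫ x, g x : ℝ) : ℂ) := by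
    rw [SchwartzMap.fourier_coe, Real.fourier_real_eq_integral_exp_smul, ← integral_complex_ofReal]
    simp [hf]
  refine ⟨fun k => 𝓕 f (k : ℝ), memL2s_fourier s f, fun r hr ξ hξ => ?_, ?_, ?_, ?_⟩
  · rw [hatData_fourier]
    refine (tsum_congr fun n => hf0 _ ?_).trans tsum_zero
    have h1 := hr.trans (hξ n)
    have e : ξ - 2 * Real.pi * n = -(2 * Real.pi * (-(ξ / (2 * Real.pi)) + n)) := by
      field_simp
      ring
    rw [e, abs_neg, abs_mul, abs_of_pos (by positivity : 0 < 2 * Real.pi)] at h1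
    exact le_of_mul_le_mul_left h1 (by positivity)
  · rw [hatData_fourier, tsum_eq_single 0]
    · simp only [zero_div, neg_zero, Int.cast_zero, add_zero, hf]
      rw [g.one_of_mem_closedBall (Metric.mem_closedBall_self g.rIn_pos.le), Complex.ofReal_one]
    · intro n hn
      refine hf0 _ ?_
      simp only [zero_div, neg_zero, zero_add]
      exact hδ1.trans (by exact_mod_cast Int.one_le_abs hn)
  · simp only [hint]
    exact_mod_cast g.integral_pos.ne'
  · simp only [hint]
    rw [Complex.norm_real, Real.norm_of_nonneg g.integral_pos.le]
    refine (g.integral_le_measure_closedBall (μ := MeasureTheory.volume)).trans ?_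
    simp [g, MeasureTheory.measureReal_def, Real.volume_closedBall, hδ.le]

end DiracNLS

end

noncomputable section

namespace DiracNLS

open Filter Topology Set

variable {σ s γ T ε : ℝ} {α : ℤ → ℂ}

/-! ### Comparison with the linear evolution -/

theorem norm_le_norm_apply (hs : 1 / 2 < s) {a : Seq} (ha : ∀ k, a k = weight s k * α k) (k : ℤ) :
    ‖α k‖ ≤ ‖a k‖ := by
  rw [ha, norm_mul, Complex.norm_real, Real.norm_of_nonneg (weight_pos s k).le]
  exact le_mul_of_one_le_left (norm_nonneg _) (one_le_weight hs k)

theorem summable_norm_of_seq (hs : 1 / 2 < s) {a : Seq} (ha : ∀ k, a k = weight s k * α k) :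
    Summable fun k => ‖α k‖ := (summable_inv_weight_mul hs a).congr fun k => by
  have := (weight_pos s k).ne'
  rw [ha, norm_mul, Complex.norm_real, Real.norm_of_nonneg (weight_pos s k).le]
  field_simp

theorem norm_freeDirac {t : ℝ} (ht : 0 < t) (k : ℤ) (x : ℝ) :
    ‖freeDirac k t x‖ = (√(4 * Real.pi * t))⁻¹ := by
  rw [freeDirac, ← rootDen, norm_div, norm_exp_I_mul, norm_rootDen ht, one_div]

/-- The logarithmic phases are a cubic perturbation of the linear evolution. -/
theorem norm_field_sub_linear_le (hs : 1 / 2 < s) (hσ : |σ| ≤ 1) {a : Seq}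
    (ha : ∀ k, a k = weight s k * α k) {t : ℝ} (ht : 0 < t) (x : ℝ) :
    ‖field σ s α t x a - ∑' k, α k * freeDirac k t x‖ ≤
      (√(4 * Real.pi * t))⁻¹ * (|Real.log t| * ‖a‖ ^ 3) := by
  have hS : Summable fun k => α k * freeDirac k t x := Summable.of_norm <|
    ((summable_norm_of_seq hs ha).mul_right (√(4 * Real.pi * t))⁻¹).congr fun k => by
      rw [norm_mul, norm_freeDirac ht]
  rw [field, ← (summable_norm_mode_mul hs ht x a).of_norm.tsum_sub hS]
  -- The phase error satisfies |e^{iθ} - 1| ≤ |α_k|²|log t|. Of the three resulting factors α_k, one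
  -- is bounded by the norm and the other two are summed as a square.
  have hsum : HasSum (fun k => (√(4 * Real.pi * t))⁻¹ * (|Real.log t| * ‖a‖) * ‖a k‖ ^ 2)
      ((√(4 * Real.pi * t))⁻¹ * (|Real.log t| * ‖a‖ ^ 3)) := by
    have h := (seq_summable_sq a).hasSum.mul_left ((√(4 * Real.pi * t))⁻¹ * (|Real.log t| * ‖a‖))
    rw [← seq_norm_sq] at h
    have e : (√(4 * Real.pi * t))⁻¹ * (|Real.log t| * ‖a‖) * ‖a‖ ^ 2 =
        (√(4 * Real.pi * t))⁻¹ * (|Real.log t| * ‖a‖ ^ 3) := by ring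
    rwa [e] at h
  refine tsum_of_norm_bounded hsum fun k => ?_
  set θ : ℝ := -(σ * (‖α k‖ ^ 2 / (4 * Real.pi)) * Real.log (Real.sqrt t)) with hθ
  have e : mode σ s α k t x * a k - α k * freeDirac k t x =
      (Complex.exp (Complex.I * θ) - 1) * α k * freeDirac k t x := by
    rw [ha, mode_mul_weight ht, hθ]
    push_cast
    ring_nf
  have hθle : |θ| ≤ ‖α k‖ ^ 2 * |Real.log t| := by
    rw [hθ, Real.log_sqrt ht.le, abs_neg, abs_mul, abs_mul, abs_div, abs_div,
      abs_of_nonneg (sq_nonneg ‖α k‖), abs_of_pos (by positivity : 0 < 4 * Real.pi),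
      abs_of_pos (by norm_num : (0 : ℝ) < 2)]
    have h4 : (1 : ℝ) ≤ 4 * Real.pi := by linarith [Real.pi_gt_three]
    have h1 : ‖α k‖ ^ 2 / (4 * Real.pi) ≤ ‖α k‖ ^ 2 := div_le_self (sq_nonneg _) h4
    have h2 : |σ| * (‖α k‖ ^ 2 / (4 * Real.pi)) ≤ ‖α k‖ ^ 2 :=
      (mul_le_of_le_one_left (by positivity) hσ).trans h1
    exact mul_le_mul h2 (half_le_self (abs_nonneg _)) (by positivity) (by positivity)
  have h1 := norm_le_norm_apply hs ha k
  have h2 := norm_le_norm_seq hs ha k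
  have h3 : ‖Complex.exp (Complex.I * θ) - 1‖ ≤ ‖α k‖ ^ 2 * |Real.log t| :=
    Real.norm_exp_I_mul_ofReal_sub_one_le.trans hθle
  rw [e, norm_mul, norm_mul, norm_freeDirac ht]
  calc ‖Complex.exp (Complex.I * θ) - 1‖ * ‖α k‖ * (√(4 * Real.pi * t))⁻¹
      ≤ (‖a k‖ ^ 2 * |Real.log t|) * ‖a‖ * (√(4 * Real.pi * t))⁻¹ := by
        refine mul_le_mul_of_nonneg_right (mul_le_mul (h3.trans ?_) h2 (norm_nonneg _)
          (by positivity)) (by positivity)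
        exact mul_le_mul_of_nonneg_right (pow_le_pow_left₀ (norm_nonneg _) h1 2) (abs_nonneg _)
    _ = _ := by ring

/-! ### The Talbot times -/

section Talbot

variable {p q : ℕ}

theorem talbotTime_pos (hp : 1 ≤ p) (hq : 1 ≤ q) : 0 < talbotTime p q := by
  have : (0 : ℝ) < p := by exact_mod_cast hp
  have : (0 : ℝ) < q := by exact_mod_cast hq
  rw [talbotTime]
  positivity

theorem talbotTime_le (hq : 1 ≤ q) : talbotTime p q ≤ p := by
  have h1 : (1 : ℝ) ≤ q := by exact_mod_cast hq
  have h2 : 1 / (2 * Real.pi) ≤ 1 := by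
    rw [div_le_one (by positivity)]
    linarith [Real.pi_gt_three]
  rw [talbotTime]
  calc 1 / (2 * Real.pi) * ((p : ℝ) / q) ≤ 1 * p :=
        mul_le_mul h2 (div_le_self (Nat.cast_nonneg _) h1) (by positivity) zero_le_one
    _ = p := one_mul _

/-- Here 4t = 2p/(πq), so the k² term of (x - k)²/(4t) is the quadratic phase and the cross term is
a frequency linear in x. -/
theorem freeDirac_talbotTime [NeZero p] (hq : 1 ≤ q) (k : ℤ) (x : ℝ) :
    freeDirac k (talbotTime p q) x =
      Complex.exp (Complex.I * ((x ^ 2 / (4 * talbotTime p q) : ℝ) : ℂ)) /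
        rootDen (talbotTime p q) *
        (quadPhase p q k * Complex.exp (-(Complex.I * k * ((Real.pi * q * x / p : ℝ) : ℂ)))) := by
  have hp : (p : ℝ) ≠ 0 := by exact_mod_cast NeZero.ne p
  have hq0 : (q : ℝ) ≠ 0 := by exact_mod_cast (by omega : q ≠ 0)
  have e : (x - k) ^ 2 / (4 * talbotTime p q) =
      x ^ 2 / (4 * talbotTime p q) + Real.pi * q * (k : ℝ) ^ 2 / (2 * p) -
        k * (Real.pi * q * x / p) := by
    rw [talbotTime]
    field_simp
    ring
  have e2 : Complex.exp (Complex.I * (((x - k) ^ 2 / (4 * talbotTime p q) : ℝ) : ℂ)) =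
      Complex.exp (Complex.I * ((x ^ 2 / (4 * talbotTime p q) : ℝ) : ℂ)) *
        (Complex.exp (Complex.I * ((Real.pi * q * (k : ℝ) ^ 2 / (2 * p) : ℝ) : ℂ)) *
        Complex.exp (-(Complex.I * k * ((Real.pi * q * x / p : ℝ) : ℂ)))) := by
    rw [← Complex.exp_add, ← Complex.exp_add, e]
    congr 1
    push_cast
    ring
  rw [freeDirac, ← rootDen, e2, quadPhase_intCast]
  ring

/-- The linear evolution at the Talbot times. -/
theorem tsum_mul_freeDirac_talbotTime [NeZero p] (hq : 1 ≤ q) (x : ℝ) :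
    ∑' k, α k * freeDirac k (talbotTime p q) x =
      Complex.exp (Complex.I * ((x ^ 2 / (4 * talbotTime p q) : ℝ) : ℂ)) /
        rootDen (talbotTime p q) *
      ∑' k : ℤ, α k * quadPhase p q k *
        Complex.exp (-(Complex.I * k * ((Real.pi * q * x / p : ℝ) : ℂ))) := by
  rw [← tsum_mul_left]
  refine tsum_congr fun k => ?_
  rw [freeDirac_talbotTime hq]
  ring

theorem inv_sqrt_talbotTime_le (hp : 1 ≤ p) (hq : 1 ≤ q) :
    (√(4 * Real.pi * talbotTime p q))⁻¹ ≤ √q := by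
  have hp1 : (1 : ℝ) ≤ p := by exact_mod_cast hp
  have hq0 : (0 : ℝ) < q := by exact_mod_cast hq
  rw [← Real.sqrt_inv]
  refine Real.sqrt_le_sqrt ?_
  have e : (4 * Real.pi * talbotTime p q)⁻¹ = q / (2 * p) := by
    rw [talbotTime]
    field_simp
    norm_num
  rw [e]
  exact div_le_self hq0.le (by linarith)

/-- The origin of the logarithm of q in the admissible range of denominators. -/
theorem abs_log_talbotTime_le (hp : 1 ≤ p) (hq : 1 ≤ q) :
    |Real.log (talbotTime p q)| ≤ Real.log q + |Real.log (1 / (2 * Real.pi) * p)| := by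
  have hp0 : (0 : ℝ) < p := by exact_mod_cast hp
  have hq1 : (1 : ℝ) ≤ q := by exact_mod_cast hq
  have e : talbotTime p q = 1 / (2 * Real.pi) * p / q := by rw [talbotTime]; ring
  rw [e, Real.log_div (by positivity) (by positivity)]
  have h := abs_sub (Real.log (1 / (2 * Real.pi) * p)) (Real.log q)
  rw [abs_of_nonneg (Real.log_nonneg hq1)] at h
  linarith

/-- The constant in the comparison of the nonlinear with the linear evolution. -/
def talbotConst (s γ : ℝ) (p : ℕ) : ℝ :=
  1 + |Real.log (1 / (2 * Real.pi) * p)| +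
    √(invWeightSum s) * (16 * growthConst s γ (p + 1) * (p : ℝ) ^ γ)

theorem one_le_talbotConst (hγ : 0 < γ) : 1 ≤ talbotConst s γ p := by
  have h1 := growthConst_nonneg (s := s) hγ
    (by linarith [Nat.cast_nonneg (α := ℝ) p] : (1 : ℝ) ≤ (p : ℝ) + 1)
  have : 0 ≤ √(invWeightSum s) * (16 * growthConst s γ (p + 1) * (p : ℝ) ^ γ) := by positivity
  have := abs_nonneg (Real.log (1 / (2 * Real.pi) * p))
  rw [talbotConst]
  linarith

/-- Solutions at the Talbot times are close to the linear evolution. -/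
theorem IsDiracSolution.norm_sub_linear_le (hs : 1 / 2 < s) (hσ : |σ| ≤ 1) (hγ : 0 < γ)
    (hγ1 : γ < 1) (hp : 1 ≤ p) (hq : 1 ≤ q) (hε : 0 < ε) (hε1 : ε ≤ 1) (hα : MemL2s s α)
    (hn : l2sNorm s α ≤ ε)
    (hsm : 64 * growthConst s γ (p + 1) * (p + 1) * ε ^ 2 ≤ 1) {u : ℝ → ℝ → ℂ}
    (hu : IsDiracSolution σ s γ α T u) (hT : talbotTime p q < T) (x : ℝ) :
    ‖u (talbotTime p q) x - ∑' k, α k * freeDirac k (talbotTime p q) x‖ ≤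
      √q * (Real.log q + talbotConst s γ p) * ε ^ 3 := by
  obtain ⟨a, ha, han⟩ := exists_seq hα
  have haε : ‖a‖ ≤ ε := han.trans_le hn
  -- The existence time p + 1 exceeds every t_{p,q}, which are all at most p.
  have hT₀ : (1 : ℝ) ≤ (p : ℝ) + 1 := by linarith [Nat.cast_nonneg (α := ℝ) p]
  have ht := talbotTime_pos hp hq
  have htp : talbotTime p q ≤ p := talbotTime_le hq
  obtain ⟨w, hw, huw⟩ := hu.exists_field_of_small hs hσ hγ hγ1 hT₀ hε hε1 ha haε hsm ht hT
    (by linarith)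
  have hG := growthConst_nonneg (s := s) hγ hT₀
  have h1 := norm_field_sub_linear_le hs hσ ha ht x
  have h2 := norm_field_le (σ := σ) (α := α) hs ht x w
  have h3 : ‖w‖ ≤ 16 * growthConst s γ (p + 1) * (p : ℝ) ^ γ * ε ^ 3 := by
    refine hw.trans ?_
    rw [remRadius]
    calc 16 * growthConst s γ (p + 1) * ε ^ 3 * talbotTime p q ^ γ
        ≤ 16 * growthConst s γ (p + 1) * ε ^ 3 * (p : ℝ) ^ γ :=
          mul_le_mul_of_nonneg_left (Real.rpow_le_rpow ht.le htp hγ.le) (by positivity)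
      _ = _ := by ring
  have h4 := abs_log_talbotTime_le hp hq
  have h5 : ‖a‖ ^ 3 ≤ ε ^ 3 := pow_le_pow_left₀ (norm_nonneg _) haε 3
  have hlog : 0 ≤ Real.log q := Real.log_nonneg (by exact_mod_cast hq)
  set A := |Real.log (1 / (2 * Real.pi) * (p : ℝ))| with hA
  set G := 16 * growthConst s γ (p + 1) * (p : ℝ) ^ γ with hGdef
  rw [huw x, field_add hs ht, add_sub_right_comm]
  calc _ ≤ _ := norm_add_le _ _
    _ ≤ _ := add_le_add h1 h2
    _ = (√(4 * Real.pi * talbotTime p q))⁻¹ *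
        (|Real.log (talbotTime p q)| * ‖a‖ ^ 3 + √(invWeightSum s) * ‖w‖) := by ring
    _ ≤ √q * ((Real.log q + A) * ε ^ 3 + √(invWeightSum s) * (G * ε ^ 3)) := by
        refine mul_le_mul (inv_sqrt_talbotTime_le hp hq) (add_le_add ?_ ?_) (by positivity)
          (by positivity)
        · exact mul_le_mul h4 h5 (by positivity) (by positivity)
        · exact mul_le_mul_of_nonneg_left h3 (by positivity)
    _ = √q * (Real.log q + (A + √(invWeightSum s) * G)) * ε ^ 3 := by ring
    _ ≤ √q * (Real.log q + talbotConst s γ p) * ε ^ 3 := by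
        rw [talbotConst, ← hA, ← hGdef]
        gcongr
        linarith

end Talbot

end DiracNLS

end

noncomputable section

namespace DiracNLS

open Filter Topology Set

variable {σ s γ : ℝ} {p : ℕ}

/-! ### Scaling of the data -/

section Scaling

variable {α : ℤ → ℂ}

theorem MemL2s.const_mul (h : MemL2s s α) (c : ℂ) : MemL2s s fun k => c * α k :=
  (Summable.mul_left (‖c‖ ^ 2) h).congr fun k => by rw [norm_mul]; ring

theorem l2sNorm_const_mul (s : ℝ) (α : ℤ → ℂ) (c : ℂ) :
    l2sNorm s (fun k => c * α k) = ‖c‖ * l2sNorm s α := by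
  have e : ∀ k : ℤ, (weight s k * ‖c * α k‖) ^ 2 = ‖c‖ ^ 2 * (weight s k * ‖α k‖) ^ 2 :=
    fun k => by rw [norm_mul]; ring
  simp only [l2sNorm, e]
  rw [tsum_mul_left, Real.sqrt_mul (sq_nonneg _), Real.sqrt_sq (norm_nonneg _)]

theorem hatData_const_mul (α : ℤ → ℂ) (c : ℂ) (ξ : ℝ) :
    hatData (fun k => c * α k) ξ = c * hatData α ξ := by
  simp only [hatData, mul_assoc, tsum_mul_left]

theorem FourierLocalized.const_mul {r : ℝ} (h : FourierLocalized α r) (c : ℂ) :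
    FourierLocalized (fun k => c * α k) r := fun ξ hξ => by
  rw [hatData_const_mul, h ξ hξ, mul_zero]

theorem norm_le_l2sNorm (hs : 1 / 2 < s) (h : MemL2s s α) (k : ℤ) : ‖α k‖ ≤ l2sNorm s α := by
  obtain ⟨a, ha, han⟩ := exists_seq h
  exact (norm_le_norm_seq hs ha k).trans_eq han

end Scaling

/-- Below this size of the data, the solution theory applies up to the time `p + 1`, and the
comparison with the linear evolution is effective for bounded denominators. -/
theorem exists_small (s : ℝ) (hγ : 0 < γ) (p : ℕ) : ∃ ε₀ ∈ Ioo (0 : ℝ) 1, ∀ ε, 0 < ε → ε ≤ ε₀ →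
    64 * growthConst s γ (p + 1) * (p + 1) * ε ^ 2 ≤ 1 ∧
    Real.exp (talbotConst s γ p) * (2 * talbotConst s γ p) * ε ^ 2 ≤ 1 := by
  have hT₀ : (1 : ℝ) ≤ (p : ℝ) + 1 := by linarith [Nat.cast_nonneg (α := ℝ) p]
  have hG := growthConst_nonneg (s := s) hγ hT₀
  have hD := one_le_talbotConst (s := s) (p := p) hγ
  set A := 64 * growthConst s γ (p + 1) * (p + 1) with hA
  set D := Real.exp (talbotConst s γ p) * (2 * talbotConst s γ p) with hDdef
  have hA0 : 0 ≤ A := by positivity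
  have hD0 : 0 ≤ D := by positivity
  have hpos : 0 < 2 + A + D := by positivity
  refine ⟨(2 + A + D)⁻¹, ⟨by positivity, inv_lt_one_of_one_lt₀ (by linarith)⟩,
    fun ε hε hεle => ?_⟩
  have h1 : (2 + A + D) * ε ≤ 1 := by
    rw [← mul_inv_cancel₀ hpos.ne']
    exact mul_le_mul_of_nonneg_left hεle hpos.le
  have h2 : ε ≤ 1 := by nlinarith
  constructor <;> nlinarith [mul_nonneg hA0 hε.le, mul_nonneg hD0 hε.le]

/-- Away from the lattice, solutions with localized data are small at the Talbot times. -/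
theorem IsDiracSolution.norm_le_of_fourierLocalized (hs : 1 / 2 < s) (hσ : |σ| ≤ 1) (hγ : 0 < γ)
    (hγ1 : γ < 1) (hp : 1 ≤ p) {ε : ℝ} (hε : 0 < ε) (hε1 : ε ≤ 1)
    (hsm : 64 * growthConst s γ (p + 1) * (p + 1) * ε ^ 2 ≤ 1)
    (hsm2 : Real.exp (talbotConst s γ p) * (2 * talbotConst s γ p) * ε ^ 2 ≤ 1)
    {α : ℤ → ℂ} (hα : MemL2s s α) (hn : l2sNorm s α ≤ ε) {Q : ℝ}
    (hQ : ε ^ 2 * √Q * Real.log Q < 1 / 2) {η : ℝ}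
    (hloc : FourierLocalized α (η * (Real.pi / p))) {T : ℝ} {u : ℝ → ℝ → ℂ}
    (hu : IsDiracSolution σ s γ α T u) {q : ℕ} (hq : 1 ≤ q) (hqQ : (q : ℝ) ≤ Q)
    (hT : talbotTime p q < T) {x : ℝ} (hx : η / q < Metric.infDist x (lattice q)) :
    ‖u (talbotTime p q) x‖ ≤ ε := by
  have : NeZero p := ⟨by omega⟩
  obtain ⟨a, ha, -⟩ := exists_seq hα
  have h := hu.norm_sub_linear_le hs hσ hγ hγ1 hp hq hε hε1 hα hn hsm hT x
  rw [tsum_mul_freeDirac_talbotTime hq, tsum_quadPhase_mul_eq_zero (summable_norm_of_seq hs ha) hq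
    hloc hx, mul_zero, sub_zero] at h
  refine h.trans ?_
  have hD := one_le_talbotConst (s := s) (p := p) hγ
  set D := talbotConst s γ p
  have hq1 : (1 : ℝ) ≤ q := by exact_mod_cast hq
  have hlog : 0 ≤ Real.log q := Real.log_nonneg hq1
  have hsq : 1 ≤ √(q : ℝ) := Real.one_le_sqrt.2 hq1
  suffices h : √(q : ℝ) * (Real.log q + D) * ε ^ 2 ≤ 1 by
    calc √(q : ℝ) * (Real.log q + D) * ε ^ 3 = (√(q : ℝ) * (Real.log q + D) * ε ^ 2) * ε := by ring
      _ ≤ 1 * ε := mul_le_mul_of_nonneg_right h hε.le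
      _ = ε := one_mul ε
  -- When log q dominates the constant, the sum is at most 2√q log q and the hypothesis on Q
  -- suffices. Otherwise q ≤ e^D is bounded, and the smallness of ε depending on p, s and γ takes
  -- over.
  rcases le_total D (Real.log q) with hcase | hcase
  · have h1 : √(q : ℝ) * Real.log q ≤ √Q * Real.log Q :=
      mul_le_mul (Real.sqrt_le_sqrt hqQ) (Real.log_le_log (by linarith) hqQ) hlog
        (Real.sqrt_nonneg _)
    calc √(q : ℝ) * (Real.log q + D) * ε ^ 2
        ≤ √(q : ℝ) * (Real.log q + Real.log q) * ε ^ 2 := by gcongr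
      _ = 2 * ε ^ 2 * (√(q : ℝ) * Real.log q) := by ring
      _ ≤ 2 * ε ^ 2 * (√Q * Real.log Q) := by gcongr
      _ ≤ 1 := by linarith
  · have h1 : √(q : ℝ) ≤ Real.exp D := by
      have h2 : (q : ℝ) ≤ Real.exp D := by
        rw [← Real.exp_log (by linarith : (0 : ℝ) < q)]
        exact Real.exp_le_exp.2 hcase
      have h3 : √(q : ℝ) ≤ q := by nlinarith [Real.sq_sqrt (by linarith : (0 : ℝ) ≤ q)]
      exact h3.trans h2
    calc √(q : ℝ) * (Real.log q + D) * ε ^ 2 ≤ Real.exp D * (D + D) * ε ^ 2 := by gcongr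
      _ = Real.exp D * (2 * D) * ε ^ 2 := by ring
      _ ≤ 1 := hsm2

/-- At the origin, the amplitude of solutions with localized data at the Talbot times. -/
theorem IsDiracSolution.le_norm_div_freeDirac (hs : 1 / 2 < s) (hσ : |σ| ≤ 1) (hγ : 0 < γ)
    (hγ1 : γ < 1) [NeZero p] {ε : ℝ} (hε : 0 < ε) (hε1 : ε ≤ 1)
    (hsm : 64 * growthConst s γ (p + 1) * (p + 1) * ε ^ 2 ≤ 1)
    {α : ℤ → ℂ} (hα : MemL2s s α) (hn : l2sNorm s α ≤ ε) {η : ℝ} (hη : η ≤ 1)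
    (hloc : FourierLocalized α (η * (Real.pi / p))) {T : ℝ} {u : ℝ → ℝ → ℂ}
    (hu : IsDiracSolution σ s γ α T u) {q : ℕ} (hq : 1 ≤ q) (hT : talbotTime p q < T) :
    (‖gaussCoeff p q 0‖ * ‖hatData α 0‖ -
      √(4 * Real.pi * talbotTime p q) * (√q * (Real.log q + talbotConst s γ p)) * ε ^ 3) / ‖α 0‖ ≤
    ‖u (talbotTime p q) 0 / (α 0 * freeDirac 0 (talbotTime p q) 0)‖ := by
  have hp : 1 ≤ p := NeZero.one_le
  obtain ⟨a, ha, -⟩ := exists_seq hα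
  have ht := talbotTime_pos hp hq
  have h := hu.norm_sub_linear_le hs hσ hγ hγ1 hp hq hε hε1 hα hn hsm hT 0
  rw [tsum_mul_freeDirac_talbotTime hq] at h
  simp only [mul_zero, zero_div, Complex.ofReal_zero, neg_zero, Complex.exp_zero, mul_one] at h
  rw [tsum_quadPhase (summable_norm_of_seq hs ha) hη hloc] at h
  have hrt : 0 < √(4 * Real.pi * talbotTime p q) := by positivity
  have h1 := (norm_sub_norm_le _ _).trans ((norm_sub_rev _ _).trans_le h)
  have h0 : (0 : ℝ) ^ 2 / (4 * talbotTime p q) = 0 := by simp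
  simp only [h0, Complex.ofReal_zero, mul_zero, Complex.exp_zero, norm_mul, norm_div, norm_one,
    norm_rootDen ht] at h1
  rw [norm_div, norm_mul, norm_freeDirac ht, div_mul_eq_div_div, div_inv_eq_mul, div_mul_eq_mul_div]
  refine div_le_div_of_nonneg_right ?_ (norm_nonneg _)
  -- Multiplication by √(4πt) removes the common amplitude of the free modes.
  have h2 := mul_le_mul_of_nonneg_left h1 hrt.le
  have e : √(4 * Real.pi * talbotTime p q) *
      (1 / √(4 * Real.pi * talbotTime p q) * (‖gaussCoeff p q 0‖ * ‖hatData α 0‖) -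
        ‖u (talbotTime p q) 0‖) =
      ‖gaussCoeff p q 0‖ * ‖hatData α 0‖ -
        ‖u (talbotTime p q) 0‖ * √(4 * Real.pi * talbotTime p q) := by
    field_simp
  rw [e] at h2
  linarith

/-- Small localized data whose Fourier transform at the origin dominates the coefficient at the
origin and the cube of the norm. -/
theorem exists_concentrating_data (hs : 1 / 2 < s) {ε₀ δ : ℝ} (hε₀ : 0 < ε₀) (hε₀1 : ε₀ ≤ 1)
    (hδ : 0 < δ) (hδ1 : δ ≤ 1) :
    ∃ α : ℤ → ℂ, MemL2s s α ∧ (∀ r, 2 * Real.pi * δ ≤ r → FourierLocalized α r) ∧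
      0 < l2sNorm s α ∧ l2sNorm s α ≤ ε₀ * δ ∧ l2sNorm s α ^ 3 ≤ δ * ‖hatData α 0‖ ∧
      α 0 ≠ 0 ∧ ‖α 0‖ ≤ 2 * δ * ‖hatData α 0‖ := by
  obtain ⟨β, hβ, hloc, h1, h0, hle⟩ := exists_localized_data s hδ hδ1
  set n := l2sNorm s β with hn
  have hn0 : 0 < n := (norm_pos_iff.2 h0).trans_le (norm_le_l2sNorm hs hβ 0)
  -- With this scaling both cn and cn² are at most ε₀δ. The cube of the norm is then at most δ times
  -- c, the value of the Fourier transform at the origin.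
  set c : ℝ := ε₀ * δ / (1 + n ^ 2) with hc
  have hc0 : 0 < c := by positivity
  have hcn : ‖(c : ℂ)‖ = c := by rw [Complex.norm_real, Real.norm_of_nonneg hc0.le]
  have hcN : c * (1 + n ^ 2) = ε₀ * δ := by rw [hc]; field_simp
  have hed : ε₀ * δ ≤ δ := mul_le_of_le_one_left hδ.le hε₀1
  have hcn1 : c * n ≤ ε₀ * δ := by
    rw [← hcN]
    exact mul_le_mul_of_nonneg_left (by nlinarith) hc0.le
  have hcn2 : c * n ^ 2 ≤ ε₀ * δ := by
    rw [← hcN]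
    exact mul_le_mul_of_nonneg_left (by linarith) hc0.le
  refine ⟨fun k => c * β k, hβ.const_mul c, fun r hr => (hloc r hr).const_mul c, ?_⟩
  rw [l2sNorm_const_mul, hatData_const_mul, h1, mul_one, hcn, ← hn]
  refine ⟨by positivity, hcn1, ?_, ?_, ?_⟩
  · calc (c * n) ^ 3 = (c * n ^ 2) * (c * n) * c := by ring
      _ ≤ (ε₀ * δ) * (ε₀ * δ) * c := by gcongr
      _ ≤ 1 * δ * c := by
        refine mul_le_mul_of_nonneg_right (mul_le_mul (hed.trans hδ1) hed ?_ zero_le_one) hc0.le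
        positivity
      _ = δ * c := by ring
  · exact mul_ne_zero (by exact_mod_cast hc0.ne') h0
  · rw [norm_mul, hcn]
    calc c * ‖β 0‖ ≤ c * (2 * δ) := mul_le_mul_of_nonneg_left hle hc0.le
      _ = 2 * δ * c := by ring

theorem tendsto_inv_one_add_abs : Tendsto (fun l : ℝ => (1 + |l|)⁻¹) atTop (𝓝 0) :=
  tendsto_inv_atTop_zero.comp (tendsto_atTop_add_const_left _ _ tendsto_abs_atTop_atTop)

/-- Concentration at the origin along families of solutions with concentrating data. -/
theorem tendsto_norm_div_freeDirac (hs : 1 / 2 < s) (hσ : |σ| ≤ 1) (hγ : 0 < γ)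
    (hγ1 : γ < 1) [NeZero p] {ε₀ : ℝ} (hε₀1 : ε₀ ≤ 1)
    (hsm : ∀ ε, 0 < ε → ε ≤ ε₀ → 64 * growthConst s γ (p + 1) * (p + 1) * ε ^ 2 ≤ 1)
    {ι : Type*} {L : Filter ι} {δ : ι → ℝ} (hδ : ∀ l, 0 < δ l) (hδ0 : Tendsto δ L (𝓝 0))
    {α : ι → ℤ → ℂ} (hα : ∀ l, MemL2s s (α l)) (hpos : ∀ l, 0 < l2sNorm s (α l))
    (hle : ∀ l, l2sNorm s (α l) ≤ ε₀)
    (hcube : ∀ l, l2sNorm s (α l) ^ 3 ≤ δ l * ‖hatData (α l) 0‖)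
    (hne : ∀ l, α l 0 ≠ 0) (hzero : ∀ l, ‖α l 0‖ ≤ 2 * δ l * ‖hatData (α l) 0‖)
    (hloc : ∀ᶠ l in L, FourierLocalized (α l) (1 * (Real.pi / p)))
    {T : ι → ℝ} {u : ι → ℝ → ℝ → ℂ} (hu : ∀ l, IsDiracSolution σ s γ (α l) (T l) (u l))
    {q : ℕ} (hq : Odd q) (hT : ∀ l, talbotTime p q < T l) :
    Tendsto (fun l => ‖u l (talbotTime p q) 0 / (α l 0 * freeDirac 0 (talbotTime p q) 0)‖)
      L atTop := by
  set G := ‖gaussCoeff p q 0‖ with hG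
  have hG0 : 0 < G := norm_pos_iff.2 (gaussCoeff_zero_ne_zero hq)
  set A := √(4 * Real.pi * talbotTime p q) * (√q * (Real.log q + talbotConst s γ p)) with hA
  have hq1 : 1 ≤ q := hq.pos
  have hA0 : 0 ≤ A := by
    have := one_le_talbotConst (s := s) (p := p) hγ
    have : 0 ≤ Real.log q := Real.log_natCast_nonneg q
    positivity
  have hev : ∀ᶠ l in L, A * δ l ≤ G / 2 := by
    have h := hδ0.const_mul A
    rw [mul_zero] at h
    exact (h.eventually_lt_const (half_pos hG0)).mono fun l hl => hl.le
  have hlim : Tendsto (fun l => G / 4 * (δ l)⁻¹) L atTop :=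
    (tendsto_inv_nhdsGT_zero.comp (tendsto_nhdsWithin_iff.2
      ⟨hδ0, Eventually.of_forall hδ⟩)).const_mul_atTop (by positivity)
  refine tendsto_atTop_mono' L ?_ hlim
  filter_upwards [hev, hloc] with l h1 h2
  have h3 := (hu l).le_norm_div_freeDirac hs hσ hγ hγ1 (hpos l) ((hle l).trans hε₀1)
    (hsm _ (hpos l) (hle l)) (hα l) le_rfl le_rfl h2 hq1 (hT l)
  refine le_trans ?_ h3
  rw [← hA, ← hG]
  have hα0 : 0 < ‖α l 0‖ := norm_pos_iff.2 (hne l)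
  rw [le_div_iff₀ hα0]
  have hδl := hδ l
  -- The nonlinear error takes at most half of the Gauss sum term. Since α₀ is at most 2δ times the
  -- Fourier transform at the origin, the ratio is at least G/(4δ).
  calc G / 4 * (δ l)⁻¹ * ‖α l 0‖ ≤ G / 4 * (δ l)⁻¹ * (2 * δ l * ‖hatData (α l) 0‖) :=
        mul_le_mul_of_nonneg_left (hzero l) (by positivity)
    _ = G * ‖hatData (α l) 0‖ - G / 2 * ‖hatData (α l) 0‖ := by field_simp; ring
    _ ≤ G * ‖hatData (α l) 0‖ - A * (δ l * ‖hatData (α l) 0‖) := by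
        have := mul_le_mul_of_nonneg_right h1 (norm_nonneg (hatData (α l) 0))
        linarith
    _ ≤ G * ‖hatData (α l) 0‖ - A * l2sNorm s (α l) ^ 3 := by
        have := mul_le_mul_of_nonneg_left (hcube l) hA0
        linarith

theorem exists_forall_sq_mul_lt (N : ℝ) : ∃ δ > 0, ∀ ε : ℝ, 0 < ε → ε < δ →
    ε ^ 2 * √N * Real.log N < 1 / 2 := by
  set B := |√N * Real.log N| with hB
  have hB0 : 0 ≤ B := abs_nonneg _
  have hpos : 0 < 2 + 2 * B := by positivity
  refine ⟨(2 + 2 * B)⁻¹, by positivity, fun ε hε hlt => ?_⟩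
  have h1 : (2 + 2 * B) * ε < 1 := by
    rw [← mul_inv_cancel₀ hpos.ne']
    exact mul_lt_mul_of_pos_left hlt hpos
  have h2 : √N * Real.log N ≤ B := le_abs_self _
  have h3 : ε < 1 := by nlinarith
  rw [mul_assoc]
  calc ε ^ 2 * (√N * Real.log N) ≤ ε ^ 2 * B := mul_le_mul_of_nonneg_left h2 (sq_nonneg _)
    _ ≤ ε * B := mul_le_mul_of_nonneg_right (by nlinarith) hB0
    _ < 1 / 2 := by linarith

end DiracNLS

end

/-! ### Assembly of the three statements -/

theorem proposition3p2
    (σ : ℝ) (hσ : σ = 1 ∨ σ = -1) (p : ℕ) (hp : 1 ≤ p)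
    (s : ℝ) (hs : 1 / 2 < s) (γ : ℝ) (hγ : γ ∈ Set.Ioo (0 : ℝ) 1) :
    -- almost vanishing away from the lattice
    (∃ ε₀ ∈ Set.Ioo (0 : ℝ) 1, ∀ ε : ℝ, 0 < ε → ε < ε₀ →
      ∀ α : ℤ → ℂ, DiracNLS.MemL2s s α → DiracNLS.l2sNorm s α ≤ ε →
        (∃ T : ℝ, DiracNLS.talbotTime p 1 < T ∧
          ∃ u : ℝ → ℝ → ℂ, DiracNLS.IsDiracSolution σ s γ α T u) ∧
        ∀ qε : ℝ, ε ^ 2 * Real.sqrt qε * Real.log qε < 1 / 2 →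
          ∀ η ∈ Set.Ioo (0 : ℝ) 1, DiracNLS.FourierLocalized α (η * (Real.pi / p)) →
            ∀ (T : ℝ) (u : ℝ → ℝ → ℂ), DiracNLS.IsDiracSolution σ s γ α T u →
              ∀ q : ℕ, Odd q → 1 ≤ q → (q : ℝ) ≤ qε → DiracNLS.talbotTime p q < T →
                ∀ x : ℝ, η / q < Metric.infDist x (DiracNLS.lattice q) →
                  ‖u (DiracNLS.talbotTime p q) x‖ ≤ ε) ∧
    -- the admissible bound on `q` can be taken arbitrarily large as `ε → 0`
    (∀ N : ℝ, ∃ δ > 0, ∀ ε : ℝ, 0 < ε → ε < δ →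
      ε ^ 2 * Real.sqrt N * Real.log N < 1 / 2) ∧
    -- concentration on the lattice
    (∃ α : ℝ → ℤ → ℂ,
      (∀ l : ℝ, DiracNLS.MemL2s s (α l)) ∧
      Filter.Tendsto (fun l => DiracNLS.l2sNorm s (α l)) Filter.atTop (nhds 0) ∧
      (∀ η ∈ Set.Ioo (0 : ℝ) 1, ∀ᶠ l in Filter.atTop,
        DiracNLS.FourierLocalized (α l) (η * (Real.pi / p))) ∧
      (∀ l : ℝ, ∃ T : ℝ, DiracNLS.talbotTime p 1 < T ∧
        ∃ u : ℝ → ℝ → ℂ, DiracNLS.IsDiracSolution σ s γ (α l) T u) ∧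
      ∀ (T : ℝ → ℝ) (u : ℝ → ℝ → ℝ → ℂ),
        (∀ l : ℝ, DiracNLS.IsDiracSolution σ s γ (α l) (T l) (u l)) →
        ∀ q : ℕ, Odd q → (∀ l : ℝ, DiracNLS.talbotTime p q < T l) →
          Filter.Tendsto
            (fun l => ‖u l (DiracNLS.talbotTime p q) 0 /
              (α l 0 * DiracNLS.freeDirac 0 (DiracNLS.talbotTime p q) 0)‖)
            Filter.atTop Filter.atTop) := by
  obtain ⟨hγ0, hγ1⟩ := hγ
  have hσ1 : |σ| ≤ 1 := by rcases hσ with rfl | rfl <;> simp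
  have : NeZero p := ⟨by omega⟩
  have hp0 : (0 : ℝ) < p := by exact_mod_cast hp
  have hT₀ : (1 : ℝ) ≤ (p : ℝ) + 1 := by linarith
  have hTp : DiracNLS.talbotTime p 1 < (p : ℝ) + 1 :=
    (DiracNLS.talbotTime_le le_rfl).trans_lt (by linarith)
  obtain ⟨ε₀, hε₀, hsmall⟩ := DiracNLS.exists_small s hγ0 p
  refine ⟨⟨ε₀, hε₀, fun ε hε hεlt α hα hn => ?_⟩, DiracNLS.exists_forall_sq_mul_lt, ?_⟩
  · obtain ⟨hsm, hsm2⟩ := hsmall ε hε hεlt.le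
    have hε1 : ε ≤ 1 := hεlt.le.trans hε₀.2.le
    refine ⟨⟨p + 1, hTp, DiracNLS.exists_isDiracSolution hs hσ1 hγ0 hγ1 hT₀ hε.le hε1 hα hn hsm⟩,
      fun Q hQ η _ hloc T u hu q _ hq hqQ hT x hx => ?_⟩
    exact hu.norm_le_of_fourierLocalized hs hσ1 hγ0 hγ1 hp hε hε1 hsm hsm2 hα hn hQ hloc hq hqQ hT
      hx
  -- The width of the bump at parameter λ is 1/(1 + |λ|), admissible for every real λ and tending to
  -- 0.
  · have hδ : ∀ l : ℝ, 0 < (1 + |l|)⁻¹ := fun l => by positivity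
    have hδ1 : ∀ l : ℝ, (1 + |l|)⁻¹ ≤ 1 := fun l =>
      inv_le_one_of_one_le₀ (by linarith [abs_nonneg l])
    have hδ0 := DiracNLS.tendsto_inv_one_add_abs
    choose α hα hloc hpos hle hcube hne hzero using fun l : ℝ =>
      DiracNLS.exists_concentrating_data hs hε₀.1 hε₀.2.le (hδ l) (hδ1 l)
    have hle' : ∀ l, DiracNLS.l2sNorm s (α l) ≤ ε₀ := fun l =>
      (hle l).trans (mul_le_of_le_one_right hε₀.1.le (hδ1 l))
    -- Stated for every η > 0, not only η < 1: the concentration uses η = 1.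
    have hev : ∀ η : ℝ, 0 < η →
        ∀ᶠ l in Filter.atTop, DiracNLS.FourierLocalized (α l) (η * (Real.pi / p)) := fun η hη => by
      have h := hδ0.const_mul (2 * Real.pi)
      rw [mul_zero] at h
      exact (h.eventually_lt_const (by positivity : 0 < η * (Real.pi / p))).mono
        fun l hl => hloc l _ hl.le
    refine ⟨α, hα, ?_, fun η hη => hev η hη.1, fun l => ?_, fun T u hu q hq hT => ?_⟩
    · have h := hδ0.const_mul ε₀
      rw [mul_zero] at h
      exact squeeze_zero (fun l => (hpos l).le) hle h
    · exact ⟨p + 1, hTp, DiracNLS.exists_isDiracSolution hs hσ1 hγ0 hγ1 hT₀ (hpos l).le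
        ((hle' l).trans hε₀.2.le) (hα l) le_rfl (hsmall _ (hpos l) (hle' l)).1⟩
    · exact DiracNLS.tendsto_norm_div_freeDirac hs hσ1 hγ0 hγ1 hε₀.2.le
        (fun ε h h' => (hsmall ε h h').1) hδ hδ0 hα hpos hle' hcube hne hzero (hev 1 one_pos) hu hq
        hT
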